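/- **Setting.** Let $n,d\ge 1$ be integers. For a customer $c\in\{1,\dots,n\}$ let $X_c\subseteq\mathbb{R}^d_{\ge 0}$ be a non-empty closed convex set, and let $X=\sum_{c=1}^n X_c$ (Minkowski sum). Let $\beta\in\mathbb{R}^d_{\ge0}$ with $\beta_1\ge\dots\ge\beta_d$ and $\sum_i\beta_i=1$, and let $\|x\|_\beta=\sum_{i=1}^d\beta_i\,(|x|^{\downarrow})_i$ be the corresponding (normalized) ordered norm, where $|x|^{\downarrow}$ lists the absolute values of the entries of $x$ in non-increasing order. Put $\mathrm{OPT}=\inf_{x\in X}\|x\|_\beta$. A convex differentiable function $\Psi:\mathbb{R}^d_{\ge 0}\to\mathbb{R}_{\ge 0}$ is a *$(\delta,\eta)$-approximation* of $\|\cdot\|_\beta$ if $\|x\|_\beta\le\Psi(x)\le\|x\|_\beta+\delta$ and $\nabla\Psi(x+y)\le \exp(\eta\|y\|_\infty)\,\nabla\Psi(x)$ (entrywise) for all $x,y\in\mathbb{R}^d_{\ge 0}$. A *linear minimization oracle* for $X_c$ is a function that maps each price vector $y\in\mathbb{R}^d_{\ge0}$ to a minimizer of $\langle y,\cdot\rangle$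 over $X_c$, provided that there is one. A *randomized algorithm in the oracle model* is an adaptive procedure that in each step evaluates $\nabla\Psi$ at a point of its choice, or calls the oracle of a customer of its choice with a price vector of its choice, or draws a random element of a finite set from a distribution of its choice, or stops and outputs a vector. Its choices may depend in any way on $n$, $d$, $\varepsilon$ and all answers received so far, but it has no other access to $\beta$, $\Psi$ and the sets $X_c$. Gradient evaluations and oracle calls (of all customers together) are counted; other computations are not. **Theorem.** There are an absolute constant $K>0$ and, for all $n,d\ge1$ and $\varepsilon\in(0,1]$, a randomized algorithm in the oracle model such that, with $$\Omega^*=K\,(n+d)\,\log(n+d)\,\bigl(\varepsilon^{-2}+\log\log d\bigr)$$ (natural logarithms, and $\log\log d:=0$ if $d=1$), the following holds for every normalized ordered norm $\|\cdot\|_\beta$ on $\mathbb{R}^d$, every $(\ln d,1)$-approximation $\Psi$ of it, all sets $X_1,\dots,X_n$ as above and all linear minimization oracles for them: 1. the algorithm always outputs some $x\in X$ with $\|x\|_\beta\le(1+\varepsilon)\,\mathrm{OPT}$; 2. it always makes at most $\Omega^*$ gradient evaluations of $\Psi$ and at most $n\Omega^*$ oracle calls; 3. it makes more than $\Omega^*$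 oracle calls with probability at most $(nd)^{-18}$. -/

import Mathlib

open scoped ENNReal

/-- The entries of `|x|`, sorted in non-increasing order. -/
noncomputable def sortedAbs {d : ℕ} (x : Fin d → ℝ) : Fin d → ℝ :=
  fun i => |x (Tuple.sort (fun j => -|x j|) i)|

/-- Weight vectors of normalized ordered norms: non-negative, sorted in non-increasing order,
with entries summing to one. -/
structure IsOrderedWeight {d : ℕ} (β : Fin d → ℝ) : Prop where
  nonneg : ∀ i, 0 ≤ β i
  antitone : Antitone β
  sum_eq_one : ∑ i, β i = 1

/-- The ordered norm with weight vector `β`. -/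
noncomputable def orderedNorm {d : ℕ} (β x : Fin d → ℝ) : ℝ :=
  ∑ i, β i * sortedAbs x i

/-- The gradient of a function on the non-negative orthant `Set.Ici 0`. At boundary points the
derivative is taken within the orthant, where it is still unique. -/
noncomputable def orthantGradient {d : ℕ} (Ψ : (Fin d → ℝ) → ℝ) (x : Fin d → ℝ) : Fin d → ℝ :=
  fun i => fderivWithin ℝ Ψ (Set.Ici 0) x (Pi.single i 1)

/-- `Ψ` is a `(δ, η)`-approximation of the ordered norm with weights `β`. Only the values of `Ψ` on
the non-negative orthant matter. The norm `‖y‖` on `Fin d → ℝ` is the maximum norm. -/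
structure IsNormApprox {d : ℕ} (δ η : ℝ) (β : Fin d → ℝ) (Ψ : (Fin d → ℝ) → ℝ) : Prop where
  differentiableOn : DifferentiableOn ℝ Ψ (Set.Ici 0)
  convexOn : ConvexOn ℝ (Set.Ici 0) Ψ
  nonneg : ∀ x, 0 ≤ x → 0 ≤ Ψ x
  lower : ∀ x, 0 ≤ x → orderedNorm β x ≤ Ψ x
  upper : ∀ x, 0 ≤ x → Ψ x ≤ orderedNorm β x + δ
  gradient_le : ∀ x y, 0 ≤ x → 0 ≤ y →
    orthantGradient Ψ (x + y) ≤ Real.exp (η * ‖y‖) • orthantGradient Ψ x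

/-- The set of ways to serve one customer: a non-empty closed convex set of non-negative vectors. -/
structure IsCustomerSet {d : ℕ} (Xc : Set (Fin d → ℝ)) : Prop where
  nonempty : Xc.Nonempty
  isClosed : IsClosed Xc
  convex : Convex ℝ Xc
  nonneg : ∀ x ∈ Xc, 0 ≤ x

/-- The Minkowski sum of the sets `X c`. -/
def feasibleSet {n d : ℕ} (X : Fin n → Set (Fin d → ℝ)) : Set (Fin d → ℝ) :=
  {x | ∃ s : Fin n → Fin d → ℝ, (∀ c, s c ∈ X c) ∧ x = ∑ c, s c}

/-- The optimum value of the ordered norm over the feasible set. -/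
noncomputable def optValue {n d : ℕ} (β : Fin d → ℝ) (X : Fin n → Set (Fin d → ℝ)) : ℝ :=
  sInf (orderedNorm β '' feasibleSet X)

/-- `L` is a linear minimization oracle over `Xc`: for non-negative prices `y`, it returns a minimizer
of `⟨y, ·⟩` over `Xc`. (On the closed set `Xc` a minimizer exists for all strictly positive prices,
but for prices with zero entries it need not exist; then nothing is required of the answer.) -/
def IsLinearMinOracle {d : ℕ} (Xc : Set (Fin d → ℝ)) (L : (Fin d → ℝ) → (Fin d → ℝ)) : Prop :=
  ∀ y, 0 ≤ y → (∃ s ∈ Xc, ∀ x ∈ Xc, y ⬝ᵥ s ≤ y ⬝ᵥ x) →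
    L y ∈ Xc ∧ ∀ x ∈ Xc, y ⬝ᵥ L y ≤ y ⬝ᵥ x

/-- Randomized algorithms in the oracle model, for `n` customers and `d` resources. An algorithm
either returns a vector, or evaluates the gradient of the norm approximation at a point, or calls the
linear minimization oracle of one customer with a price vector, or draws a random element of a
finite set; how it continues may depend on all answers received so far. It has no other
access to the norm, to its approximation and to the sets of the customers. -/
inductive OracleAlgorithm (n d : ℕ) : Type
  | ret (x : Fin d → ℝ)
  | gradient (z : Fin d → ℝ) (k : (Fin d → ℝ) → OracleAlgorithm n d)
  | minimize (c : Fin n) (y : Fin d → ℝ) (k : (Fin d → ℝ) → OracleAlgorithm n d)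
  | sample (m : ℕ) (p : PMF (Fin m)) (k : Fin m → OracleAlgorithm n d)

/-- What is recorded about one run: the returned vector, the number of gradient evaluations and the
number of calls to linear minimization oracles (of all customers together). -/
structure Outcome (d : ℕ) : Type where
  solution : Fin d → ℝ
  gradientEvals : ℕ
  oracleCalls : ℕ

/-- The distribution of the outcome of a run in which gradient evaluations are answered by `g` and
calls to the linear minimization oracle of customer `c` by `L c`. -/
noncomputable def OracleAlgorithm.run {n d : ℕ} (g : (Fin d → ℝ) → (Fin d → ℝ))
    (L : Fin n → (Fin d → ℝ) → (Fin d → ℝ)) : OracleAlgorithm n d → PMF (Outcome d)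
  | .ret x => PMF.pure ⟨x, 0, 0⟩
  | .gradient z k => (OracleAlgorithm.run g L (k (g z))).map
      fun o => ⟨o.solution, o.gradientEvals + 1, o.oracleCalls⟩
  | .minimize c y k => (OracleAlgorithm.run g L (k (L c y))).map
      fun o => ⟨o.solution, o.gradientEvals, o.oracleCalls + 1⟩
  | .sample _ p k => p.bind fun i => OracleAlgorithm.run g L (k i)

/-- The bound `K (n + d) log (n + d) (ε⁻² + log log d)`; for `d = 1` the term `log log d` is `0`. -/
noncomputable def callBound (K : ℝ) (n d : ℕ) (ε : ℝ) : ℝ :=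
  K * ((n + d) * Real.log (n + d) * ((ε ^ 2)⁻¹ + Real.log (Real.log d)))

/-! Serve every customer at unit speed, always moving the load along an oracle answer at the current
prices ∇Ψ. After time τ all customers have received service of about τ, so loads divided by times
give a point of X with norm about Ψ(load)/τ. At prices y = ∇Ψ(x) one has ⟨y, s⟩ ≤ ‖s‖_β, so the
oracle values sum to at most OPT (`SmoothNorm.value_le`). Hence Ψ grows at rate about OPT, and the
additive error ln d is absorbed once τ is large.

To save oracle calls, each round draws one customer with probability proportional to its rate and
serves it for the reciprocal of that rate; the clock advances by the reciprocal of the total rate,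
so an uninterrupted customer progresses at unit expected speed. A round (`ringLoop`) consists of
steps of norm at most η with refreshed prices and stops once their accumulated norm reaches one, so
prices drift by a bounded factor only. Full steps and interruptions are paid for by growth of the
ℓ₁-norm of the load, which is at most d·Ψ. This is where n + d comes from.

The test of a guess G for OPT adapts the rates: an interrupted customer doubles its rate, a
completed one halves it (`guess_time_supermartingale`). It yields OPT up to a constant factor. The
answers at unit prices are optimal up to a factor d, so binary search on the exponent needs about
log log d tests (`ex_search_le`). The main phase takes its rates from the approximate solution σ,
which also completes interrupted rounds. Accumulated prices yield a lower bound on OPT, against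
which the program checks its result (`ens_solve`).

All tail bounds come from exponential supermartingales (`Prog.ex_draw_le`, `Prog.ex_iter_exp_le`).
Call bounds and correctness of returned solutions hold surely; bad luck can only cause a failure.
After a failure the program is repeated with all customers merged into one. Then every draw is
forced, so a failure probability below one means that failure is impossible
(`Prog.ens_lt_one_of_ex_lt_one`), at the price of n calls per merged call. -/

open scoped Pointwise

/-! ### Elementary inequalities for ordered norms. -/

section OrderedNorm

variable {d : ℕ} {β : Fin d → ℝ}

theorem sortedAbs_antitone (x : Fin d → ℝ) : Antitone (sortedAbs x) := by
  intro i j hij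
  have := Tuple.monotone_sort (fun j => -|x j|) hij
  simpa [sortedAbs] using this

/-- Rearrangement inequality: the norm is a maximum over permutations, from which subadditivity,
monotonicity and homogeneity follow. -/
theorem IsOrderedWeight.sum_perm_le (hβ : IsOrderedWeight β) (x : Fin d → ℝ)
    (π : Equiv.Perm (Fin d)) : ∑ i, β i * |x (π i)| ≤ orderedNorm β x := by
  have h := (hβ.antitone.monovary (sortedAbs_antitone x)).sum_mul_comp_perm_le_sum_mul
    (σ := π.trans (Tuple.sort (fun j => -|x j|)).symm)
  simpa [orderedNorm, sortedAbs] using h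

theorem sum_sortedAbs (x : Fin d → ℝ) : ∑ i, sortedAbs x i = ∑ i, |x i| :=
  Equiv.sum_comp (Tuple.sort (fun j => -|x j|)) fun i => |x i|

theorem IsOrderedWeight.orderedNorm_nonneg (hβ : IsOrderedWeight β) (x : Fin d → ℝ) :
    0 ≤ orderedNorm β x :=
  Finset.sum_nonneg fun i _ => mul_nonneg (hβ.nonneg i) (abs_nonneg _)

theorem IsOrderedWeight.orderedNorm_add_le (hβ : IsOrderedWeight β) (x y : Fin d → ℝ) :
    orderedNorm β (x + y) ≤ orderedNorm β x + orderedNorm β y := by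
  refine le_trans ?_ (add_le_add (hβ.sum_perm_le x (Tuple.sort fun j => -|(x + y) j|))
    (hβ.sum_perm_le y (Tuple.sort fun j => -|(x + y) j|)))
  rw [← Finset.sum_add_distrib]
  refine Finset.sum_le_sum fun i _ => ?_
  rw [← mul_add]
  exact mul_le_mul_of_nonneg_left (abs_add_le _ _) (hβ.nonneg i)

theorem IsOrderedWeight.orderedNorm_mono (hβ : IsOrderedWeight β) {x y : Fin d → ℝ}
    (hx : 0 ≤ x) (hxy : x ≤ y) : orderedNorm β x ≤ orderedNorm β y := by
  refine le_trans ?_ (hβ.sum_perm_le y (Tuple.sort fun j => -|x j|))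
  refine Finset.sum_le_sum fun i _ => mul_le_mul_of_nonneg_left ?_ (hβ.nonneg i)
  exact abs_le_abs_of_nonneg (hx _) (hxy _)

theorem IsOrderedWeight.orderedNorm_smul_le (hβ : IsOrderedWeight β) {t : ℝ} (ht : 0 ≤ t)
    (x : Fin d → ℝ) : orderedNorm β (t • x) ≤ t * orderedNorm β x := by
  refine le_trans (le_of_eq ?_) (mul_le_mul_of_nonneg_left
    (hβ.sum_perm_le x (Tuple.sort fun j => -|(t • x) j|)) ht)
  rw [orderedNorm, Finset.mul_sum]
  refine Finset.sum_congr rfl fun i _ => ?_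
  simp only [sortedAbs, Pi.smul_apply, smul_eq_mul, abs_mul, abs_of_nonneg ht]
  ring

/-- Chebyshev's sum inequality for the equally sorted sequences `β` and `sortedAbs x`. -/
theorem IsOrderedWeight.sum_le (hβ : IsOrderedWeight β) (x : Fin d → ℝ) :
    ∑ i, |x i| ≤ d * orderedNorm β x := by
  have h := (hβ.antitone.monovary (sortedAbs_antitone x)).sum_mul_sum_le_card_mul_sum
  rw [hβ.sum_eq_one, sum_sortedAbs] at h
  simpa [orderedNorm] using h

theorem IsOrderedWeight.le_one (hβ : IsOrderedWeight β) (i : Fin d) : β i ≤ 1 := by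
  rw [← hβ.sum_eq_one]
  exact Finset.single_le_sum (fun j _ => hβ.nonneg j) (Finset.mem_univ i)

theorem IsOrderedWeight.orderedNorm_le_sum (hβ : IsOrderedWeight β) (x : Fin d → ℝ) :
    orderedNorm β x ≤ ∑ i, |x i| := by
  rw [← sum_sortedAbs]
  exact Finset.sum_le_sum fun i _ => mul_le_of_le_one_left (abs_nonneg _) (hβ.le_one i)

theorem IsOrderedWeight.exists_pos_mul_le (hβ : IsOrderedWeight β) :
    ∃ b : ℝ, 0 < b ∧ ∀ x i, b * |x i| ≤ orderedNorm β x := by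
  have hd : 0 < d := by
    rcases Nat.eq_zero_or_pos d with rfl | h
    · simpa using hβ.sum_eq_one
    · exact h
  refine ⟨β ⟨0, hd⟩, ?_, fun x i => ?_⟩
  · by_contra h
    have : ∑ i, β i ≤ 0 := Finset.sum_nonpos fun i _ =>
      (hβ.antitone (Fin.mk_le_of_le_val (Nat.zero_le _) : (⟨0, hd⟩ : Fin d) ≤ i)).trans (not_lt.1 h)
    linarith [hβ.sum_eq_one]
  · refine le_trans ?_ (hβ.sum_perm_le x (Equiv.swap ⟨0, hd⟩ i))
    have := Finset.single_le_sum (f := fun j => β j * |x (Equiv.swap ⟨0, hd⟩ i j)|)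
      (fun j _ => mul_nonneg (hβ.nonneg j) (abs_nonneg _)) (Finset.mem_univ (⟨0, hd⟩ : Fin d))
    simpa using this

end OrderedNorm

/-- The properties of a normalized ordered norm `N` and a smooth approximation `Ψ` of it with
gradient `g` that the algorithm relies on. -/
structure SmoothNorm {d : ℕ} (N Ψ : (Fin d → ℝ) → ℝ) (g : (Fin d → ℝ) → Fin d → ℝ) : Prop where
  nonneg : ∀ x, 0 ≤ N x
  mono : ∀ x y, 0 ≤ x → x ≤ y → N x ≤ N y
  smul_le : ∀ t x, 0 ≤ t → N (t • x) ≤ t * N x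
  sum_le : ∀ x, 0 ≤ x → ∑ i, x i ≤ d * N x
  le_sum : ∀ x, 0 ≤ x → N x ≤ ∑ i, x i
  grad_pos : ∀ x, 0 ≤ x → ∀ i, 0 < g x i
  grad_le : ∀ x s, 0 ≤ x → 0 ≤ s → g x ⬝ᵥ s ≤ N s
  grad_add_le : ∀ x z, 0 ≤ x → 0 ≤ z → g (x + z) ≤ Real.exp ‖z‖ • g x
  add_le : ∀ x z, 0 ≤ x → 0 ≤ z → Ψ (x + z) ≤ Ψ x + Real.exp ‖z‖ * (g x ⬝ᵥ z)
  lower : ∀ x, 0 ≤ x → N x ≤ Ψ x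
  zero_le : Ψ 0 ≤ Real.log d

/-! ### Gradients of smooth norm approximations. -/

section Approx

variable {d : ℕ} {β : Fin d → ℝ} {Ψ : (Fin d → ℝ) → ℝ} {δ η : ℝ}

theorem dotProduct_orthantGradient (Ψ : (Fin d → ℝ) → ℝ) (x z : Fin d → ℝ) :
    orthantGradient Ψ x ⬝ᵥ z = fderivWithin ℝ Ψ (Set.Ici 0) x z := by
  conv_rhs => rw [pi_eq_sum_univ' z]
  simp only [map_sum, map_smul, dotProduct, orthantGradient, smul_eq_mul]
  refine Finset.sum_congr rfl fun i _ => ?_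
  rw [mul_comm]

/-- On the segment from `x` to `y` the function is convex in one variable, so its slope is at least
the one-sided derivative at `x`. This also covers boundary points of the orthant. -/
theorem IsNormApprox.add_gradient_le (h : IsNormApprox δ η β Ψ) {x y : Fin d → ℝ} (hx : 0 ≤ x)
    (hy : 0 ≤ y) : Ψ x + orthantGradient Ψ x ⬝ᵥ (y - x) ≤ Ψ y := by
  rw [dotProduct_orthantGradient]
  have hd := (h.differentiableOn x hx).hasFDerivWithinAt
  have hline : ∀ t ∈ Set.Icc (0 : ℝ) 1, x + t • (y - x) ∈ Set.Ici (0 : Fin d → ℝ) := by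
    intro t ht
    have := (convex_Ici (0 : Fin d → ℝ)) hx hy (sub_nonneg.2 ht.2) ht.1 (by ring)
    convert this using 1
    module
  have hγ : HasDerivWithinAt (fun t : ℝ => x + t • (y - x)) (y - x) (Set.Icc 0 1) 0 := by
    have := ((hasDerivAt_id (0 : ℝ)).smul_const (y - x)).const_add x
    simpa using this.hasDerivWithinAt
  have hcomp : HasDerivWithinAt (fun t : ℝ => Ψ (x + t • (y - x)))
      (fderivWithin ℝ Ψ (Set.Ici 0) x (y - x)) (Set.Icc 0 1) 0 := by
    have hd' : HasFDerivWithinAt Ψ (fderivWithin ℝ Ψ (Set.Ici 0) x) (Set.Ici 0)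
      (x + (0 : ℝ) • (y - x)) := by simpa using hd
    exact hd'.comp_hasDerivWithinAt (0 : ℝ) hγ hline
  have hconv : ConvexOn ℝ (Set.Icc (0 : ℝ) 1) (fun t : ℝ => Ψ (x + t • (y - x))) := by
    refine ⟨convex_Icc _ _, fun s hs t ht a b ha hb hab => ?_⟩
    have := h.convexOn.2 (hline s hs) (hline t ht) ha hb hab
    convert this using 2
    have : x = (a + b) • x := by rw [hab, one_smul]
    nth_rewrite 1 [this]
    simp only [smul_eq_mul]
    module
  have := hconv.le_slope_of_hasDerivWithinAt (x := 0) (y := 1) (by simp) (by simp) (by simp) hcomp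
  simp only [slope_def_field, zero_smul, one_smul, add_zero, sub_zero, div_one,
    add_sub_cancel] at this
  linarith

theorem IsNormApprox.add_le (h : IsNormApprox δ 1 β Ψ) {x z : Fin d → ℝ} (hx : 0 ≤ x)
    (hz : 0 ≤ z) : Ψ (x + z) ≤ Ψ x + Real.exp ‖z‖ * (orthantGradient Ψ x ⬝ᵥ z) := by
  have h1 := h.add_gradient_le (add_nonneg hx hz) hx
  have h2 : orthantGradient Ψ (x + z) ⬝ᵥ z ≤ (Real.exp (1 * ‖z‖) • orthantGradient Ψ x) ⬝ᵥ z :=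
    dotProduct_le_dotProduct_of_nonneg_right (h.gradient_le x z hx hz) hz
  rw [smul_dotProduct, one_mul, smul_eq_mul] at h2
  have h3 : x - (x + z) = -z := by abel
  rw [h3, dotProduct_neg] at h1
  linarith

/-- Otherwise `IsNormApprox.add_le` would bound Ψ by `Ψ x` on a whole ray in direction `i`, along
which the norm is unbounded. Strict positivity guarantees that the oracles have minimizers at these
prices. -/
theorem IsNormApprox.gradient_pos (h : IsNormApprox δ 1 β Ψ) (hβ : IsOrderedWeight β)
    {x : Fin d → ℝ} (hx : 0 ≤ x) (i : Fin d) : 0 < orthantGradient Ψ x i := by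
  by_contra hi
  rw [not_lt] at hi
  obtain ⟨b, hb, hle⟩ := hβ.exists_pos_mul_le
  have hbound : ∀ t : ℝ, 0 ≤ t → b * t ≤ Ψ x := by
    intro t ht
    have hs : (0 : Fin d → ℝ) ≤ Pi.single i t := Pi.single_nonneg.2 ht
    have h1 := h.add_le hx hs
    rw [dotProduct_single] at h1
    have h2 : Real.exp ‖(Pi.single i t : Fin d → ℝ)‖ * (orthantGradient Ψ x i * t) ≤ 0 :=
      mul_nonpos_of_nonneg_of_nonpos (Real.exp_pos _).le (mul_nonpos_of_nonpos_of_nonneg hi ht)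
    have h3 := h.lower _ (add_nonneg hx hs)
    have h4 := hle (x + Pi.single i t) i
    have h5 : t ≤ |(x + (Pi.single i t : Fin d → ℝ)) i| := by
      refine le_trans ?_ (le_abs_self _)
      simpa using hx i
    have := mul_le_mul_of_nonneg_left h5 hb.le
    linarith
  have h0 := h.nonneg x hx
  have := hbound ((Ψ x + 1) / b) (by positivity)
  rw [mul_div_cancel₀ _ hb.ne'] at this
  linarith

/-- On the ray `x + t • s` the tangent of Ψ at `x` lies below the norm plus `δ`. For large `t` only
the slopes matter. -/
theorem IsNormApprox.gradient_dotProduct_le (h : IsNormApprox δ η β Ψ) (hβ : IsOrderedWeight β)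
    {x s : Fin d → ℝ} (hx : 0 ≤ x) (hs : 0 ≤ s) :
    orthantGradient Ψ x ⬝ᵥ s ≤ orderedNorm β s := by
  by_contra hlt
  rw [not_le] at hlt
  have hbound : ∀ t : ℝ, 0 ≤ t →
      t * (orthantGradient Ψ x ⬝ᵥ s - orderedNorm β s) ≤ orderedNorm β x + δ - Ψ x := by
    intro t ht
    have hts : 0 ≤ t • s := smul_nonneg ht hs
    have h1 := h.add_gradient_le hx (add_nonneg hx hts)
    rw [add_sub_cancel_left, dotProduct_smul, smul_eq_mul] at h1
    have h2 := h.upper _ (add_nonneg hx hts)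
    have h3 := hβ.orderedNorm_add_le x (t • s)
    have h4 := hβ.orderedNorm_smul_le ht s
    linarith
  have h0 := hbound 0 le_rfl
  rw [zero_mul] at h0
  have hpos := sub_pos.2 hlt
  have := hbound ((orderedNorm β x + δ - Ψ x + 1) /
    (orthantGradient Ψ x ⬝ᵥ s - orderedNorm β s)) (by positivity)
  rw [div_mul_cancel₀ _ hpos.ne'] at this
  linarith

theorem IsNormApprox.smoothNorm (h : IsNormApprox (Real.log d) 1 β Ψ) (hβ : IsOrderedWeight β) :
    SmoothNorm (orderedNorm β) Ψ (orthantGradient Ψ) where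
  nonneg := hβ.orderedNorm_nonneg
  mono _ _ := hβ.orderedNorm_mono
  smul_le _ x ht := hβ.orderedNorm_smul_le ht x
  sum_le x hx := by
    simpa only [abs_of_nonneg (hx _)] using hβ.sum_le x
  le_sum x hx := by
    simpa only [abs_of_nonneg (hx _)] using hβ.orderedNorm_le_sum x
  grad_pos _ hx := h.gradient_pos hβ hx
  grad_le _ _ hx hs := h.gradient_dotProduct_le hβ hx hs
  grad_add_le x z hx hz := by simpa using h.gradient_le x z hx hz
  add_le _ _ hx hz := h.add_le hx hz
  lower := h.lower
  zero_le := by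
    have := h.upper 0 le_rfl
    simpa [orderedNorm, sortedAbs] using this

end Approx

/-! ### Linear minimization at positive prices. -/

/-- A linear minimization oracle for each of the sets `X c` of non-negative vectors that works for
strictly positive prices. -/
structure LinOracle {n d : ℕ} (X : Fin n → Set (Fin d → ℝ))
    (O : Fin n → (Fin d → ℝ) → Fin d → ℝ) : Prop where
  convex : ∀ c, Convex ℝ (X c)
  nonneg : ∀ c, ∀ x ∈ X c, 0 ≤ x
  mem : ∀ c y, (∀ i, 0 < y i) → O c y ∈ X c
  le : ∀ c y, (∀ i, 0 < y i) → ∀ x ∈ X c, y ⬝ᵥ O c y ≤ y ⬝ᵥ x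

/-- At positive prices, a sublevel set within the orthant is contained in a box, so compactness
applies. -/
theorem IsCustomerSet.exists_minimizer {d : ℕ} {S : Set (Fin d → ℝ)} (hS : IsCustomerSet S)
    {y : Fin d → ℝ} (hy : ∀ i, 0 < y i) : ∃ s ∈ S, ∀ x ∈ S, y ⬝ᵥ s ≤ y ⬝ᵥ x := by
  obtain ⟨x₀, hx₀⟩ := hS.nonempty
  have hcont : Continuous fun x : Fin d → ℝ => y ⬝ᵥ x := by
    unfold dotProduct
    fun_prop
  have hK : IsCompact (S ∩ {x | y ⬝ᵥ x ≤ y ⬝ᵥ x₀}) := by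
    refine (isCompact_Icc (a := (0 : Fin d → ℝ)) (b := fun i => y ⬝ᵥ x₀ / y i)).of_isClosed_subset
      (hS.isClosed.inter (isClosed_le hcont continuous_const)) fun x hx => ?_
    refine ⟨hS.nonneg x hx.1, fun i => ?_⟩
    rw [le_div_iff₀ (hy i), mul_comm]
    refine le_trans ?_ hx.2
    exact Finset.single_le_sum (f := fun j => y j * x j)
      (fun j _ => mul_nonneg (hy j).le (hS.nonneg x hx.1 j)) (Finset.mem_univ i)
  obtain ⟨s, hs, hmin⟩ := hK.exists_isMinOn ⟨x₀, hx₀, le_refl (y ⬝ᵥ x₀)⟩ hcont.continuousOn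
  refine ⟨s, hs.1, fun x hx => ?_⟩
  by_cases hxx : y ⬝ᵥ x ≤ y ⬝ᵥ x₀
  · exact hmin ⟨hx, hxx⟩
  · exact hs.2.trans (not_le.1 hxx).le

theorem linOracle_of_isLinearMinOracle {n d : ℕ} {X : Fin n → Set (Fin d → ℝ)}
    (hX : ∀ c, IsCustomerSet (X c)) {L : Fin n → (Fin d → ℝ) → Fin d → ℝ}
    (hL : ∀ c, IsLinearMinOracle (X c) (L c)) : LinOracle X L where
  convex c := (hX c).convex
  nonneg c := (hX c).nonneg
  mem c y hy := (hL c y (fun i => (hy i).le) ((hX c).exists_minimizer hy)).1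
  le c y hy := (hL c y (fun i => (hy i).le) ((hX c).exists_minimizer hy)).2

/-! ### Oracle programs: sure properties and expectations. -/

/-- Oracle programs returning a value of type `α`, which sample customers only. -/
inductive Prog (n d : ℕ) (α : Type) : Type
  | ret (a : α)
  | grad (z : Fin d → ℝ) (k : (Fin d → ℝ) → Prog n d α)
  | query (c : Fin n) (y : Fin d → ℝ) (k : (Fin d → ℝ) → Prog n d α)
  | sample (p : PMF (Fin n)) (k : Fin n → Prog n d α)

namespace Prog

variable {n d : ℕ} {α γ : Type}

/-- Sequential composition. -/
def bind : Prog n d α → (α → Prog n d γ) → Prog n d γ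
  | ret a, f => f a
  | grad z k, f => grad z fun v => (k v).bind f
  | query c y k, f => query c y fun v => (k v).bind f
  | sample p k, f => sample p fun c => (k c).bind f

/-- `Q a i j` holds for every possible result `a`, obtained with `i` gradient evaluations and `j`
oracle calls. -/
def Ens (g : (Fin d → ℝ) → Fin d → ℝ) (O : Fin n → (Fin d → ℝ) → Fin d → ℝ) :
    Prog n d α → (α → ℕ → ℕ → Prop) → Prop
  | ret a, Q => Q a 0 0
  | grad z k, Q => Ens g O (k (g z)) fun a i j => Q a (i + 1) j
  | query c y k, Q => Ens g O (k (O c y)) fun a i j => Q a i (j + 1)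
  | sample _ k, Q => ∀ c, Ens g O (k c) Q

/-- The expectation of a function of the result. -/
noncomputable def ex (g : (Fin d → ℝ) → Fin d → ℝ) (O : Fin n → (Fin d → ℝ) → Fin d → ℝ) :
    Prog n d α → (α → ℝ≥0∞) → ℝ≥0∞
  | ret a, f => f a
  | grad z k, f => ex g O (k (g z)) f
  | query c y k, f => ex g O (k (O c y)) f
  | sample p k, f => ∑ c, p c * ex g O (k c) f

variable {g : (Fin d → ℝ) → Fin d → ℝ} {O : Fin n → (Fin d → ℝ) → Fin d → ℝ}

theorem Ens.mono {p : Prog n d α} {Q Q' : α → ℕ → ℕ → Prop} (h : Ens g O p Q)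
    (hQ : ∀ a i j, Q a i j → Q' a i j) : Ens g O p Q' := by
  induction p generalizing Q Q' with
  | ret a => exact hQ _ _ _ h
  | grad z k ih => exact ih _ h fun a i j => hQ a _ _
  | query c y k ih => exact ih _ h fun a i j => hQ a _ _
  | sample p k ih => exact fun c => ih c (h c) hQ

theorem Ens.and {p : Prog n d α} {Q Q' : α → ℕ → ℕ → Prop} (h : Ens g O p Q)
    (h' : Ens g O p Q') : Ens g O p fun a i j => Q a i j ∧ Q' a i j := by
  induction p generalizing Q Q' with
  | ret a => exact ⟨h, h'⟩
  | grad z k ih => exact ih _ h h'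
  | query c y k ih => exact ih _ h h'
  | sample p k ih => exact fun c => ih c (h c) (h' c)

theorem Ens.of_forall {p : Prog n d α} {Q : α → ℕ → ℕ → Prop} (h : ∀ a i j, Q a i j) :
    Ens g O p Q := by
  induction p generalizing Q with
  | ret a => exact h _ _ _
  | grad z k ih => exact ih _ fun _ _ _ => h _ _ _
  | query c y k ih => exact ih _ fun _ _ _ => h _ _ _
  | sample p k ih => exact fun c => ih c h

theorem ens_bind {p : Prog n d α} {k : α → Prog n d γ} {Q : γ → ℕ → ℕ → Prop} :
    Ens g O (p.bind k) Q ↔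
      Ens g O p fun a i j => Ens g O (k a) fun b i' j' => Q b (i + i') (j + j') := by
  induction p generalizing Q with
  | ret a => simp [bind, Ens]
  | grad z k ih => simp only [bind, Ens, ih]; simp only [add_right_comm]
  | query c y k ih => simp only [bind, Ens, ih]; simp only [add_right_comm]
  | sample p k ih => simp only [bind, Ens, ih]

theorem ex_bind (p : Prog n d α) (k : α → Prog n d γ) (f : γ → ℝ≥0∞) :
    ex g O (p.bind k) f = ex g O p fun a => ex g O (k a) f := by
  induction p with
  | ret a => rfl
  | grad z k ih => simp only [bind, ex, ih]
  | query c y k ih => simp only [bind, ex, ih]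
  | sample p k ih => simp only [bind, ex, ih]

theorem ex_le_ex {p : Prog n d α} {f f' : α → ℝ≥0∞} (h : Ens g O p fun a _ _ => f a ≤ f' a) :
    ex g O p f ≤ ex g O p f' := by
  induction p with
  | ret a => exact h
  | grad z k ih => exact ih _ h
  | query c y k ih => exact ih _ h
  | sample p k ih => exact Finset.sum_le_sum fun c _ => mul_le_mul_right (ih c (h c)) _

theorem ex_const (p : Prog n d α) (r : ℝ≥0∞) : ex g O p (fun _ => r) = r := by
  induction p with
  | ret a => rfl
  | grad z k ih => exact ih _
  | query c y k ih => exact ih _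
  | sample p k ih =>
    simp only [ex, ih, ← Finset.sum_mul]
    have := p.tsum_coe
    rw [tsum_fintype] at this
    rw [this, one_mul]

theorem ex_le_of_ens {p : Prog n d α} {f : α → ℝ≥0∞} {r : ℝ≥0∞}
    (h : Ens g O p fun a _ _ => f a ≤ r) : ex g O p f ≤ r :=
  (ex_le_ex h).trans_eq (ex_const p r)

theorem ex_add (p : Prog n d α) (f f' : α → ℝ≥0∞) :
    ex g O p (fun a => f a + f' a) = ex g O p f + ex g O p f' := by
  induction p with
  | ret a => rfl
  | grad z k ih => exact ih _
  | query c y k ih => exact ih _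
  | sample p k ih => simp only [ex, ih, mul_add, Finset.sum_add_distrib]

theorem ex_zero (p : Prog n d α) : ex g O p (fun _ => 0) = 0 := ex_const p 0

theorem ex_sum {ι : Type} (s : Finset ι) (p : Prog n d α) (f : ι → α → ℝ≥0∞) :
    ex g O p (fun a => ∑ i ∈ s, f i a) = ∑ i ∈ s, ex g O p (f i) := by
  classical
  induction s using Finset.induction_on with
  | empty => simpa using ex_zero p
  | insert i s hi ih => simp only [Finset.sum_insert hi, ex_add, ih]

/-- `N`-fold iteration. -/
def iter (step : α → Prog n d α) : ℕ → α → Prog n d α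
  | 0, s => ret s
  | N + 1, s => (iter step N s).bind step

theorem ens_iter {step : α → Prog n d α} (J : ℕ → α → ℕ → ℕ → Prop)
    (h : ∀ k s i j, J k s i j → Ens g O (step s) fun s' i' j' => J (k + 1) s' (i + i') (j + j'))
    {s : α} (h0 : J 0 s 0 0) (N : ℕ) : Ens g O (iter step N s) (J N) := by
  induction N with
  | zero => exact h0
  | succ N ih => exact ens_bind.2 (ih.mono fun a i j ha => h N a i j ha)

theorem ex_iter_le {step : α → Prog n d α} {Inv : α → Prop} {V : α → ℝ≥0∞}
    (hInv : ∀ s, Inv s → Ens g O (step s) fun s' _ _ => Inv s')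
    (hV : ∀ s, Inv s → ex g O (step s) V ≤ V s) {s : α} (hs : Inv s) (N : ℕ) :
    ex g O (iter step N s) V ≤ V s := by
  induction N with
  | zero => exact le_rfl
  | succ N ih =>
    refine le_trans ?_ ih
    rw [iter, ex_bind]
    exact ex_le_ex ((ens_iter (fun _ s _ _ => Inv s) (fun _ s _ _ h => hInv s h) hs N).mono
      fun a _ _ ha => hV a ha)

/-- The program that multiplies all answers to oracle calls by `t`. -/
def rescale (t : ℝ) : Prog n d α → Prog n d α
  | ret a => ret a
  | grad z k => grad z fun v => (k v).rescale t
  | query c y k => query c y fun v => (k (t • v)).rescale t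
  | sample p k => sample p fun c => (k c).rescale t

/-- Scaling the answers simulates scaled customer sets; this reduces any guess for the optimum to
the guess one. -/
theorem ens_rescale {t : ℝ} {p : Prog n d α} {Q : α → ℕ → ℕ → Prop} :
    Ens g O (p.rescale t) Q ↔ Ens g (fun c y => t • O c y) p Q := by
  induction p generalizing Q with
  | ret a => rfl
  | grad z k ih => exact ih _
  | query c y k ih => exact ih _
  | sample p k ih => exact forall_congr' fun c => ih c

theorem ex_rescale {t : ℝ} {p : Prog n d α} {f : α → ℝ≥0∞} :
    ex g O (p.rescale t) f = ex g (fun c y => t • O c y) p f := by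
  induction p with
  | ret a => rfl
  | grad z k ih => exact ih _
  | query c y k ih => exact ih _
  | sample p k ih => simp only [rescale, ex, ih]

/-- Calls the oracles of the customers in a list with the same prices. -/
def queryList (y : Fin d → ℝ) : List (Fin n) → (Fin n → Fin d → ℝ) → Prog n d (Fin n → Fin d → ℝ)
  | [], f => ret f
  | c :: l, f => query c y fun s => queryList y l (Function.update f c s)

theorem ens_queryList (y : Fin d → ℝ) (l : List (Fin n)) (f : Fin n → Fin d → ℝ) :
    Ens g O (queryList y l f) fun f' i j =>
      (∀ c, f' c = if c ∈ l then O c y else f c) ∧ i = 0 ∧ j = l.length := by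
  induction l generalizing f with
  | nil => simp [queryList, Ens]
  | cons c l ih =>
    refine (ih (Function.update f c (O c y))).mono ?_
    rintro f' i j ⟨h, rfl, rfl⟩
    refine ⟨fun c' => ?_, rfl, rfl⟩
    rw [h c']
    by_cases h1 : c' ∈ l <;> by_cases h2 : c' = c <;> simp [h1, h2]

/-- Calls the oracles of all customers with the same prices. -/
def queryAll (y : Fin d → ℝ) : Prog n d (Fin n → Fin d → ℝ) :=
  queryList y (List.finRange n) 0

theorem ens_queryAll (y : Fin d → ℝ) :
    Ens g O (queryAll y) fun f i j => f = (fun c => O c y) ∧ i = 0 ∧ j = n := by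
  refine (ens_queryList y (List.finRange n) 0).mono ?_
  rintro f i j ⟨h, hi, hj⟩
  exact ⟨funext fun c => by simpa using h c, hi, by simpa using hj⟩

theorem ex_queryAll_bind (y : Fin d → ℝ) (k : (Fin n → Fin d → ℝ) → Prog n d α) (f : α → ℝ≥0∞) :
    ex g O ((queryAll y).bind k) f = ex g O (k fun c => O c y) f := by
  rw [ex_bind]
  refine le_antisymm ?_ ?_
  · exact ex_le_of_ens ((ens_queryAll y).mono fun a _ _ h => by rw [h.1])
  · conv_lhs => rw [← ex_const (g := g) (O := O) (queryAll y) (ex g O (k fun c => O c y) f)]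
    exact ex_le_ex ((ens_queryAll y).mono fun a _ _ h => by rw [h.1])

/-- Runs a program for one customer, whose oracle is the sum of the oracles of `n` customers. -/
def aggregate : Prog 1 d α → Prog n d α
  | ret a => ret a
  | grad z k => grad z fun v => (k v).aggregate
  | query _ y k => (queryAll y).bind fun f => (k (∑ c, f c)).aggregate
  | sample _ k => (k 0).aggregate

/-- Linear minimization over a Minkowski sum splits into its summands, so one call for the merged
customer costs `n` calls. -/
theorem Ens.aggregate {p : Prog 1 d α} {Q : α → ℕ → ℕ → Prop}
    (h : Ens g (fun _ y => ∑ c, O c y) p fun a i j => Q a i (n * j)) :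
    Ens g O p.aggregate Q := by
  induction p generalizing Q with
  | ret a => simpa [Prog.aggregate, Ens] using h
  | grad z k ih => exact ih _ h
  | query c y k ih =>
    refine ens_bind.2 ((ens_queryAll y).mono ?_)
    rintro f i j ⟨rfl, rfl, rfl⟩
    refine ih _ (Ens.mono h fun a i' j' h' => ?_)
    rw [zero_add, add_comm]
    exact h'
  | sample p k ih => exact ih 0 (h 0)

/-- With a single customer every draw is forced: the run is deterministic, and the expectation is
the value at its only result. -/
theorem ens_lt_one_of_ex_lt_one {O : Fin 1 → (Fin d → ℝ) → Fin d → ℝ} {p : Prog 1 d α}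
    {f : α → ℝ≥0∞} (h : ex g O p f < 1) : Ens g O p fun a _ _ => f a < 1 := by
  induction p with
  | ret a => exact h
  | grad z k ih => exact ih _ h
  | query c y k ih => exact ih _ h
  | sample p k ih =>
    intro c
    refine ih c ?_
    have h1 : p 0 = 1 := by
      have := p.tsum_coe
      rwa [tsum_fintype, Fin.sum_univ_one] at this
    simp only [ex, Fin.sum_univ_one, h1, one_mul] at h
    rwa [Subsingleton.elim c 0]

/-- The oracle algorithm given by a program that returns a vector. -/
def toAlg : Prog n d (Fin d → ℝ) → OracleAlgorithm n d
  | ret x => .ret x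
  | grad z k => .gradient z fun v => (k v).toAlg
  | query c y k => .minimize c y fun v => (k v).toAlg
  | sample p k => .sample n p fun c => (k c).toAlg

theorem Ens.toAlg {p : Prog n d (Fin d → ℝ)} {Q : (Fin d → ℝ) → ℕ → ℕ → Prop}
    (h : Ens g O p Q) :
    ∀ o ∈ (p.toAlg.run g O).support, Q o.solution o.gradientEvals o.oracleCalls := by
  induction p generalizing Q with
  | ret a =>
    intro o ho
    simp only [Prog.toAlg, OracleAlgorithm.run, PMF.support_pure, Set.mem_singleton_iff] at ho
    subst ho
    exact h
  | grad z k ih =>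
    intro o ho
    simp only [Prog.toAlg, OracleAlgorithm.run, PMF.support_map, Set.mem_image] at ho
    obtain ⟨o', ho', rfl⟩ := ho
    exact ih _ h o' ho'
  | query c y k ih =>
    intro o ho
    simp only [Prog.toAlg, OracleAlgorithm.run, PMF.support_map, Set.mem_image] at ho
    obtain ⟨o', ho', rfl⟩ := ho
    exact ih _ h o' ho'
  | sample p k ih =>
    intro o ho
    simp only [Prog.toAlg, OracleAlgorithm.run, PMF.mem_support_bind_iff] at ho
    obtain ⟨c, -, hc⟩ := ho
    exact ih c (h c) o hc

/-- `f` majorizes the indicator of those first-stage results after which the event `E` may still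
occur. -/
theorem toOuterMeasure_run_bind_le {p : Prog n d α} {k : α → Prog n d (Fin d → ℝ)} {f : α → ℝ≥0∞}
    {E : (Fin d → ℝ) → ℕ → ℕ → Prop}
    (h : Ens g O p fun a i j =>
      1 ≤ f a ∨ Ens g O (k a) fun b i' j' => ¬ E b (i + i') (j + j')) :
    ((p.bind k).toAlg.run g O).toOuterMeasure
      {o | E o.solution o.gradientEvals o.oracleCalls} ≤ ex g O p f := by
  induction p generalizing E with
  | ret a =>
    rcases h with h | h
    · refine le_trans ?_ h
      rw [← (PMF.toOuterMeasure_apply_eq_one_iff (p := (((ret a : Prog n d α).bind k).toAlg.run g O))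
        (s := Set.univ)).2 (Set.subset_univ _)]
      exact MeasureTheory.measure_mono (Set.subset_univ _)
    · refine le_of_eq_of_le ?_ zero_le
      rw [PMF.toOuterMeasure_apply_eq_zero_iff, Set.disjoint_left]
      intro o ho
      simpa using h.toAlg o ho
  | grad z k' ih =>
    simp only [bind, Prog.toAlg, OracleAlgorithm.run, PMF.toOuterMeasure_map_apply]
    refine ih _ (E := fun b i j => E b (i + 1) j) (Ens.mono h fun a i j h' => ?_)
    simpa only [add_right_comm] using h'
  | query c y k' ih =>
    simp only [bind, Prog.toAlg, OracleAlgorithm.run, PMF.toOuterMeasure_map_apply]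
    refine ih _ (E := fun b i j => E b i (j + 1)) (Ens.mono h fun a i j h' => ?_)
    simpa only [add_right_comm] using h'
  | sample p k' ih =>
    simp only [bind, Prog.toAlg, OracleAlgorithm.run, PMF.toOuterMeasure_bind_apply, tsum_fintype]
    exact Finset.sum_le_sum fun c _ => mul_le_mul_right (ih c (h c)) _

end Prog

/-! ### Monotonicity of oracle values. -/

section LinOracle

variable {n d : ℕ} {X : Fin n → Set (Fin d → ℝ)} {O : Fin n → (Fin d → ℝ) → Fin d → ℝ}

theorem LinOracle.nonneg_of_mem_smul (hO : LinOracle X O) {c : Fin n} {a : ℝ} {v : Fin d → ℝ}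
    (ha : 0 ≤ a) (hv : v ∈ a • X c) : 0 ≤ v := by
  obtain ⟨s, hs, rfl⟩ := hv
  exact smul_nonneg ha (hO.nonneg c s hs)

theorem LinOracle.add_mem_smul (hO : LinOracle X O) {c : Fin n} {a b : ℝ} {v w : Fin d → ℝ}
    (ha : 0 ≤ a) (hb : 0 ≤ b) (hv : v ∈ a • X c) (hw : w ∈ b • X c) : v + w ∈ (a + b) • X c := by
  rw [(hO.convex c).add_smul ha hb]
  exact Set.add_mem_add hv hw

theorem dotProduct_nonneg_of_pos {y s : Fin d → ℝ} (hy : ∀ i, 0 < y i) (hs : 0 ≤ s) :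
    0 ≤ y ⬝ᵥ s :=
  dotProduct_nonneg_of_nonneg (fun i => (hy i).le) hs

theorem LinOracle.dotProduct_nonneg (hO : LinOracle X O) (c : Fin n) {y : Fin d → ℝ}
    (hy : ∀ i, 0 < y i) : 0 ≤ y ⬝ᵥ O c y :=
  dotProduct_nonneg_of_pos hy (hO.nonneg c _ (hO.mem c y hy))

/-- The answer at the old prices stays feasible at the new ones. -/
theorem LinOracle.value_le_mul (hO : LinOracle X O) (c : Fin n) {y y' : Fin d → ℝ} {t : ℝ}
    (hy : ∀ i, 0 < y i) (hy' : ∀ i, 0 < y' i) (h : y' ≤ t • y) :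
    y' ⬝ᵥ O c y' ≤ t * (y ⬝ᵥ O c y) := by
  refine (hO.le c y' hy' _ (hO.mem c y hy)).trans ?_
  rw [← smul_eq_mul, ← smul_dotProduct]
  exact dotProduct_le_dotProduct_of_nonneg_right h (hO.nonneg c _ (hO.mem c y hy))

end LinOracle

theorem norm_le_sum_of_nonneg {d : ℕ} {s : Fin d → ℝ} (hs : 0 ≤ s) : ‖s‖ ≤ ∑ i, s i := by
  refine (pi_norm_le_iff_of_nonneg (Finset.sum_nonneg fun i _ => hs i)).2 fun i => ?_
  rw [Real.norm_of_nonneg (hs i)]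
  exact Finset.single_le_sum (fun j _ => hs j) (Finset.mem_univ i)

theorem exp_le_one_add_two_mul {a : ℝ} (h0 : 0 ≤ a) (h1 : a ≤ 1) : Real.exp a ≤ 1 + 2 * a := by
  have h := convexOn_exp.2 (Set.mem_univ 0) (Set.mem_univ 1) (sub_nonneg.2 h1) h0 (by ring)
  simp only [smul_eq_mul, mul_zero, mul_one, zero_add, Real.exp_zero] at h
  nlinarith [Real.exp_one_lt_d9]

/-! ### Serving one customer while prices drift. -/

/-- The result of serving one customer for some time: the load vector, the time that remains to be
served, the accumulated maximum norm of the steps and an upper bound on the increase of `Ψ`. -/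
structure RingState (d : ℕ) : Type where
  load : Fin d → ℝ
  rem : ℝ
  acc : ℝ
  cost : ℝ

/-- Serves customer `c` in steps of maximum norm at most `η`, with current prices, until nothing
remains or the accumulated norm reaches one. -/
noncomputable def ringLoop {n d : ℕ} (c : Fin n) (η : ℝ) : ℕ → RingState d → Prog n d (RingState d)
  | 0, r => .ret r
  | fuel + 1, r => .grad r.load fun y => .query c y fun s =>
      if r.rem * ‖s‖ ≤ η then
        .ret ⟨r.load + r.rem • s, 0, r.acc + r.rem * ‖s‖,
          r.cost + Real.exp η * (r.rem * (y ⬝ᵥ s))⟩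
      else if 1 ≤ r.acc + η then
        .ret ⟨r.load + (η / ‖s‖) • s, r.rem - η / ‖s‖, r.acc + η,
          r.cost + Real.exp η * (η / ‖s‖ * (y ⬝ᵥ s))⟩
      else
        ringLoop c η fuel ⟨r.load + (η / ‖s‖) • s, r.rem - η / ‖s‖, r.acc + η,
          r.cost + Real.exp η * (η / ‖s‖ * (y ⬝ᵥ s))⟩

/-- Properties of the state while serving customer `c` for time `ℓ`, starting with load `x₀`. -/
structure RingInv {n d : ℕ} (Ψ : (Fin d → ℝ) → ℝ) (g : (Fin d → ℝ) → Fin d → ℝ)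
    (X : Fin n → Set (Fin d → ℝ)) (O : Fin n → (Fin d → ℝ) → Fin d → ℝ) (c : Fin n) (η : ℝ)
    (x₀ : Fin d → ℝ) (ℓ : ℝ) (r : RingState d) : Prop where
  rem_nonneg : 0 ≤ r.rem
  rem_le : r.rem ≤ ℓ
  mem : r.load - x₀ ∈ (ℓ - r.rem) • X c
  acc_nonneg : 0 ≤ r.acc
  acc_le_sum : r.acc ≤ ∑ i, (r.load - x₀) i
  norm_le : ‖r.load - x₀‖ ≤ r.acc
  psi_le : Ψ r.load ≤ Ψ x₀ + r.cost
  cost_nonneg : 0 ≤ r.cost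
  cost_le : r.cost ≤ Real.exp η * ((ℓ - r.rem) * (g x₀ ⬝ᵥ O c (g x₀)) * (1 + 2 * r.acc))

section Ring

variable {n d : ℕ} {N Ψ : (Fin d → ℝ) → ℝ} {g : (Fin d → ℝ) → Fin d → ℝ}
  {X : Fin n → Set (Fin d → ℝ)} {O : Fin n → (Fin d → ℝ) → Fin d → ℝ} {c : Fin n} {η : ℝ}
  {x₀ : Fin d → ℝ} {ℓ : ℝ}

theorem RingInv.le {r : RingState d} (hO : LinOracle X O) (h : RingInv Ψ g X O c η x₀ ℓ r) :
    x₀ ≤ r.load :=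
  sub_nonneg.1 (hO.nonneg_of_mem_smul (sub_nonneg.2 h.rem_le) h.mem)

theorem RingInv.init (hne : (X c).Nonempty) (hℓ : 0 ≤ ℓ) :
    RingInv Ψ g X O c η x₀ ℓ ⟨x₀, ℓ, 0, 0⟩ where
  rem_nonneg := hℓ
  rem_le := le_rfl
  mem := by
    obtain ⟨s, hs⟩ := hne
    exact ⟨s, hs, by simp⟩
  acc_nonneg := le_rfl
  acc_le_sum := by simp
  norm_le := by simp
  psi_le := by simp
  cost_nonneg := le_rfl
  cost_le := by simp

/-- Since the start, prices have grown by a factor of at most `exp r.acc ≤ 1 + 2 * r.acc`, and the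
oracle value with them. The factor `exp η` pays for the drift within a step. -/
theorem RingInv.step {r : RingState d} (hN : SmoothNorm N Ψ g) (hO : LinOracle X O)
    (hx₀ : 0 ≤ x₀) (h : RingInv Ψ g X O c η x₀ ℓ r) (hacc : r.acc ≤ 1) {α : ℝ} (hα : 0 ≤ α)
    (hαr : α ≤ r.rem) (hαη : α * ‖O c (g r.load)‖ ≤ η) :
    RingInv Ψ g X O c η x₀ ℓ ⟨r.load + α • O c (g r.load), r.rem - α,
      r.acc + α * ‖O c (g r.load)‖,
      r.cost + Real.exp η * (α * (g r.load ⬝ᵥ O c (g r.load)))⟩ := by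
  have hx : 0 ≤ r.load := hx₀.trans (h.le hO)
  have hpos := hN.grad_pos _ hx
  have hpos₀ := hN.grad_pos _ hx₀
  set s := O c (g r.load) with hs
  have hsX : s ∈ X c := hO.mem c _ hpos
  have hs0 : 0 ≤ s := hO.nonneg c s hsX
  have hys : 0 ≤ g r.load ⬝ᵥ s := dotProduct_nonneg_of_pos hpos hs0
  have hαs : 0 ≤ α * ‖s‖ := mul_nonneg hα (norm_nonneg _)
  have hsub : r.load + α • s - x₀ = r.load - x₀ + α • s := by abel
  have hnorm : ‖α • s‖ = α * ‖s‖ := by rw [norm_smul, Real.norm_of_nonneg hα]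
  refine ⟨sub_nonneg.2 hαr, by simpa using h.rem_le.trans (le_add_of_nonneg_right hα), ?_,
    add_nonneg h.acc_nonneg hαs, ?_, ?_, ?_, ?_, ?_⟩
  · simp only [hsub]
    rw [show ℓ - (r.rem - α) = ℓ - r.rem + α by ring]
    exact hO.add_mem_smul (sub_nonneg.2 h.rem_le) hα h.mem (Set.smul_mem_smul_set hsX)
  · simp only [hsub]
    simp only [Pi.add_apply (r.load - x₀) (α • s), Finset.sum_add_distrib, Pi.smul_apply,
      smul_eq_mul, ← Finset.mul_sum]
    exact add_le_add h.acc_le_sum (mul_le_mul_of_nonneg_left (norm_le_sum_of_nonneg hs0) hα)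
  · simp only [hsub]
    exact (norm_add_le _ _).trans (add_le_add h.norm_le hnorm.le)
  · have h1 := hN.add_le _ _ hx (smul_nonneg hα hs0)
    rw [hnorm, dotProduct_smul, smul_eq_mul] at h1
    have h2 := mul_le_mul_of_nonneg_right (Real.exp_le_exp.2 hαη) (mul_nonneg hα hys)
    have h3 := h.psi_le
    simp only
    linarith
  · exact add_nonneg h.cost_nonneg (mul_nonneg (Real.exp_pos _).le (mul_nonneg hα hys))
  · set k := g x₀ ⬝ᵥ O c (g x₀) with hk
    have hk0 : 0 ≤ k := hO.dotProduct_nonneg c hpos₀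
    have h1 : g r.load ⬝ᵥ s ≤ Real.exp ‖r.load - x₀‖ * k := by
      refine hO.value_le_mul c hpos₀ hpos ?_
      have := hN.grad_add_le x₀ (r.load - x₀) hx₀ (sub_nonneg.2 (h.le hO))
      rwa [add_sub_cancel] at this
    have h2 : g r.load ⬝ᵥ s ≤ (1 + 2 * r.acc) * k :=
      h1.trans (mul_le_mul_of_nonneg_right ((Real.exp_le_exp.2 h.norm_le).trans
        (exp_le_one_add_two_mul h.acc_nonneg hacc)) hk0)
    have h3 : α * (g r.load ⬝ᵥ s) ≤ α * ((1 + 2 * r.acc) * k) := mul_le_mul_of_nonneg_left h2 hα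
    have h4 := h.cost_le
    have h5 : 0 ≤ (ℓ - (r.rem - α)) * k * (2 * (α * ‖s‖)) := by
      have : 0 ≤ ℓ - (r.rem - α) := by linarith [h.rem_le]
      positivity
    have h6 : (ℓ - r.rem) * k * (1 + 2 * r.acc) + α * (g r.load ⬝ᵥ s) ≤
        (ℓ - (r.rem - α)) * k * (1 + 2 * (r.acc + α * ‖s‖)) := by nlinarith
    have h7 := mul_le_mul_of_nonneg_left h6 (Real.exp_pos η).le
    simp only
    linarith

/-- The guarantee for the final state of `ringLoop` and the number of calls. -/
structure RingSpec (Ψ : (Fin d → ℝ) → ℝ) (g : (Fin d → ℝ) → Fin d → ℝ)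
    (X : Fin n → Set (Fin d → ℝ)) (O : Fin n → (Fin d → ℝ) → Fin d → ℝ) (c : Fin n) (η : ℝ)
    (x₀ : Fin d → ℝ) (ℓ : ℝ) (r : RingState d) (i j : ℕ) : Prop
    extends RingInv Ψ g X O c η x₀ ℓ r where
  done : r.rem = 0 ∨ 1 ≤ r.acc
  acc_le : r.acc ≤ 1 + η
  grads : i = j
  calls : η * j ≤ η + r.acc

/-- Every call but the last adds exactly `η` to `acc`, which bounds the calls. The same growth keeps
`hfuel` true, so the loop stops by itself before the fuel runs out. -/
theorem ens_ringLoop_of_inv (hN : SmoothNorm N Ψ g) (hO : LinOracle X O) (hx₀ : 0 ≤ x₀)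
    (hη : 0 < η) (fuel : ℕ) (r : RingState d) (h : RingInv Ψ g X O c η x₀ ℓ r) (hacc : r.acc < 1)
    (hfuel : 1 ≤ r.acc + fuel * η) :
    Prog.Ens g O (ringLoop c η fuel r) fun r' i j =>
      RingInv Ψ g X O c η x₀ ℓ r' ∧ (r'.rem = 0 ∨ 1 ≤ r'.acc) ∧ r'.acc ≤ 1 + η ∧ i = j ∧
        η * j ≤ η + (r'.acc - r.acc) := by
  induction fuel generalizing r with
  | zero => norm_num at hfuel; linarith
  | succ fuel ih =>
    simp only [ringLoop, Prog.Ens]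
    set s := O c (g r.load) with hs
    split_ifs with h1 h2
    · have := h.step hN hO hx₀ hacc.le h.rem_nonneg le_rfl h1
      rw [sub_self] at this
      have h3 : 0 ≤ r.rem * ‖s‖ := mul_nonneg h.rem_nonneg (norm_nonneg _)
      refine ⟨this, Or.inl rfl, ?_, rfl, ?_⟩
      · simp only; linarith
      · push_cast; linarith
    all_goals
      -- A zero answer would have led to the first branch.
      have hs0 : 0 < ‖s‖ := by
        refine (norm_nonneg s).lt_of_ne fun h0 => h1 ?_
        rw [← h0, mul_zero]
        exact hη.le
      have hα : η / ‖s‖ * ‖s‖ = η := div_mul_cancel₀ _ hs0.ne'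
      have hinv := h.step hN hO hx₀ hacc.le (div_nonneg hη.le hs0.le)
        ((div_le_iff₀ hs0).2 (not_le.1 h1).le) hα.le
      rw [← hs, hα] at hinv
    · refine ⟨hinv, Or.inr h2, ?_, rfl, ?_⟩
      · simp only; linarith
      · push_cast; linarith
    · refine (ih _ hinv (not_le.1 h2) ?_).mono ?_
      · push_cast at hfuel; simp only; linarith
      · rintro r' i j ⟨ha, hb, hc, rfl, he⟩
        refine ⟨ha, hb, hc, rfl, ?_⟩
        push_cast; simp only at he; linarith

theorem ens_ringLoop (hN : SmoothNorm N Ψ g) (hO : LinOracle X O) (hx₀ : 0 ≤ x₀) (hη : 0 < η)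
    (hℓ : 0 ≤ ℓ) {fuel : ℕ} (hfuel : 1 ≤ fuel * η) :
    Prog.Ens g O (ringLoop c η fuel ⟨x₀, ℓ, 0, 0⟩) (RingSpec Ψ g X O c η x₀ ℓ) := by
  refine (ens_ringLoop_of_inv hN hO hx₀ hη fuel _
    (RingInv.init ⟨_, hO.mem c _ (hN.grad_pos _ hx₀)⟩ hℓ) one_pos (by simpa using hfuel)).mono ?_
  rintro r i j ⟨h1, h2, h3, h4, h5⟩
  exact ⟨h1, h2, h3, h4, by simpa using h5⟩

end Ring

theorem sum_update {ι A B : Type*} [Fintype ι] [DecidableEq ι] [AddCommGroup B] (F : ι → A → B)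
    (f : ι → A) (c : ι) (v : A) :
    ∑ c', F c' (Function.update f c v c') = ∑ c', F c' (f c') + (F c v - F c (f c)) := by
  rw [← Finset.add_sum_erase _ _ (Finset.mem_univ c),
    ← Finset.add_sum_erase _ (fun c' => F c' (f c')) (Finset.mem_univ c)]
  have : ∑ c' ∈ Finset.univ.erase c, F c' (Function.update f c v c') =
      ∑ c' ∈ Finset.univ.erase c, F c' (f c') :=
    Finset.sum_congr rfl fun c' hc' => by rw [Function.update_of_ne (Finset.ne_of_mem_erase hc')]
  rw [this, Function.update_self]
  abel

/-! ### Weighted sampling and exponential supermartingales. -/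

namespace Prog

variable {n d : ℕ} {α : Type} {g : (Fin d → ℝ) → Fin d → ℝ}
  {O : Fin n → (Fin d → ℝ) → Fin d → ℝ}

/-- The distribution proportional to positive weights. -/
noncomputable def weightPMF (r : Fin n → ℝ) (h : (∀ c, 0 < r c) ∧ Nonempty (Fin n)) : PMF (Fin n) :=
  PMF.ofFintype (fun c => ENNReal.ofReal (r c / ∑ c', r c')) (by
    have := h.2
    have hS : 0 < ∑ c', r c' := Finset.sum_pos (fun c _ => h.1 c) Finset.univ_nonempty
    rw [← ENNReal.ofReal_sum_of_nonneg fun c _ => (div_pos (h.1 c) hS).le, ← Finset.sum_div,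
      div_self hS.ne', ENNReal.ofReal_one])

open Classical in
/-- Draws a customer with probability proportional to its weight, if this is possible. -/
noncomputable def draw (r : Fin n → ℝ) (dflt : Prog n d α) (k : Fin n → Prog n d α) : Prog n d α :=
  if h : (∀ c, 0 < r c) ∧ Nonempty (Fin n) then sample (weightPMF r h) k else dflt

theorem ens_draw {r : Fin n → ℝ} {dflt : Prog n d α} {k : Fin n → Prog n d α}
    {Q : α → ℕ → ℕ → Prop} (hr : ∀ c, 0 < r c) (hn : Nonempty (Fin n))
    (h : ∀ c, Ens g O (k c) Q) : Ens g O (draw r dflt k) Q := by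
  rw [draw, dif_pos ⟨hr, hn⟩]
  exact h

/-- Under the drawing probabilities the mean of `exp (w c)` is at most `1 + t ≤ exp t`, so
subtracting `t` in the exponent compensates for the growth. -/
theorem ex_draw_le {r : Fin n → ℝ} {dflt : Prog n d α} {k : Fin n → Prog n d α} {φ : α → ℝ}
    {φ₀ t : ℝ} {w : Fin n → ℝ} (hr : ∀ c, 0 < r c) (hn : Nonempty (Fin n))
    (h : ∀ c, Ens g O (k c) fun a _ _ => φ a ≤ φ₀ + w c - t)
    (hw : ∑ c, r c * Real.exp (w c) ≤ (∑ c, r c) * (1 + t)) :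
    ex g O (draw r dflt k) (fun a => ENNReal.ofReal (Real.exp (φ a))) ≤
      ENNReal.ofReal (Real.exp φ₀) := by
  rw [draw, dif_pos ⟨hr, hn⟩, ex]
  have hS : 0 < ∑ c', r c' := Finset.sum_pos (fun c _ => hr c) Finset.univ_nonempty
  have h1 : ∀ c, weightPMF r ⟨hr, hn⟩ c *
      ex g O (k c) (fun a => ENNReal.ofReal (Real.exp (φ a))) ≤
        ENNReal.ofReal (r c / (∑ c', r c') * Real.exp (φ₀ + w c - t)) := by
    intro c
    rw [ENNReal.ofReal_mul (div_pos (hr c) hS).le]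
    refine mul_le_mul_right (ex_le_of_ens ((h c).mono fun a _ _ ha => ?_)) _
    exact ENNReal.ofReal_le_ofReal (Real.exp_le_exp.2 ha)
  refine (Finset.sum_le_sum fun c _ => h1 c).trans ?_
  rw [← ENNReal.ofReal_sum_of_nonneg
    fun c _ => mul_nonneg (div_pos (hr c) hS).le (Real.exp_pos _).le]
  refine ENNReal.ofReal_le_ofReal ?_
  have h2 : ∀ c, r c / (∑ c', r c') * Real.exp (φ₀ + w c - t) =
      Real.exp φ₀ * Real.exp (-t) / (∑ c', r c') * (r c * Real.exp (w c)) := by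
    intro c
    rw [show φ₀ + w c - t = φ₀ + -t + w c by ring, Real.exp_add, Real.exp_add]
    ring
  simp only [h2, ← Finset.mul_sum]
  calc Real.exp φ₀ * Real.exp (-t) / (∑ c', r c') * ∑ c, r c * Real.exp (w c)
      ≤ Real.exp φ₀ * Real.exp (-t) / (∑ c', r c') * ((∑ c, r c) * (1 + t)) :=
        mul_le_mul_of_nonneg_left hw (by positivity)
    _ = Real.exp φ₀ * (Real.exp (-t) * (1 + t)) := by field_simp
    _ ≤ Real.exp φ₀ * (Real.exp (-t) * Real.exp t) := by
        gcongr
        linarith [Real.add_one_le_exp t]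
    _ = Real.exp φ₀ := by rw [← Real.exp_add, neg_add_cancel, Real.exp_zero, mul_one]

/-- The tail bound for an exponential supermartingale. -/
theorem ex_iter_exp_le {step : α → Prog n d α} {Inv : α → Prop} {φ : α → ℝ}
    (hInv : ∀ s, Inv s → Ens g O (step s) fun s' _ _ => Inv s')
    (hφ : ∀ s, Inv s → ∀ b : ℝ, ex g O (step s) (fun s' => ENNReal.ofReal (Real.exp (φ s' + b))) ≤
      ENNReal.ofReal (Real.exp (φ s + b))) {s : α} (hs : Inv s) (N : ℕ) (a : ℝ) :
    ex g O (iter step N s) (fun s' => ENNReal.ofReal (Real.exp (φ s' + (-φ s - a)))) ≤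
      ENNReal.ofReal (Real.exp (-a)) := by
  refine (ex_iter_le (V := fun s' => ENNReal.ofReal (Real.exp (φ s' + (-φ s - a)))) hInv
    (fun s' hs' => hφ s' hs' _) hs N).trans_eq ?_
  rw [show φ s + (-φ s - a) = -a by ring]

end Prog

/-- Weak duality: gradients are prices at which no vector costs more than its norm. -/
theorem SmoothNorm.value_le {n d : ℕ} {N Ψ : (Fin d → ℝ) → ℝ} {g : (Fin d → ℝ) → Fin d → ℝ}
    {X : Fin n → Set (Fin d → ℝ)} {O : Fin n → (Fin d → ℝ) → Fin d → ℝ} (hN : SmoothNorm N Ψ g)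
    (hO : LinOracle X O) {x : Fin d → ℝ} (hx : 0 ≤ x) {s : Fin n → Fin d → ℝ}
    (hs : ∀ c, s c ∈ X c) : ∑ c, g x ⬝ᵥ O c (g x) ≤ N (∑ c, s c) := by
  refine le_trans ?_ (hN.grad_le x _ hx (Finset.sum_nonneg fun c _ => hO.nonneg c _ (hs c)))
  rw [dotProduct_sum]
  exact Finset.sum_le_sum fun c _ => hO.le c _ (hN.grad_pos x hx) _ (hs c)

/-! ### Testing a guess with adaptive rates. -/

/-- The state of the algorithm that tests a guess for the optimum: loads, service times and rates
(as exponents of two) of the customers, a bound on `Ψ` and a clock. -/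
structure GuessState (n d : ℕ) : Type where
  load : Fin n → Fin d → ℝ
  time : Fin n → ℝ
  lvl : Fin n → ℕ
  cost : ℝ
  clock : ℝ

/-- The service time of customer `c` in the next round. -/
noncomputable def GuessState.len {n d : ℕ} (s : GuessState n d) (c : Fin n) : ℝ := (2 ^ s.lvl c)⁻¹

/-- The total rate. -/
noncomputable def GuessState.rate {n d : ℕ} (s : GuessState n d) : ℝ := ∑ c, (2 : ℝ) ^ s.lvl c

/-- The state after a round for customer `c` with result `r`. -/
noncomputable def GuessState.next {n d : ℕ} (s : GuessState n d) (c : Fin n) (r : RingState d) :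
    GuessState n d where
  load := Function.update s.load c (s.load c + (r.load - ∑ c, s.load c))
  time := Function.update s.time c (s.time c + (s.len c - r.rem))
  lvl := Function.update s.lvl c (if r.rem = 0 then s.lvl c - 1 else s.lvl c + 1)
  cost := s.cost + r.cost
  clock := s.clock + s.rate⁻¹

/-- One round for a random customer. -/
noncomputable def guessStep {n d : ℕ} (s : GuessState n d) : Prog n d (GuessState n d) :=
  .draw (fun c => 2 ^ s.lvl c) (.ret s) fun c =>
    (ringLoop c (1 / 2) 2 ⟨∑ c, s.load c, s.len c, 0, 0⟩).bind fun r => .ret (s.next c r)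

/-- The initial state. -/
noncomputable def guessInit (n d : ℕ) : GuessState n d := ⟨0, 0, 0, Real.log d + 1, 0⟩

/-- Properties of the state after `k` rounds. -/
structure GuessInv {n d : ℕ} (Ψ : (Fin d → ℝ) → ℝ) (X : Fin n → Set (Fin d → ℝ)) (k : ℕ)
    (s : GuessState n d) : Prop where
  load_mem : ∀ c, s.load c ∈ s.time c • X c
  time_nonneg : ∀ c, 0 ≤ s.time c
  psi_le : Ψ (∑ c, s.load c) ≤ s.cost
  cost_pos : 0 < s.cost
  count : (k : ℝ) + ∑ c, (s.lvl c : ℝ) ≤ 2 * ∑ i, (∑ c, s.load c) i + ∑ c, s.time c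

section Guess

variable {n d : ℕ} {N Ψ : (Fin d → ℝ) → ℝ} {g : (Fin d → ℝ) → Fin d → ℝ}
  {X : Fin n → Set (Fin d → ℝ)} {O : Fin n → (Fin d → ℝ) → Fin d → ℝ} {k : ℕ}
  {s : GuessState n d} {c : Fin n} {r : RingState d} {i j : ℕ}

theorem GuessState.len_pos (s : GuessState n d) (c : Fin n) : 0 < s.len c := by
  unfold GuessState.len; positivity

theorem GuessState.len_le_one (s : GuessState n d) (c : Fin n) : s.len c ≤ 1 :=
  inv_le_one_of_one_le₀ (one_le_pow₀ one_le_two)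

theorem GuessState.rate_mul_len (s : GuessState n d) (c : Fin n) :
    (2 : ℝ) ^ s.lvl c * s.len c = 1 := mul_inv_cancel₀ (by positivity)

theorem GuessState.rate_pos (s : GuessState n d) (c : Fin n) : 0 < s.rate :=
  Finset.sum_pos (fun _ _ => by positivity) ⟨c, Finset.mem_univ c⟩

theorem GuessState.sum_next_load (s : GuessState n d) (c : Fin n) (r : RingState d) :
    ∑ c', (s.next c r).load c' = r.load := by
  have := sum_update (fun _ v => v) s.load c (s.load c + (r.load - ∑ c, s.load c))
  simp only [GuessState.next]
  rw [this]
  abel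

theorem GuessInv.load_nonneg (hO : LinOracle X O) (h : GuessInv Ψ X k s) (c : Fin n) :
    0 ≤ s.load c :=
  hO.nonneg_of_mem_smul (h.time_nonneg c) (h.load_mem c)

theorem GuessInv.sum_nonneg (hO : LinOracle X O) (h : GuessInv Ψ X k s) : 0 ≤ ∑ c, s.load c :=
  Finset.sum_nonneg fun c _ => h.load_nonneg hO c

theorem GuessInv.init (hN : SmoothNorm N Ψ g) (hne : ∀ c, (X c).Nonempty) :
    GuessInv Ψ X 0 (guessInit n d) where
  load_mem c := by
    obtain ⟨v, hv⟩ := hne c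
    exact ⟨v, hv, by simp [guessInit]⟩
  time_nonneg c := le_rfl
  psi_le := by
    have := hN.zero_le
    simp only [guessInit, Pi.zero_apply, Finset.sum_const_zero]
    linarith
  cost_pos := by
    have := Real.log_natCast_nonneg d
    simp only [guessInit]
    linarith
  count := by simp [guessInit]

/-- For `count`: a completed round lowers the level by one, or at level zero serves one full unit of
time. An interrupted round raises the level by one but adds at least one to the ℓ₁-load, which
counts twice. -/
theorem GuessInv.next (hO : LinOracle X O) (h : GuessInv Ψ X k s)
    (hr : RingSpec Ψ g X O c (1 / 2) (∑ c, s.load c) (s.len c) r i j) :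
    GuessInv Ψ X (k + 1) (s.next c r) where
  load_mem c' := by
    rcases eq_or_ne c' c with rfl | hc
    · simp only [GuessState.next, Function.update_self]
      exact hO.add_mem_smul (h.time_nonneg _) (sub_nonneg.2 hr.rem_le) (h.load_mem _) hr.mem
    · simp only [GuessState.next, Function.update_of_ne hc]
      exact h.load_mem c'
  time_nonneg c' := by
    rcases eq_or_ne c' c with rfl | hc
    · simp only [GuessState.next, Function.update_self]
      exact add_nonneg (h.time_nonneg _) (sub_nonneg.2 hr.rem_le)
    · simp only [GuessState.next, Function.update_of_ne hc]
      exact h.time_nonneg c'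
  psi_le := by
    rw [GuessState.sum_next_load]
    simp only [GuessState.next]
    linarith [hr.psi_le, h.psi_le]
  cost_pos := add_pos_of_pos_of_nonneg h.cost_pos hr.cost_nonneg
  count := by
    rw [GuessState.sum_next_load]
    have h1 := h.count
    have h2 := hr.acc_le_sum
    simp only [Pi.sub_apply, Finset.sum_sub_distrib] at h2
    have h3 := sum_update (fun _ v => v) s.time c (s.time c + (s.len c - r.rem))
    have h4 := sum_update (fun _ (v : ℕ) => (v : ℝ)) s.lvl c
      (if r.rem = 0 then s.lvl c - 1 else s.lvl c + 1)
    simp only [GuessState.next]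
    rw [h3, h4]
    have h5 := hr.acc_nonneg
    have h6 := hr.rem_le
    push_cast
    by_cases h0 : r.rem = 0
    · rw [if_pos h0]
      -- At level zero the truncated subtraction keeps the level, and the served time `1` pays for
      -- the round.
      rcases Nat.eq_zero_or_pos (s.lvl c) with hl | hl
      · have h7 : s.len c = 1 := by simp [GuessState.len, hl]
        rw [hl, h7, h0]
        norm_num
        linarith
      · push_cast [Nat.cast_sub (Nat.one_le_iff_ne_zero.2 hl.ne')]
        linarith
    · rw [if_neg h0]
      have := hr.done.resolve_left h0
      linarith

theorem ens_guessStep (hN : SmoothNorm N Ψ g) (hO : LinOracle X O) (hn : Nonempty (Fin n))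
    (h : GuessInv Ψ X k s) {Q : GuessState n d → ℕ → ℕ → Prop}
    (hQ : ∀ c r i j, RingSpec Ψ g X O c (1 / 2) (∑ c, s.load c) (s.len c) r i j →
      Q (s.next c r) i j) :
    Prog.Ens g O (guessStep s) Q := by
  refine Prog.ens_draw (fun c => by positivity) hn fun c => Prog.ens_bind.2 ?_
  refine (ens_ringLoop hN hO (h.sum_nonneg hO) (by norm_num) (s.len_pos c).le
    (by norm_num)).mono fun r i j hr => ?_
  exact hQ c r i j hr

theorem ex_guessStep_le (hN : SmoothNorm N Ψ g) (hO : LinOracle X O) (hn : Nonempty (Fin n))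
    (h : GuessInv Ψ X k s) {φ : GuessState n d → ℝ} {w : Fin n → ℝ} {t : ℝ}
    (hφ : ∀ c r i j, RingSpec Ψ g X O c (1 / 2) (∑ c, s.load c) (s.len c) r i j →
      φ (s.next c r) ≤ φ s + w c - t)
    (hw : ∑ c, (2 : ℝ) ^ s.lvl c * Real.exp (w c) ≤ s.rate * (1 + t)) (b : ℝ) :
    Prog.ex g O (guessStep s) (fun s' => ENNReal.ofReal (Real.exp (φ s' + b))) ≤
      ENNReal.ofReal (Real.exp (φ s + b)) := by
  refine Prog.ex_draw_le (w := w) (t := t) (fun c => by positivity) hn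
    (fun c => Prog.ens_bind.2 ?_) hw
  refine (ens_ringLoop hN hO (h.sum_nonneg hO) (by norm_num) (s.len_pos c).le
    (by norm_num)).mono fun r i j hr => ?_
  have := hφ c r i j hr
  simp only [Prog.Ens]
  linarith

theorem exp_neg_le_one_sub_half {a : ℝ} (h0 : 0 ≤ a) (h1 : a ≤ 1) :
    Real.exp (-a) ≤ 1 - a / 2 := by
  have h := convexOn_exp.2 (Set.mem_univ 0) (Set.mem_univ (-1)) (sub_nonneg.2 h1) h0 (by ring)
  simp only [smul_eq_mul, mul_zero, mul_neg, mul_one, zero_add, Real.exp_zero] at h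
  have h2 : Real.exp (-1) ≤ 1 / 2 := by
    rw [Real.exp_neg, inv_le_comm₀ (Real.exp_pos _) (by norm_num)]
    linarith [Real.exp_one_gt_d9]
  nlinarith

/-- As `acc ≤ 3/2`, a round costs at most `1.65 * 4 < 7` times service time times oracle value. The
drawing probability cancels the service time, so after division by 7 the mean increase is at most
the total oracle value over the total rate, hence at most the clock increment. The factor 2 comes
from `exp a ≤ 1 + 2 * a`. -/
theorem guess_cost_supermartingale (hN : SmoothNorm N Ψ g) (hO : LinOracle X O)
    (hn : Nonempty (Fin n)) (hH : ∀ x, 0 ≤ x → ∑ c, g x ⬝ᵥ O c (g x) ≤ 1) (h : GuessInv Ψ X k s)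
    (b : ℝ) :
    Prog.ex g O (guessStep s)
      (fun s' => ENNReal.ofReal (Real.exp (s'.cost / 7 - 2 * s'.clock + b))) ≤
      ENNReal.ofReal (Real.exp (s.cost / 7 - 2 * s.clock + b)) := by
  have hx := h.sum_nonneg hO
  set y := g (∑ c, s.load c) with hy
  have hpos : ∀ i, 0 < y i := hN.grad_pos _ hx
  have hval : ∀ c, 0 ≤ y ⬝ᵥ O c y := fun c => hO.dotProduct_nonneg c hpos
  refine ex_guessStep_le (φ := fun s => s.cost / 7 - 2 * s.clock) (t := 2 * s.rate⁻¹)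
    (w := fun c => s.len c * (y ⬝ᵥ O c y)) hN hO hn h ?_ ?_ b
  · intro c r i j hr
    simp only [GuessState.next]
    have h1 := hr.cost_le
    have h2 : Real.exp (1 / 2) ≤ 1.65 := by
      have : Real.exp (1 / 2) ^ 2 = Real.exp 1 := by rw [← Real.exp_nat_mul]; norm_num
      nlinarith [Real.exp_one_lt_d9, Real.exp_pos (1 / 2)]
    have h3 : (s.len c - r.rem) * (y ⬝ᵥ O c y) * (1 + 2 * r.acc) ≤
        s.len c * (y ⬝ᵥ O c y) * 4 := by
      have := hr.acc_le
      have := hr.acc_nonneg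
      have h4 : (s.len c - r.rem) * (y ⬝ᵥ O c y) ≤ s.len c * (y ⬝ᵥ O c y) :=
        mul_le_mul_of_nonneg_right (by linarith [hr.rem_nonneg]) (hval c)
      have h5 : 0 ≤ s.len c * (y ⬝ᵥ O c y) := mul_nonneg (s.len_pos c).le (hval c)
      exact mul_le_mul h4 (by linarith) (by linarith) h5
    have h6 : 0 ≤ s.len c * (y ⬝ᵥ O c y) := mul_nonneg (s.len_pos c).le (hval c)
    have h7 : r.cost ≤ 1.65 * (s.len c * (y ⬝ᵥ O c y) * 4) :=
      h1.trans ((mul_le_mul_of_nonneg_left h3 (Real.exp_pos _).le).trans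
        (mul_le_mul_of_nonneg_right h2 (by positivity)))
    linarith
  · have hle : ∀ c, y ⬝ᵥ O c y ≤ 1 := fun c =>
      (Finset.single_le_sum (f := fun c => y ⬝ᵥ O c y) (fun c _ => hval c)
        (Finset.mem_univ c)).trans (hH _ hx)
    calc ∑ c, (2 : ℝ) ^ s.lvl c * Real.exp (s.len c * (y ⬝ᵥ O c y))
        ≤ ∑ c, ((2 : ℝ) ^ s.lvl c + 2 * (y ⬝ᵥ O c y)) := by
          refine Finset.sum_le_sum fun c _ => ?_
          have h1 := exp_le_one_add_two_mul (mul_nonneg (s.len_pos c).le (hval c))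
            (mul_le_one₀ (s.len_le_one c) (hval c) (hle c))
          have h2 := mul_le_mul_of_nonneg_left h1
            (show (0 : ℝ) ≤ (2 : ℝ) ^ s.lvl c by positivity)
          refine h2.trans (le_of_eq ?_)
          linear_combination (2 * (y ⬝ᵥ O c y)) * s.rate_mul_len c
      _ = s.rate + 2 * ∑ c, y ⬝ᵥ O c y := by
          rw [Finset.sum_add_distrib, ← Finset.mul_sum, GuessState.rate]
      _ ≤ s.rate + 2 * 1 := by gcongr; exact hH _ hx
      _ = s.rate * (1 + 2 * s.rate⁻¹) := by
          obtain ⟨c⟩ := hn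
          field_simp [(s.rate_pos c).ne']

/-- The term `2 * len` makes both outcomes equally good: completion at most doubles `len` but adds
`len` to the time, interruption halves `len`. Either way the exponent, apart from the clock term,
drops by at least `len`. As the rate times `len` is one, this pays for half the clock increment. -/
theorem guess_time_supermartingale (hN : SmoothNorm N Ψ g) (hO : LinOracle X O)
    (h : GuessInv Ψ X k s) (c : Fin n) (b : ℝ) :
    Prog.ex g O (guessStep s)
      (fun s' => ENNReal.ofReal
        (Real.exp (2 * s'.len c - 3 * s'.time c + s'.clock / 2 + b))) ≤
      ENNReal.ofReal (Real.exp (2 * s.len c - 3 * s.time c + s.clock / 2 + b)) := by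
  classical
  refine ex_guessStep_le (φ := fun s => 2 * s.len c - 3 * s.time c + s.clock / 2)
    (t := -(s.rate⁻¹ / 2)) (w := Function.update 0 c (-s.len c)) hN hO ⟨c⟩ h ?_ ?_ b
  · intro c' r i j hr
    rcases eq_or_ne c c' with rfl | hc
    · simp only [GuessState.next, GuessState.len, Function.update_self]
      have h1 : (0 : ℝ) < (2 ^ s.lvl c)⁻¹ := by positivity
      have h2 := hr.rem_le
      simp only [GuessState.len] at h2
      by_cases h0 : r.rem = 0
      · rw [if_pos h0, h0]
        have : ((2 : ℝ) ^ (s.lvl c - 1))⁻¹ ≤ 2 * (2 ^ s.lvl c)⁻¹ := by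
          rw [inv_le_comm₀ (by positivity) (by positivity), mul_inv, inv_inv]
          rcases Nat.eq_zero_or_pos (s.lvl c) with hl | hl
          · rw [hl]; norm_num
          · obtain ⟨m, hm⟩ := Nat.exists_eq_succ_of_ne_zero hl.ne'
            rw [hm, Nat.succ_sub_one, pow_succ]
            linarith
        linarith
      · rw [if_neg h0, pow_succ, mul_inv]
        linarith
    · simp only [GuessState.next, GuessState.len, Function.update_of_ne hc,
        Function.update_of_ne hc.symm, Pi.zero_apply]
      linarith
  · have h1 := sum_update (fun c' v => (2 : ℝ) ^ s.lvl c' * Real.exp v) 0 c (-s.len c)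
    simp only [Pi.zero_apply, Real.exp_zero, mul_one] at h1
    rw [h1]
    have h2 := mul_le_mul_of_nonneg_left (exp_neg_le_one_sub_half (s.len_pos c).le
      (s.len_le_one c)) (show (0 : ℝ) ≤ 2 ^ s.lvl c by positivity)
    have h3 := s.rate_mul_len c
    have h4 := mul_inv_cancel₀ (s.rate_pos c).ne'
    unfold GuessState.rate at *
    linarith

/-- An upper tail for the total time. By `count`, many rounds need much load or much time, so it
shows that the clock has advanced far. -/
theorem guess_sum_time_supermartingale (hN : SmoothNorm N Ψ g) (hO : LinOracle X O)
    (hn : Nonempty (Fin n)) (h : GuessInv Ψ X k s) (b : ℝ) :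
    Prog.ex g O (guessStep s)
      (fun s' => ENNReal.ofReal (Real.exp (∑ c, s'.time c - 2 * n * s'.clock + b))) ≤
      ENNReal.ofReal (Real.exp (∑ c, s.time c - 2 * n * s.clock + b)) := by
  refine ex_guessStep_le (φ := fun s => ∑ c, s.time c - 2 * n * s.clock)
    (t := 2 * n * s.rate⁻¹) (w := s.len) hN hO hn h ?_ ?_ b
  · intro c r i j hr
    have h3 := sum_update (fun _ v => v) s.time c (s.time c + (s.len c - r.rem))
    simp only [GuessState.next]
    rw [h3]
    linarith [hr.rem_nonneg]
  · calc ∑ c, (2 : ℝ) ^ s.lvl c * Real.exp (s.len c)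
        ≤ ∑ c, ((2 : ℝ) ^ s.lvl c + 2) := by
          refine Finset.sum_le_sum fun c _ => ?_
          have h1 := exp_le_one_add_two_mul (s.len_pos c).le (s.len_le_one c)
          have h2 := mul_le_mul_of_nonneg_left h1
            (show (0 : ℝ) ≤ (2 : ℝ) ^ s.lvl c by positivity)
          refine h2.trans (le_of_eq ?_)
          linear_combination 2 * s.rate_mul_len c
      _ = s.rate + 2 * n := by
          rw [Finset.sum_add_distrib, GuessState.rate]
          simp [mul_comm]
      _ = s.rate * (1 + 2 * n * s.rate⁻¹) := by
          obtain ⟨c⟩ := hn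
          field_simp [(s.rate_pos c).ne']

theorem ens_iter_guessStep (hN : SmoothNorm N Ψ g) (hO : LinOracle X O) (hn : Nonempty (Fin n))
    (F : ℕ) :
    Prog.Ens g O (Prog.iter guessStep F (guessInit n d)) fun s i j =>
      GuessInv Ψ X F s ∧ i = j ∧ j ≤ 4 * F := by
  refine Prog.ens_iter (fun k s i j => GuessInv Ψ X k s ∧ i = j ∧ j ≤ 4 * k) ?_
    ⟨GuessInv.init hN fun c => ⟨_, hO.mem c _ (hN.grad_pos 0 le_rfl)⟩, rfl, le_rfl⟩ F
  rintro k s i j ⟨h, rfl, hj⟩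
  refine ens_guessStep hN hO hn h fun c r i' j' hr => ⟨h.next hO hr, by rw [hr.grads], ?_⟩
  have h1 := hr.calls
  have h2 := hr.acc_le
  have h3 : (j' : ℝ) ≤ (4 : ℕ) := by push_cast; linarith
  have := Nat.cast_le.1 h3
  omega

end Guess

section GuessTest

variable {n d : ℕ} {N Ψ : (Fin d → ℝ) → ℝ} {g : (Fin d → ℝ) → Fin d → ℝ}
  {X : Fin n → Set (Fin d → ℝ)} {O : Fin n → (Fin d → ℝ) → Fin d → ℝ}

open Classical in
/-- Tests whether the optimum is at most one. If the answer is positive, a solution of value at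
most 120 is returned. -/
noncomputable def guess (n d F : ℕ) : Prog n d (Option (Fin n → Fin d → ℝ)) :=
  (Prog.iter guessStep F (guessInit n d)).bind fun s =>
    .ret (if ∀ c, 0 < s.time c ∧ s.cost ≤ 120 * s.time c then
      some fun c => (s.time c)⁻¹ • s.load c else none)

theorem inv_smul_mem_of_mem_smul {S : Set (Fin d → ℝ)} {a : ℝ} {v : Fin d → ℝ} (ha : 0 < a)
    (hv : v ∈ a • S) : a⁻¹ • v ∈ S := by
  obtain ⟨x, hx, rfl⟩ := hv
  simpa [smul_smul, inv_mul_cancel₀ ha.ne'] using hx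

/-- Entrywise, dividing each load by its own time gives at most `t` times the total load. -/
theorem SmoothNorm.norm_sum_inv_smul_le (hN : SmoothNorm N Ψ g) {load : Fin n → Fin d → ℝ}
    {time : Fin n → ℝ} {t : ℝ} (ht : 0 ≤ t) (hload : ∀ c, 0 ≤ load c) (htime : ∀ c, 0 < time c)
    (h : ∀ c, (time c)⁻¹ ≤ t) :
    N (∑ c, (time c)⁻¹ • load c) ≤ t * N (∑ c, load c) := by
  refine le_trans (hN.mono _ (t • ∑ c, load c) ?_ ?_) (hN.smul_le _ _ ht)
  · exact Finset.sum_nonneg fun c _ => smul_nonneg (inv_nonneg.2 (htime c).le) (hload c)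
  · rw [Finset.smul_sum]
    exact Finset.sum_le_sum fun c _ => smul_le_smul_of_nonneg_right (h c) (hload c)

theorem ens_guess (hN : SmoothNorm N Ψ g) (hO : LinOracle X O) (hn : Nonempty (Fin n)) (F : ℕ) :
    Prog.Ens g O (guess n d F) fun o i j =>
      (∀ σ ∈ o, (∀ c, σ c ∈ X c) ∧ N (∑ c, σ c) ≤ 120) ∧ i = j ∧ j ≤ 4 * F := by
  refine Prog.ens_bind.2 ((ens_iter_guessStep hN hO hn F).mono ?_)
  rintro s i j ⟨h, hij, hj⟩
  refine ⟨?_, by simpa using hij, by simpa using hj⟩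
  intro σ hσ
  split_ifs at hσ with htest
  · rw [Option.mem_some_iff] at hσ
    subst hσ
    refine ⟨fun c => inv_smul_mem_of_mem_smul (htest c).1 (h.load_mem c), ?_⟩
    have h1 : N (∑ c, (s.time c)⁻¹ • s.load c) ≤ 120 / s.cost * N (∑ c, s.load c) := by
      refine hN.norm_sum_inv_smul_le (div_pos (by norm_num) h.cost_pos).le (h.load_nonneg hO)
        (fun c => (htest c).1) fun c => ?_
      rw [inv_eq_one_div, div_le_div_iff₀ (htest c).1 h.cost_pos, one_mul]
      exact (htest c).2
    refine h1.trans ?_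
    rw [div_mul_eq_mul_div, div_le_iff₀ h.cost_pos]
    have := (hN.lower _ (h.sum_nonneg hO)).trans h.psi_le
    linarith
  · simp at hσ

theorem one_le_ofReal_exp {z : ℝ} (hz : 0 ≤ z) : 1 ≤ ENNReal.ofReal (Real.exp z) := by
  rw [← ENNReal.ofReal_one]
  exact ENNReal.ofReal_le_ofReal (Real.one_le_exp hz)

/-- The logarithm in the bound on the number of calls is not too small. -/
theorem log_add_bounds {n d : ℕ} (hn : 1 ≤ n) (hd : 1 ≤ d) :
    0.69 ≤ Real.log (n + d) ∧ Real.log d ≤ Real.log (n + d) := by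
  have h1 : (1 : ℝ) ≤ n := by exact_mod_cast hn
  have h2 : (1 : ℝ) ≤ d := by exact_mod_cast hd
  refine ⟨?_, Real.log_le_log (by linarith) (by linarith)⟩
  have := Real.log_le_log (show (0 : ℝ) < 2 by norm_num) (show (2 : ℝ) ≤ n + d by linarith)
  linarith [Real.log_two_gt_d9]

/-- The tails give `U ≤ 14τ + O(L)`, `A ≥ τ/6 - O(L)` and `sA ≤ 2nτ + O(L)`. If `τ < 1000L`, the
first and the third contradict `hcount` and `hF`. Otherwise `120 * A ≥ 20τ - O(L)` exceeds the bound
on `U`. -/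
theorem guess_test_of_tails {n d : ℕ} (hn : 1 ≤ n) (hd : 1 ≤ d) {L F U U₀ τ A sx sA len : ℝ}
    (hL : 0.69 ≤ L) (hF : 30000 * (n + d) * L ≤ F) (hU₀ : U₀ ≤ L + 1)
    (hcount : F ≤ 2 * sx + sA) (hsx : sx ≤ d * U) (hlen : 0 ≤ len)
    (h1 : U / 7 - 2 * τ + (-(U₀ / 7) - 60 * L) < 0)
    (h2 : 2 * len - 3 * A + τ / 2 + (-2 - 60 * L) < 0)
    (h3 : sA - 2 * n * τ + (- 60 * L) < 0) : 0 < A ∧ U ≤ 120 * A := by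
  have hn' : (1 : ℝ) ≤ n := by exact_mod_cast hn
  have hd' : (1 : ℝ) ≤ d := by exact_mod_cast hd
  have hU : U ≤ 14 * τ + 423 * L := by linarith
  have hτ : 1000 * L ≤ τ := by
    by_contra hlt
    rw [not_le] at hlt
    have h4 : (d : ℝ) * U ≤ d * (14 * (1000 * L) + 423 * L) :=
      mul_le_mul_of_nonneg_left (by linarith) (by linarith)
    have h5 : (n : ℝ) * τ ≤ n * (1000 * L) := mul_le_mul_of_nonneg_left hlt.le (by linarith)
    have h6 : L ≤ d * L := le_mul_of_one_le_left (by linarith) hd'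
    have h7 : L ≤ n * L := le_mul_of_one_le_left (by linarith) hn'
    nlinarith
  constructor <;> linarith

/-- Of an optimum at most one, only its consequence `hH` for oracle values is needed. The union
bound covers `n` lower tails of times and two further tails. -/
theorem ex_guess_le (hN : SmoothNorm N Ψ g) (hO : LinOracle X O) (hn : 1 ≤ n) (hd : 1 ≤ d)
    (hH : ∀ x, 0 ≤ x → ∑ c, g x ⬝ᵥ O c (g x) ≤ 1) {F : ℕ}
    (hF : 30000 * (n + d) * Real.log (n + d) ≤ F) :
    Prog.ex g O (guess n d F) (fun o => if o.isNone then 1 else 0) ≤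
      (n + 2) * ENNReal.ofReal (Real.exp (-(60 * Real.log (n + d)))) := by
  have hne : Nonempty (Fin n) := ⟨⟨0, hn⟩⟩
  set L := Real.log (n + d) with hL
  obtain ⟨hL1, hL2⟩ := log_add_bounds hn hd
  set s₀ := guessInit n d with hs₀
  set φ₁ : GuessState n d → ℝ := fun s => s.cost / 7 - 2 * s.clock
  set φ₂ : Fin n → GuessState n d → ℝ := fun c s => 2 * s.len c - 3 * s.time c + s.clock / 2
  set φ₃ : GuessState n d → ℝ := fun s => ∑ c, s.time c - 2 * n * s.clock
  set f : (GuessState n d → ℝ) → GuessState n d → ℝ≥0∞ := fun φ s =>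
    ENNReal.ofReal (Real.exp (φ s + (-φ s₀ - 60 * L))) with hf
  have hinit : ∃ k, GuessInv Ψ X k s₀ :=
    ⟨0, GuessInv.init hN fun c => ⟨_, hO.mem c _ (hN.grad_pos 0 le_rfl)⟩⟩
  have hInv : ∀ s, (∃ k, GuessInv Ψ X k s) → Prog.Ens g O (guessStep s)
      fun s' _ _ => ∃ k, GuessInv Ψ X k s' := by
    rintro s ⟨k, h⟩
    exact ens_guessStep hN hO hne h fun c r i j hr => ⟨k + 1, h.next hO hr⟩
  have e₁ : Prog.ex g O (Prog.iter guessStep F s₀) (f φ₁) ≤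
      ENNReal.ofReal (Real.exp (-(60 * L))) :=
    Prog.ex_iter_exp_le (φ := φ₁) hInv
      (fun s ⟨k, h⟩ b => guess_cost_supermartingale hN hO hne hH h b) hinit F (60 * L)
  have e₂ : ∀ c, Prog.ex g O (Prog.iter guessStep F s₀) (f (φ₂ c)) ≤
      ENNReal.ofReal (Real.exp (-(60 * L))) := fun c =>
    Prog.ex_iter_exp_le (φ := φ₂ c) hInv
      (fun s ⟨k, h⟩ b => guess_time_supermartingale hN hO h c b) hinit F (60 * L)
  have e₃ : Prog.ex g O (Prog.iter guessStep F s₀) (f φ₃) ≤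
      ENNReal.ofReal (Real.exp (-(60 * L))) :=
    Prog.ex_iter_exp_le (φ := φ₃) hInv
      (fun s ⟨k, h⟩ b => guess_sum_time_supermartingale hN hO hne h b) hinit F (60 * L)
  rw [guess, Prog.ex_bind]
  calc _ ≤ Prog.ex g O (Prog.iter guessStep F s₀)
        (fun s => (∑ c, f (φ₂ c) s) + (f φ₁ s + f φ₃ s)) := by
        refine Prog.ex_le_ex ((ens_iter_guessStep hN hO hne F).mono ?_)
        rintro s i j ⟨h, -, -⟩
        simp only [Prog.ex]
        split_ifs with htest hnone
        · simp at hnone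
        · exact zero_le
        -- Markov's inequality and the union bound, pointwise: if the sum is below one, all
        -- exponents are negative and the test succeeds.
        · by_contra hlt
          rw [not_le] at hlt
          refine htest fun c => ?_
          have hneg : ∀ φ, f φ s < 1 → φ s + (-φ s₀ - 60 * L) < 0 := fun φ hφ =>
            not_le.1 fun hz => hφ.not_ge (one_le_ofReal_exp hz)
          have h1 := hneg φ₁ ((le_add_left (le_add_right le_rfl)).trans_lt hlt)
          have h3 := hneg φ₃ ((le_add_left (le_add_left le_rfl)).trans_lt hlt)
          have h2 := hneg (φ₂ c) (((Finset.single_le_sum (f := fun c => f (φ₂ c) s)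
            (fun _ _ => zero_le) (Finset.mem_univ c)).trans (le_add_right le_rfl)).trans_lt hlt)
          have hx := h.sum_nonneg hO
          have hcount := h.count
          have hlvl : (0 : ℝ) ≤ ∑ c, (s.lvl c : ℝ) := Finset.sum_nonneg fun _ _ => Nat.cast_nonneg _
          refine guess_test_of_tails hn hd (U₀ := Real.log d + 1) (τ := s.clock)
            (sx := ∑ i, (∑ c, s.load c) i) (sA := ∑ c, s.time c) (len := s.len c) hL1 hF
            (by linarith) (by linarith) ?_ (s.len_pos c).le ?_ ?_ ?_
          · refine (hN.sum_le _ hx).trans (mul_le_mul_of_nonneg_left ?_ (Nat.cast_nonneg d))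
            exact (hN.lower _ hx).trans h.psi_le
          · simpa [φ₁, hs₀, guessInit] using h1
          · simpa [φ₂, hs₀, guessInit, GuessState.len] using h2
          · simpa [φ₃, hs₀, guessInit] using h3
        · rename_i hnone
          simp at hnone
    _ ≤ (∑ _c : Fin n, ENNReal.ofReal (Real.exp (-(60 * L)))) +
        (ENNReal.ofReal (Real.exp (-(60 * L))) + ENNReal.ofReal (Real.exp (-(60 * L)))) := by
        rw [Prog.ex_add, Prog.ex_add, Prog.ex_sum]
        exact add_le_add (Finset.sum_le_sum fun c _ => e₂ c) (add_le_add e₁ e₃)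
    _ = _ := by
        rw [Finset.sum_const, Finset.card_univ, Fintype.card_fin, nsmul_eq_mul]
        ring

end GuessTest

theorem LinOracle.rescale {n d : ℕ} {X : Fin n → Set (Fin d → ℝ)}
    {O : Fin n → (Fin d → ℝ) → Fin d → ℝ} (hO : LinOracle X O) {t : ℝ} (ht : 0 ≤ t) :
    LinOracle (fun c => t • X c) fun c y => t • O c y where
  convex c := (hO.convex c).smul t
  nonneg c x hx := hO.nonneg_of_mem_smul ht hx
  mem c y hy := Set.smul_mem_smul_set (hO.mem c y hy)
  le c y hy := by
    rintro _ ⟨x, hx, rfl⟩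
    simp only [dotProduct_smul, smul_eq_mul]
    exact mul_le_mul_of_nonneg_left (hO.le c y hy x hx) ht

/-! ### Binary search for the order of magnitude of the optimum. -/

section Search

variable {n d : ℕ} {N Ψ : (Fin d → ℝ) → ℝ} {g : (Fin d → ℝ) → Fin d → ℝ}
  {X : Fin n → Set (Fin d → ℝ)} {O : Fin n → (Fin d → ℝ) → Fin d → ℝ}

/-- Tests whether the optimum is at most `G`. -/
noncomputable def guessAt (n d F : ℕ) (G : ℝ) : Prog n d (Option (Fin n → Fin d → ℝ)) :=
  ((guess n d F).rescale G⁻¹).bind fun o => .ret (o.map fun σ c => G • σ c)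

theorem ens_guessAt (hN : SmoothNorm N Ψ g) (hO : LinOracle X O) (hn : Nonempty (Fin n)) (F : ℕ)
    {G : ℝ} (hG : 0 < G) :
    Prog.Ens g O (guessAt n d F G) fun o i j =>
      (∀ σ ∈ o, (∀ c, σ c ∈ X c) ∧ N (∑ c, σ c) ≤ 120 * G) ∧ i = j ∧ j ≤ 4 * F := by
  refine Prog.ens_bind.2 (Prog.ens_rescale.2
    ((ens_guess hN (hO.rescale (inv_pos.2 hG).le) hn F).mono ?_))
  rintro o i j ⟨h, hij, hj⟩
  refine ⟨?_, by simpa using hij, by simpa using hj⟩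
  intro σ hσ
  obtain ⟨σ', hσ', rfl⟩ := Option.mem_map.1 hσ
  obtain ⟨h1, h2⟩ := h σ' hσ'
  refine ⟨fun c => ?_, ?_⟩
  · obtain ⟨x, hx, hxe⟩ := h1 c
    simp only at hxe
    change G • σ' c ∈ X c
    rw [← hxe, smul_smul, mul_inv_cancel₀ hG.ne', one_smul]
    exact hx
  · rw [← Finset.smul_sum]
    exact (hN.smul_le G _ hG.le).trans (by nlinarith)

theorem ex_guessAt_le (hN : SmoothNorm N Ψ g) (hO : LinOracle X O) (hn : 1 ≤ n) (hd : 1 ≤ d)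
    {G : ℝ} (hG : 0 < G) (hH : ∀ x, 0 ≤ x → ∑ c, g x ⬝ᵥ O c (g x) ≤ G) {F : ℕ}
    (hF : 30000 * (n + d) * Real.log (n + d) ≤ F) :
    Prog.ex g O (guessAt n d F G) (fun o => if o.isNone then 1 else 0) ≤
      (n + 2) * ENNReal.ofReal (Real.exp (-(60 * Real.log (n + d)))) := by
  rw [guessAt, Prog.ex_bind, Prog.ex_rescale]
  simp only [Prog.ex, Option.isNone_map]
  refine ex_guess_le hN (hO.rescale (inv_pos.2 hG).le) hn hd (fun x hx => ?_) hF
  simp only [dotProduct_smul, smul_eq_mul, ← Finset.mul_sum]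
  exact inv_mul_le_one_of_le₀ (hH x hx) hG.le

/-- Searches for an exponent `lo` such that `G / 2 ^ lo` is close to the optimum, and a solution of
value at most `120 * (G / 2 ^ lo)`. -/
noncomputable def search (F : ℕ) (G : ℝ) :
    ℕ → ℕ × (Fin n → Fin d → ℝ) → Prog n d (ℕ × (Fin n → Fin d → ℝ))
  | 0, p => .ret p
  | k + 1, p => (guessAt n d F (G / 2 ^ (p.1 + 2 ^ k))).bind fun o =>
      search F G k (o.elim p fun σ => (p.1 + 2 ^ k, σ))

theorem ens_search (hN : SmoothNorm N Ψ g) (hO : LinOracle X O) (hn : Nonempty (Fin n)) (F : ℕ)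
    {G : ℝ} (hG : 0 < G) (k : ℕ) (p : ℕ × (Fin n → Fin d → ℝ))
    (hp : (∀ c, p.2 c ∈ X c) ∧ N (∑ c, p.2 c) ≤ 120 * (G / 2 ^ p.1)) :
    Prog.Ens g O (search F G k p) fun q i j =>
      ((∀ c, q.2 c ∈ X c) ∧ N (∑ c, q.2 c) ≤ 120 * (G / 2 ^ q.1)) ∧ i = j ∧ j ≤ 4 * F * k := by
  induction k generalizing p with
  | zero => exact ⟨hp, rfl, le_rfl⟩
  | succ k ih =>
    refine Prog.ens_bind.2 ((ens_guessAt hN hO hn F (by positivity)).mono ?_)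
    rintro o i j ⟨h, rfl, hj⟩
    refine (ih _ ?_).mono ?_
    · cases o with
      | none => exact hp
      | some σ => exact h σ rfl
    · rintro q i' j' ⟨h1, rfl, h2⟩
      refine ⟨h1, rfl, ?_⟩
      rw [mul_add]
      omega

open Classical in
-- The interval of exponents from `lo` to `lo + 2 ^ k` keeps its upper end good: `G / 2 ^ (lo + 2 ^
-- k) ≤ T`. A failed test endangers this only if the guess at the midpoint exceeds `T`, and then
-- failure is unlikely.
theorem ex_search_le (hN : SmoothNorm N Ψ g) (hO : LinOracle X O) (hn : 1 ≤ n) (hd : 1 ≤ d)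
    {G T : ℝ} (hG : 0 < G) (hH : ∀ x, 0 ≤ x → ∑ c, g x ⬝ᵥ O c (g x) ≤ T) {F : ℕ}
    (hF : 30000 * (n + d) * Real.log (n + d) ≤ F) (k : ℕ) (p : ℕ × (Fin n → Fin d → ℝ))
    (hp : G / 2 ^ (p.1 + 2 ^ k) ≤ T) :
    Prog.ex g O (search F G k p) (fun q => if G / 2 ^ (q.1 + 1) ≤ T then 0 else 1) ≤
      k * ((n + 2) * ENNReal.ofReal (Real.exp (-(60 * Real.log (n + d))))) := by
  induction k generalizing p with
  | zero => simpa [search, Prog.ex] using hp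
  | succ k ih =>
    set δ := ((n : ℝ≥0∞) + 2) * ENNReal.ofReal (Real.exp (-(60 * Real.log (n + d)))) with hδ
    have hp' : G / 2 ^ (p.1 + 2 ^ k + 2 ^ k) ≤ T := by
      rwa [add_assoc, ← two_mul, ← pow_succ']
    rw [search, Prog.ex_bind]
    by_cases hmid : G / 2 ^ (p.1 + 2 ^ k) ≤ T
    -- Here both answers of the test preserve the condition on the upper end.
    · refine (Prog.ex_le_of_ens (r := k * δ) (Prog.Ens.of_forall fun o _ _ => ?_)).trans ?_
      · cases o with
        | none => exact ih _ hmid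
        | some σ => exact ih _ hp'
      · push_cast
        gcongr
        exact le_self_add
    · calc _ ≤ Prog.ex g O (guessAt n d F (G / 2 ^ (p.1 + 2 ^ k)))
            (fun o => k * δ + if o.isNone then 1 else 0) := by
            refine Prog.ex_le_ex (Prog.Ens.of_forall fun o _ _ => ?_)
            cases o with
            | none =>
              refine (Prog.ex_le_of_ens (r := 1) (Prog.Ens.of_forall fun q _ _ => ?_)).trans ?_
              · split_ifs <;> simp
              · simp
            | some σ => simpa using ih _ hp'
        _ ≤ k * δ + δ := by
            rw [Prog.ex_add, Prog.ex_const]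
            gcongr
            exact ex_guessAt_le hN hO hn hd (by positivity)
              (fun x hx => (hH x hx).trans (not_le.1 hmid).le) hF
        _ = _ := by push_cast; ring

end Search

/-! ### The main phase, started from a constant-factor approximation. -/

/-- A solution `σ` of value at most one and a small accuracy parameter. -/
structure WarmStart {n d : ℕ} (N : (Fin d → ℝ) → ℝ) (X : Fin n → Set (Fin d → ℝ)) (e : ℝ)
    (σ : Fin n → Fin d → ℝ) : Prop where
  mem : ∀ c, σ c ∈ X c
  norm_le : N (∑ c, σ c) ≤ 1
  pos : 0 < e
  le : e ≤ 1 / 20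
  one_le_n : 1 ≤ n
  one_le_d : 1 ≤ d

/-- The rates of the customers at prices `y`. -/
noncomputable def solveRate {n d : ℕ} (e : ℝ) (σ : Fin n → Fin d → ℝ) (y : Fin d → ℝ)
    (c : Fin n) : ℝ :=
  12 * (n + d) / e * (1 / n + y ⬝ᵥ σ c + ‖σ c‖ / d)

/-- The state of the main phase: loads and service times of the customers, a bound on `Ψ`, the
accumulated prices and a clock. -/
structure SolveState (n d : ℕ) : Type where
  load : Fin n → Fin d → ℝ
  time : Fin n → ℝ
  cost : ℝ
  price : Fin d → ℝ
  clock : ℝ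

/-- The state after a round for customer `c` that started with prices `y`, had the result `r` and
was completed, at prices `y'`, with the given solution. -/
noncomputable def SolveState.next {n d : ℕ} (e : ℝ) (σ : Fin n → Fin d → ℝ) (s : SolveState n d)
    (y : Fin d → ℝ) (c : Fin n) (r : RingState d) (y' : Fin d → ℝ) : SolveState n d where
  load := Function.update s.load c (s.load c + (r.load - ∑ c, s.load c + r.rem • σ c))
  time := Function.update s.time c (s.time c + (solveRate e σ y c)⁻¹)
  cost := s.cost + (r.cost + 3 * (r.rem * (y' ⬝ᵥ σ c)))
  price := s.price + (∑ c, solveRate e σ y c)⁻¹ • y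
  clock := s.clock + (∑ c, solveRate e σ y c)⁻¹

/-- One round for a random customer. -/
noncomputable def solveStep {n d : ℕ} (e : ℝ) (σ : Fin n → Fin d → ℝ) (s : SolveState n d) :
    Prog n d (SolveState n d) :=
  .grad (∑ c, s.load c) fun y => .draw (solveRate e σ y) (.ret s) fun c =>
    (ringLoop c e ⌈e⁻¹⌉₊ ⟨∑ c, s.load c, (solveRate e σ y c)⁻¹, 0, 0⟩).bind fun r =>
      .grad r.load fun y' => .ret (s.next e σ y c r y')

/-- The initial state. -/
noncomputable def solveInit (n d : ℕ) : SolveState n d := ⟨0, 0, Real.log d + 1, 0, 0⟩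

/-- Properties of the state after `k` rounds. -/
structure SolveInv {n d : ℕ} (N Ψ : (Fin d → ℝ) → ℝ) (X : Fin n → Set (Fin d → ℝ))
    (O : Fin n → (Fin d → ℝ) → Fin d → ℝ) (e : ℝ) (k : ℕ) (s : SolveState n d) : Prop where
  load_mem : ∀ c, s.load c ∈ s.time c • X c
  time_nonneg : ∀ c, 0 ≤ s.time c
  psi_le : Ψ (∑ c, s.load c) ≤ s.cost
  cost_pos : 0 < s.cost
  cost_le : s.cost ≤ Real.log d + 1 + k * (1.2 * (e / (n + d)))
  price_nonneg : 0 ≤ s.price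
  price_min : ∀ c, ∀ x ∈ X c, s.price ⬝ᵥ O c s.price ≤ s.price ⬝ᵥ x
  price_le : ∀ x, 0 ≤ x → s.price ⬝ᵥ x ≤ s.clock * N x
  le_clock : k * (e / (36 * (n + d))) ≤ s.clock

section Solve

variable {n d : ℕ} {N Ψ : (Fin d → ℝ) → ℝ} {g : (Fin d → ℝ) → Fin d → ℝ}
  {X : Fin n → Set (Fin d → ℝ)} {O : Fin n → (Fin d → ℝ) → Fin d → ℝ} {e : ℝ}
  {σ : Fin n → Fin d → ℝ} {k : ℕ} {s : SolveState n d} {c : Fin n} {r : RingState d} {i j : ℕ}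
  {y : Fin d → ℝ}

theorem SolveInv.load_nonneg (hO : LinOracle X O) (h : SolveInv N Ψ X O e k s) (c : Fin n) :
    0 ≤ s.load c :=
  hO.nonneg_of_mem_smul (h.time_nonneg c) (h.load_mem c)

theorem SolveInv.sum_nonneg (hO : LinOracle X O) (h : SolveInv N Ψ X O e k s) :
    0 ≤ ∑ c, s.load c :=
  Finset.sum_nonneg fun c _ => h.load_nonneg hO c

theorem WarmStart.cast_pos (hW : WarmStart N X e σ) : (1 : ℝ) ≤ n ∧ (1 : ℝ) ≤ d :=
  ⟨by exact_mod_cast hW.one_le_n, by exact_mod_cast hW.one_le_d⟩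

theorem WarmStart.rate_pos (hW : WarmStart N X e σ) (hO : LinOracle X O) (hy : ∀ i, 0 < y i)
    (c : Fin n) : 0 < solveRate e σ y c := by
  obtain ⟨hn, hd⟩ := hW.cast_pos
  have := hW.pos
  have := dotProduct_nonneg_of_pos hy (hO.nonneg c _ (hW.mem c))
  unfold solveRate
  positivity

/-- Each summand of the rate controls one quantity during a service interval: `1 / n` its length, `y
⬝ᵥ σ c` the price of serving with `σ c`, and `‖σ c‖ / d` the norm of doing so. -/
theorem WarmStart.inv_rate_mul_le (hW : WarmStart N X e σ) (hO : LinOracle X O)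
    (hy : ∀ i, 0 < y i) (c : Fin n) {a : ℝ} (ha : a ≤ 1 / n + y ⬝ᵥ σ c + ‖σ c‖ / d) :
    (solveRate e σ y c)⁻¹ * a ≤ e / (12 * (n + d)) := by
  obtain ⟨hn, hd⟩ := hW.cast_pos
  have he := hW.pos
  rw [inv_mul_le_iff₀ (hW.rate_pos hO hy c), solveRate]
  refine ha.trans (le_of_eq ?_)
  field_simp

theorem WarmStart.inv_rate_mul_price_le (hW : WarmStart N X e σ) (hO : LinOracle X O)
    (hy : ∀ i, 0 < y i) (c : Fin n) :
    (solveRate e σ y c)⁻¹ * (y ⬝ᵥ σ c) ≤ e / (12 * (n + d)) := by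
  refine hW.inv_rate_mul_le hO hy c ?_
  have : (0 : ℝ) ≤ 1 / n := by positivity
  have : 0 ≤ ‖σ c‖ / d := by positivity
  linarith

theorem WarmStart.inv_rate_le (hW : WarmStart N X e σ) (hO : LinOracle X O)
    (hy : ∀ i, 0 < y i) (c : Fin n) : (solveRate e σ y c)⁻¹ ≤ e / 12 := by
  obtain ⟨hn, hd⟩ := hW.cast_pos
  have he := hW.pos
  have h1 := hW.inv_rate_mul_le hO hy c (a := 1 / n) (by
    have : 0 ≤ ‖σ c‖ / d := by positivity
    linarith [dotProduct_nonneg_of_pos hy (hO.nonneg c _ (hW.mem c))])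
  rw [mul_one_div, div_le_iff₀ (by linarith)] at h1
  refine h1.trans ?_
  rw [div_mul_eq_mul_div, div_le_div_iff₀ (by positivity) (by norm_num)]
  nlinarith

theorem WarmStart.inv_rate_mul_norm_le (hW : WarmStart N X e σ) (hO : LinOracle X O)
    (hy : ∀ i, 0 < y i) (c : Fin n) : (solveRate e σ y c)⁻¹ * ‖σ c‖ ≤ e / 12 := by
  obtain ⟨hn, hd⟩ := hW.cast_pos
  have he := hW.pos
  have h1 := hW.inv_rate_mul_le hO hy c (a := ‖σ c‖ / d) (by
    have : (0 : ℝ) ≤ 1 / n := by positivity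
    linarith [dotProduct_nonneg_of_pos hy (hO.nonneg c _ (hW.mem c))])
  rw [← mul_div_assoc, div_le_iff₀ (by linarith)] at h1
  refine h1.trans ?_
  rw [div_mul_eq_mul_div, div_le_div_iff₀ (by positivity) (by norm_num)]
  nlinarith

/-- Each of the three kinds of summands totals at most one: the first exactly, the prices by
`grad_le`, and the norms because the ℓ₁-norm is at most `d * N`. -/
theorem WarmStart.sum_rate (hW : WarmStart N X e σ) (hN : SmoothNorm N Ψ g) (hO : LinOracle X O)
    {x : Fin d → ℝ} (hx : 0 ≤ x) :
    12 * (n + d) / e ≤ ∑ c, solveRate e σ (g x) c ∧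
      ∑ c, solveRate e σ (g x) c ≤ 36 * (n + d) / e := by
  obtain ⟨hn, hd⟩ := hW.cast_pos
  have he := hW.pos
  have hσ : ∀ c, 0 ≤ σ c := fun c => hO.nonneg c _ (hW.mem c)
  have hs : 0 ≤ ∑ c, σ c := Finset.sum_nonneg fun c _ => hσ c
  have h1 : ∑ c, solveRate e σ (g x) c =
      12 * (n + d) / e * (1 + g x ⬝ᵥ (∑ c, σ c) + (∑ c, ‖σ c‖) / d) := by
    simp only [solveRate, ← Finset.mul_sum, Finset.sum_add_distrib, dotProduct_sum,
      Finset.sum_div]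
    congr 3
    rw [Finset.sum_const, Finset.card_univ, Fintype.card_fin, nsmul_eq_mul]
    field_simp
  have h2 : 0 ≤ g x ⬝ᵥ (∑ c, σ c) := dotProduct_nonneg_of_pos (hN.grad_pos x hx) hs
  have h3 : g x ⬝ᵥ (∑ c, σ c) ≤ 1 := (hN.grad_le x _ hx hs).trans hW.norm_le
  have h4 : 0 ≤ (∑ c, ‖σ c‖) / d := by positivity
  have h5 : (∑ c, ‖σ c‖) / d ≤ 1 := by
    rw [div_le_one (by linarith)]
    calc ∑ c, ‖σ c‖ ≤ ∑ c, ∑ i, σ c i := Finset.sum_le_sum fun c _ => norm_le_sum_of_nonneg (hσ c)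
      _ = ∑ i, (∑ c, σ c) i := by rw [Finset.sum_comm]; simp
      _ ≤ d * N (∑ c, σ c) := hN.sum_le _ hs
      _ ≤ d := mul_le_of_le_one_right (by linarith) hW.norm_le
  have h6 : 0 ≤ 12 * (n + d) / e := by positivity
  rw [h1]
  refine ⟨le_mul_of_one_le_right h6 (by linarith), ?_⟩
  calc _ ≤ 12 * (n + d) / e * 3 := mul_le_mul_of_nonneg_left (by linarith) h6
    _ = _ := by ring

theorem SolveState.sum_next_load (e : ℝ) (σ : Fin n → Fin d → ℝ) (s : SolveState n d)
    (y : Fin d → ℝ) (c : Fin n) (r : RingState d) (y' : Fin d → ℝ) :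
    ∑ c', (s.next e σ y c r y').load c' = r.load + r.rem • σ c := by
  have := sum_update (fun _ v => v) s.load c
    (s.load c + (r.load - ∑ c, s.load c + r.rem • σ c))
  simp only [SolveState.next]
  rw [this]
  abel

theorem exp_le_of_le_twentieth {a : ℝ} (ha : 0 ≤ a) (ha' : a ≤ 1 / 20) :
    Real.exp a ≤ 1 + 1.06 * a := by
  have h := Real.abs_exp_sub_one_sub_id_le (x := a) (by rw [abs_of_nonneg ha]; linarith)
  have := (abs_le.1 h).2
  nlinarith

/-- Time remains to be filled only after an interruption, when `acc ≥ 1`, so the cost can be charged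
to `acc`. Prices have drifted by a factor of at most `exp 1.05 < 3`. -/
theorem WarmStart.fill_le (hW : WarmStart N X e σ) (hN : SmoothNorm N Ψ g) (hO : LinOracle X O)
    (h : SolveInv N Ψ X O e k s) (hy : y = g (∑ c, s.load c))
    (hr : RingSpec Ψ g X O c e (∑ c, s.load c) (solveRate e σ y c)⁻¹ r i j) :
    0 ≤ r.rem * (g r.load ⬝ᵥ σ c) ∧ r.rem * (g r.load ⬝ᵥ σ c) ≤ 3 * r.acc * (e / (12 * (n + d))) ∧
      Ψ (r.load + r.rem • σ c) ≤ Ψ r.load + 3 * (r.rem * (g r.load ⬝ᵥ σ c)) := by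
  obtain ⟨hn, hd⟩ := hW.cast_pos
  have he := hW.pos
  have he' := hW.le
  have hx := h.sum_nonneg hO
  have hx' : 0 ≤ r.load := hx.trans (hr.le hO)
  have hypos : ∀ i, 0 < y i := by rw [hy]; exact hN.grad_pos _ hx
  have hσ : 0 ≤ σ c := hO.nonneg c _ (hW.mem c)
  have hκ := dotProduct_nonneg_of_pos hypos hσ
  have h1 : 0 ≤ g r.load ⬝ᵥ σ c := dotProduct_nonneg_of_pos (hN.grad_pos _ hx') hσ
  have h2 : 0 ≤ r.rem * (g r.load ⬝ᵥ σ c) := mul_nonneg hr.rem_nonneg h1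
  refine ⟨h2, ?_, ?_⟩
  · have h3 : g r.load ⬝ᵥ σ c ≤ 3 * (y ⬝ᵥ σ c) := by
      have h4 := hN.grad_add_le _ _ hx (sub_nonneg.2 (hr.le hO))
      rw [add_sub_cancel, ← hy] at h4
      have h5 := dotProduct_le_dotProduct_of_nonneg_right h4 hσ
      rw [smul_dotProduct, smul_eq_mul] at h5
      refine h5.trans (mul_le_mul_of_nonneg_right ?_ hκ)
      have h6 : Real.exp ‖r.load - ∑ c, s.load c‖ ≤ Real.exp (1 + 1 / 20) :=
        Real.exp_le_exp.2 (hr.norm_le.trans (hr.acc_le.trans (by linarith)))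
      have h7 := exp_le_of_le_twentieth (a := 1 / 20) (by norm_num) le_rfl
      rw [Real.exp_add] at h6
      have := mul_le_mul Real.exp_one_lt_d9.le h7 (Real.exp_pos _).le (by norm_num)
      linarith
    rcases hr.done with h0 | hacc
    · rw [h0, zero_mul]
      have := hr.acc_nonneg
      positivity
    · have h8 := hW.inv_rate_mul_price_le hO hypos c
      calc r.rem * (g r.load ⬝ᵥ σ c) ≤ (solveRate e σ y c)⁻¹ * (3 * (y ⬝ᵥ σ c)) :=
            mul_le_mul hr.rem_le h3 h1 (hr.rem_nonneg.trans hr.rem_le)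
        _ = 3 * ((solveRate e σ y c)⁻¹ * (y ⬝ᵥ σ c)) := by ring
        _ ≤ 3 * (e / (12 * (n + d))) := by linarith
        _ ≤ 3 * r.acc * (e / (12 * (n + d))) :=
            mul_le_mul_of_nonneg_right (by linarith) (by positivity)
  · have h3 := hN.add_le _ _ hx' (smul_nonneg hr.rem_nonneg hσ)
    rw [dotProduct_smul, smul_eq_mul] at h3
    have h4 : ‖r.rem • σ c‖ ≤ 1 := by
      rw [norm_smul, Real.norm_of_nonneg hr.rem_nonneg]
      have := mul_le_mul_of_nonneg_right hr.rem_le (norm_nonneg (σ c))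
      linarith [hW.inv_rate_mul_norm_le hO hypos c]
    have h5 : Real.exp ‖r.rem • σ c‖ ≤ 3 := by
      linarith [Real.exp_le_exp.2 h4, Real.exp_one_lt_d9]
    have := mul_le_mul_of_nonneg_right h5 h2
    linarith

/-- In units of `e / (12 * (n + d))` per `acc`, price drift costs at most `2 * 1.06` and filling at
most `3 * 3`, together less than 12. -/
theorem WarmStart.cost_next_le (hW : WarmStart N X e σ) (hN : SmoothNorm N Ψ g)
    (hO : LinOracle X O) (h : SolveInv N Ψ X O e k s) (hy : y = g (∑ c, s.load c))
    (hr : RingSpec Ψ g X O c e (∑ c, s.load c) (solveRate e σ y c)⁻¹ r i j) :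
    r.cost + 3 * (r.rem * (g r.load ⬝ᵥ σ c)) ≤
      Real.exp e * ((solveRate e σ y c)⁻¹ * (y ⬝ᵥ O c y)) + e / (n + d) * r.acc := by
  obtain ⟨hn, hd⟩ := hW.cast_pos
  have he := hW.pos
  have hx := h.sum_nonneg hO
  have hypos : ∀ i, 0 < y i := by rw [hy]; exact hN.grad_pos _ hx
  have hv := hO.dotProduct_nonneg c hypos
  have hacc := hr.acc_nonneg
  have h1 := hr.cost_le
  rw [← hy] at h1
  have h2 : ((solveRate e σ y c)⁻¹ - r.rem) * (y ⬝ᵥ O c y) * (1 + 2 * r.acc) ≤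
      (solveRate e σ y c)⁻¹ * (y ⬝ᵥ O c y) * (1 + 2 * r.acc) := by
    gcongr
    linarith [hr.rem_nonneg]
  have h3 := mul_le_mul_of_nonneg_left h2 (Real.exp_pos e).le
  have h4 : (solveRate e σ y c)⁻¹ * (y ⬝ᵥ O c y) ≤ e / (12 * (n + d)) :=
    (mul_le_mul_of_nonneg_left (hO.le c y hypos _ (hW.mem c))
      (inv_nonneg.2 (hW.rate_pos hO hypos c).le)).trans (hW.inv_rate_mul_price_le hO hypos c)
  have h5 : Real.exp e ≤ 1.06 := (exp_le_of_le_twentieth he.le hW.le).trans (by linarith [hW.le])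
  have h6 : Real.exp e * ((solveRate e σ y c)⁻¹ * (y ⬝ᵥ O c y)) ≤
      1.06 * (e / (12 * (n + d))) :=
    mul_le_mul h5 h4 (mul_nonneg (inv_nonneg.2 (hW.rate_pos hO hypos c).le) hv) (by norm_num)
  have h7 := mul_le_mul_of_nonneg_right h6 hacc
  have h8 := (hW.fill_le hN hO h hy hr).2.1
  have h9 : e / (n + d) * r.acc = 12 * (r.acc * (e / (12 * (n + d)))) := by field_simp
  have h10 : 0 ≤ r.acc * (e / (12 * (n + d))) := by positivity
  rw [h9]
  linarith

theorem SolveInv.init (hN : SmoothNorm N Ψ g) (hne : ∀ c, (X c).Nonempty) :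
    SolveInv N Ψ X O e 0 (solveInit n d) where
  load_mem c := by
    obtain ⟨v, hv⟩ := hne c
    exact ⟨v, hv, by simp [solveInit]⟩
  time_nonneg c := le_rfl
  psi_le := by
    have := hN.zero_le
    simp only [solveInit, Pi.zero_apply, Finset.sum_const_zero]
    linarith
  cost_pos := by
    have := Real.log_natCast_nonneg d
    simp only [solveInit]
    linarith
  cost_le := by simp [solveInit]
  price_nonneg := le_rfl
  -- At zero prices the oracle may answer with a point outside the set, but both products vanish.
  price_min := by simp [solveInit]
  price_le := by simp [solveInit]
  le_clock := by simp [solveInit]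

/-- The minimum value is superadditive in the prices. Thus one final evaluation at the accumulated
prices dominates the weighted sum of the values of all rounds. -/
theorem SolveInv.value_price_add (hO : LinOracle X O) (h : SolveInv N Ψ X O e k s)
    (hy : ∀ i, 0 < y i) {t : ℝ} (ht : 0 < t) (c : Fin n) :
    s.price ⬝ᵥ O c s.price + t * (y ⬝ᵥ O c y) ≤
      (s.price + t • y) ⬝ᵥ O c (s.price + t • y) := by
  have hpos : ∀ i, 0 < (s.price + t • y) i := fun i =>
    add_pos_of_nonneg_of_pos (h.price_nonneg i) (mul_pos ht (hy i))
  have hmem := hO.mem c _ hpos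
  rw [add_dotProduct, smul_dotProduct, smul_eq_mul]
  exact add_le_add (h.price_min c _ hmem) (mul_le_mul_of_nonneg_left (hO.le c y hy _ hmem) ht.le)

theorem SolveInv.next (hW : WarmStart N X e σ) (hN : SmoothNorm N Ψ g) (hO : LinOracle X O)
    (h : SolveInv N Ψ X O e k s) (hy : y = g (∑ c, s.load c))
    (hr : RingSpec Ψ g X O c e (∑ c, s.load c) (solveRate e σ y c)⁻¹ r i j) :
    SolveInv N Ψ X O e (k + 1) (s.next e σ y c r (g r.load)) := by
  obtain ⟨hn, hd⟩ := hW.cast_pos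
  have he := hW.pos
  have hx := h.sum_nonneg hO
  have hypos : ∀ i, 0 < y i := by rw [hy]; exact hN.grad_pos _ hx
  have hlen : 0 < (solveRate e σ y c)⁻¹ := inv_pos.2 (hW.rate_pos hO hypos c)
  obtain ⟨hS1, hS2⟩ := hW.sum_rate hN hO hx
  rw [← hy] at hS1 hS2
  have hS : 0 < (∑ c, solveRate e σ y c)⁻¹ :=
    inv_pos.2 (lt_of_lt_of_le (by positivity) hS1)
  obtain ⟨hf1, hf2, hf3⟩ := hW.fill_le hN hO h hy hr
  refine ⟨fun c' => ?_, fun c' => ?_, ?_, ?_, ?_, ?_, fun c' x hx' => ?_, fun x hx' => ?_, ?_⟩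
  · rcases eq_or_ne c' c with rfl | hc
    · simp only [SolveState.next, Function.update_self]
      refine hO.add_mem_smul (h.time_nonneg _) hlen.le (h.load_mem _) ?_
      have := hO.add_mem_smul (sub_nonneg.2 hr.rem_le) hr.rem_nonneg hr.mem
        (Set.smul_mem_smul_set (hW.mem _))
      rwa [sub_add_cancel] at this
    · simp only [SolveState.next, Function.update_of_ne hc]
      exact h.load_mem c'
  · rcases eq_or_ne c' c with rfl | hc
    · simp only [SolveState.next, Function.update_self]
      exact add_nonneg (h.time_nonneg _) hlen.le
    · simp only [SolveState.next, Function.update_of_ne hc]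
      exact h.time_nonneg c'
  · rw [SolveState.sum_next_load]
    simp only [SolveState.next]
    linarith [hr.psi_le, h.psi_le]
  · have := h.cost_pos
    have := hr.cost_nonneg
    simp only [SolveState.next]
    linarith
  -- Holds for every draw, since `1.06 / 12 + 1.05 < 1.2`; the sure bound on the calls rests on it.
  · simp only [SolveState.next]
    have h1 := hW.cost_next_le hN hO h hy hr
    have h2 := h.cost_le
    have h4 : (solveRate e σ y c)⁻¹ * (y ⬝ᵥ O c y) ≤ e / (12 * (n + d)) :=
      (mul_le_mul_of_nonneg_left (hO.le c y hypos _ (hW.mem c)) hlen.le).trans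
        (hW.inv_rate_mul_price_le hO hypos c)
    have h5 : Real.exp e ≤ 1.06 := (exp_le_of_le_twentieth he.le hW.le).trans (by linarith [hW.le])
    have h6 : Real.exp e * ((solveRate e σ y c)⁻¹ * (y ⬝ᵥ O c y)) ≤
        1.06 * (e / (12 * (n + d))) :=
      mul_le_mul h5 h4 (mul_nonneg hlen.le (hO.dotProduct_nonneg c hypos)) (by norm_num)
    have h7 : e / (12 * (n + d)) = e / (n + d) / 12 := by field_simp
    have h8 : e / (n + d) * r.acc ≤ e / (n + d) * 1.05 := by
      gcongr
      linarith [hr.acc_le, hW.le]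
    have h9 : 0 < e / (n + d) := by positivity
    rw [h7] at h6
    push_cast
    linarith
  · exact add_nonneg h.price_nonneg (smul_nonneg hS.le fun i => (hypos i).le)
  · refine hO.le c' _ (fun i => ?_) x hx'
    exact add_pos_of_nonneg_of_pos (h.price_nonneg i) (mul_pos hS (hypos i))
  · simp only [SolveState.next]
    rw [add_dotProduct, smul_dotProduct, smul_eq_mul, add_mul]
    refine add_le_add (h.price_le x hx') (mul_le_mul_of_nonneg_left ?_ hS.le)
    rw [hy]
    exact hN.grad_le _ _ hx hx'
  · simp only [SolveState.next]
    have h1 : e / (36 * (n + d)) ≤ (∑ c, solveRate e σ y c)⁻¹ := by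
      rw [← inv_div]
      exact inv_anti₀ (lt_of_lt_of_le (by positivity) hS1) hS2
    push_cast
    linarith [h.le_clock]

end Solve

section Solve

variable {n d : ℕ} {N Ψ : (Fin d → ℝ) → ℝ} {g : (Fin d → ℝ) → Fin d → ℝ}
  {X : Fin n → Set (Fin d → ℝ)} {O : Fin n → (Fin d → ℝ) → Fin d → ℝ} {e : ℝ}
  {σ : Fin n → Fin d → ℝ} {k : ℕ} {s : SolveState n d}

theorem WarmStart.nonempty (hW : WarmStart N X e σ) : Nonempty (Fin n) := ⟨⟨0, hW.one_le_n⟩⟩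

theorem WarmStart.one_le_ceil_mul (hW : WarmStart N X e σ) : 1 ≤ (⌈e⁻¹⌉₊ : ℝ) * e := by
  have h := mul_le_mul_of_nonneg_right (Nat.le_ceil e⁻¹) hW.pos.le
  rwa [inv_mul_cancel₀ hW.pos.ne'] at h

theorem ens_solveStep (hW : WarmStart N X e σ) (hN : SmoothNorm N Ψ g) (hO : LinOracle X O)
    (h : SolveInv N Ψ X O e k s) {Q : SolveState n d → ℕ → ℕ → Prop}
    (hQ : ∀ c r i j, RingSpec Ψ g X O c e (∑ c, s.load c)
      (solveRate e σ (g (∑ c, s.load c)) c)⁻¹ r i j →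
      Q (s.next e σ (g (∑ c, s.load c)) c r (g r.load)) (i + 1 + 1) j) :
    Prog.Ens g O (solveStep e σ s) Q := by
  have hx := h.sum_nonneg hO
  have hr := hW.rate_pos hO (hN.grad_pos _ hx)
  refine Prog.ens_draw hr hW.nonempty fun c => Prog.ens_bind.2 ?_
  refine (ens_ringLoop hN hO hx hW.pos (inv_pos.2 (hr c)).le hW.one_le_ceil_mul).mono
    fun r i j hr => ?_
  exact hQ c r i j hr

theorem ex_solveStep_le (hW : WarmStart N X e σ) (hN : SmoothNorm N Ψ g) (hO : LinOracle X O)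
    (h : SolveInv N Ψ X O e k s) {φ : SolveState n d → ℝ} {w : Fin n → ℝ} {t : ℝ}
    (hφ : ∀ c r i j, RingSpec Ψ g X O c e (∑ c, s.load c)
      (solveRate e σ (g (∑ c, s.load c)) c)⁻¹ r i j →
      φ (s.next e σ (g (∑ c, s.load c)) c r (g r.load)) ≤ φ s + w c - t)
    (hw : ∑ c, solveRate e σ (g (∑ c, s.load c)) c * Real.exp (w c) ≤
      (∑ c, solveRate e σ (g (∑ c, s.load c)) c) * (1 + t)) (b : ℝ) :
    Prog.ex g O (solveStep e σ s) (fun s' => ENNReal.ofReal (Real.exp (φ s' + b))) ≤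
      ENNReal.ofReal (Real.exp (φ s + b)) := by
  have hx := h.sum_nonneg hO
  have hr := hW.rate_pos hO (hN.grad_pos _ hx)
  refine Prog.ex_draw_le (w := w) (t := t) hr hW.nonempty (fun c => Prog.ens_bind.2 ?_) hw
  refine (ens_ringLoop hN hO hx hW.pos (inv_pos.2 (hr c)).le hW.one_le_ceil_mul).mono
    fun r i j hr => ?_
  have := hφ c r i j hr
  simp only [Prog.Ens]
  linarith

/-- The part of the bound on `Ψ` that exceeds the accumulated optimal values. -/
noncomputable def SolveState.excess (O : Fin n → (Fin d → ℝ) → Fin d → ℝ) (e : ℝ)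
    (s : SolveState n d) : ℝ :=
  6 * (n + d) * (s.cost - e / (n + d) * ∑ i, (∑ c, s.load c) i -
    (1 + e) * Real.exp e * ∑ c, s.price ⬝ᵥ O c s.price)

/-- The error `e / (n + d) * acc` is offset by the growth of the ℓ₁-load. In expectation the rest is
at most `exp e` times the growth of the accumulated optimal value. The scaling `6 * (n + d)` keeps
the exponent `w` at most `e`, where `exp w ≤ 1 + (1 + e) * w`. -/
theorem solve_excess_supermartingale (hW : WarmStart N X e σ) (hN : SmoothNorm N Ψ g)
    (hO : LinOracle X O) (h : SolveInv N Ψ X O e k s) (b : ℝ) :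
    Prog.ex g O (solveStep e σ s)
      (fun s' => ENNReal.ofReal (Real.exp (s'.excess O e + b))) ≤
      ENNReal.ofReal (Real.exp (s.excess O e + b)) := by
  obtain ⟨hn, hd⟩ := hW.cast_pos
  have he := hW.pos
  have he' := hW.le
  have hx := h.sum_nonneg hO
  set y := g (∑ c, s.load c) with hy
  have hypos : ∀ i, 0 < y i := hN.grad_pos _ hx
  have hr := hW.rate_pos hO hypos
  have hv : ∀ c, 0 ≤ y ⬝ᵥ O c y := fun c => hO.dotProduct_nonneg c hypos
  obtain ⟨hS1, -⟩ := hW.sum_rate hN hO hx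
  rw [← hy] at hS1
  have hS : 0 < ∑ c, solveRate e σ y c := lt_of_lt_of_le (by positivity) hS1
  refine ex_solveStep_le hW hN hO h (φ := SolveState.excess O e)
    (w := fun c => 6 * (n + d) * (Real.exp e * ((solveRate e σ y c)⁻¹ * (y ⬝ᵥ O c y))))
    (t := 6 * (n + d) * ((1 + e) * Real.exp e *
      ((∑ c, solveRate e σ y c)⁻¹ * ∑ c, y ⬝ᵥ O c y))) ?_ ?_ b
  · intro c r i j hrs
    have h1 := hW.cost_next_le hN hO h hy hrs
    have h2 : ∑ i, (∑ c, s.load c) i + r.acc ≤ ∑ i, (r.load + r.rem • σ c) i := by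
      have h3 := hrs.acc_le_sum
      have h4 : 0 ≤ ∑ i, (r.rem • σ c) i := Finset.sum_nonneg fun i _ =>
        mul_nonneg hrs.rem_nonneg (hO.nonneg c _ (hW.mem c) i)
      simp only [Pi.sub_apply, Finset.sum_sub_distrib] at h3
      simp only [Pi.add_apply (r.load) (r.rem • σ c), Finset.sum_add_distrib]
      linarith
    have h5 : ∑ c, s.price ⬝ᵥ O c s.price +
        (∑ c, solveRate e σ y c)⁻¹ * ∑ c, y ⬝ᵥ O c y ≤
        ∑ c, (s.price + (∑ c, solveRate e σ y c)⁻¹ • y) ⬝ᵥ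
          O c (s.price + (∑ c, solveRate e σ y c)⁻¹ • y) := by
      rw [Finset.mul_sum, ← Finset.sum_add_distrib]
      exact Finset.sum_le_sum fun c _ => h.value_price_add hO hypos (inv_pos.2 hS) c
    have h6 := mul_le_mul_of_nonneg_left h2 (show 0 ≤ e / (n + d) by positivity)
    have h7 := mul_le_mul_of_nonneg_left h5 (show 0 ≤ (1 + e) * Real.exp e by positivity)
    simp only [SolveState.excess]
    rw [SolveState.sum_next_load]
    simp only [SolveState.next]
    rw [← mul_add, ← mul_sub]
    refine mul_le_mul_of_nonneg_left ?_ (by positivity)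
    linarith
  · have h5 : Real.exp e ≤ 1.06 := (exp_le_of_le_twentieth he.le he').trans (by linarith)
    calc _ ≤ ∑ c, (solveRate e σ y c +
          6 * (n + d) * ((1 + e) * Real.exp e * (y ⬝ᵥ O c y))) := by
          refine Finset.sum_le_sum fun c _ => ?_
          set w := 6 * (n + d) * (Real.exp e * ((solveRate e σ y c)⁻¹ * (y ⬝ᵥ O c y))) with hw
          have h4 : (solveRate e σ y c)⁻¹ * (y ⬝ᵥ O c y) ≤ e / (12 * (n + d)) :=
            (mul_le_mul_of_nonneg_left (hO.le c y hypos _ (hW.mem c))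
              (inv_pos.2 (hr c)).le).trans (hW.inv_rate_mul_price_le hO hypos c)
          have h6 : Real.exp e * ((solveRate e σ y c)⁻¹ * (y ⬝ᵥ O c y)) ≤
              1.06 * (e / (12 * (n + d))) :=
            mul_le_mul h5 h4 (mul_nonneg (inv_pos.2 (hr c)).le (hv c)) (by norm_num)
          have hw0 : 0 ≤ w := by
            have := (hr c)
            have := hv c
            positivity
          have hw1 : w ≤ e := by
            refine (mul_le_mul_of_nonneg_left h6 (by positivity)).trans ?_
            have : 6 * ((n : ℝ) + d) * (1.06 * (e / (12 * (n + d)))) = 0.53 * e := by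
              field_simp
              norm_num
            linarith
          have h7 := Real.abs_exp_sub_one_sub_id_le (x := w) (by rw [abs_of_nonneg hw0]; linarith)
          have h8 := (abs_le.1 h7).2
          have h9 : Real.exp w ≤ 1 + (1 + e) * w := by nlinarith
          refine (mul_le_mul_of_nonneg_left h9 (hr c).le).trans (le_of_eq ?_)
          rw [hw]
          field_simp [(hr c).ne']
      _ = _ := by
          rw [Finset.sum_add_distrib, ← Finset.mul_sum, ← Finset.mul_sum]
          field_simp
          exact mul_comm _ _

/-- The mean service time per round equals the clock increment. Since 12 times a service interval is
at most `e`, second-order terms cost only a factor `1 - e`. -/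
theorem solve_time_supermartingale (hW : WarmStart N X e σ) (hN : SmoothNorm N Ψ g)
    (hO : LinOracle X O) (h : SolveInv N Ψ X O e k s) (c : Fin n) (b : ℝ) :
    Prog.ex g O (solveStep e σ s)
      (fun s' => ENNReal.ofReal (Real.exp (12 * (1 - e) * s'.clock - 12 * s'.time c + b))) ≤
      ENNReal.ofReal (Real.exp (12 * (1 - e) * s.clock - 12 * s.time c + b)) := by
  classical
  have he := hW.pos
  have he' := hW.le
  have hx := h.sum_nonneg hO
  set y := g (∑ c, s.load c) with hy
  have hypos : ∀ i, 0 < y i := hN.grad_pos _ hx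
  have hr := hW.rate_pos hO hypos
  have hS : 0 < ∑ c, solveRate e σ y c :=
    Finset.sum_pos (fun c _ => hr c) ⟨c, Finset.mem_univ c⟩
  refine ex_solveStep_le hW hN hO h (φ := fun s => 12 * (1 - e) * s.clock - 12 * s.time c)
    (w := Function.update 0 c (-(12 * (solveRate e σ y c)⁻¹)))
    (t := -(12 * (1 - e) * (∑ c, solveRate e σ y c)⁻¹)) ?_ ?_ b
  · intro c' r i j hrs
    rcases eq_or_ne c c' with rfl | hc
    · simp only [SolveState.next, Function.update_self]
      linarith
    · simp only [SolveState.next, Function.update_of_ne hc, Function.update_of_ne hc.symm,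
        Pi.zero_apply]
      linarith
  · have h1 := sum_update (fun c' v => solveRate e σ y c' * Real.exp v) 0 c
      (-(12 * (solveRate e σ y c)⁻¹))
    simp only [Pi.zero_apply, Real.exp_zero, mul_one] at h1
    rw [h1]
    set v := 12 * (solveRate e σ y c)⁻¹ with hv
    have hv0 : 0 < v := mul_pos (by norm_num) (inv_pos.2 (hr c))
    have hv1 : v ≤ e := by linarith [hW.inv_rate_le hO hypos c]
    have h7 := Real.abs_exp_sub_one_sub_id_le (x := -v)
      (by rw [abs_neg, abs_of_nonneg hv0.le]; linarith)
    have h8 := (abs_le.1 h7).2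
    have h9 : Real.exp (-v) ≤ 1 - (1 - e) * v := by nlinarith
    have h10 := mul_le_mul_of_nonneg_left h9 (hr c).le
    have h11 : solveRate e σ y c * v = 12 := by
      rw [hv]
      field_simp [(hr c).ne']
    have h12 := mul_inv_cancel₀ hS.ne'
    have h13 : (∑ c, solveRate e σ y c) * (1 + -(12 * (1 - e) * (∑ c, solveRate e σ y c)⁻¹)) =
        ∑ c, solveRate e σ y c - 12 * (1 - e) := by linear_combination (-(12 * (1 - e))) * h12
    have h14 : solveRate e σ y c * (1 - (1 - e) * v) = solveRate e σ y c - 12 * (1 - e) := by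
      linear_combination (-(1 - e)) * h11
    rw [h13]
    linarith

/-- Beyond one call per round, each call adds `e` to the ℓ₁-load. Two gradients per round are
evaluated outside `ringLoop`. -/
theorem ens_iter_solveStep (hW : WarmStart N X e σ) (hN : SmoothNorm N Ψ g) (hO : LinOracle X O)
    (F : ℕ) :
    Prog.Ens g O (Prog.iter (solveStep e σ) F (solveInit n d)) fun s i j =>
      SolveInv N Ψ X O e F s ∧ i = j + 2 * F ∧ e * j ≤ e * F + ∑ i, (∑ c, s.load c) i := by
  refine Prog.ens_iter (fun k s i j => SolveInv N Ψ X O e k s ∧ i = j + 2 * k ∧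
    e * j ≤ e * k + ∑ i, (∑ c, s.load c) i) ?_
    ⟨SolveInv.init hN fun c => ⟨_, hW.mem c⟩, rfl, by simp [solveInit]⟩ F
  rintro k s i j ⟨h, rfl, hj⟩
  refine ens_solveStep hW hN hO h fun c r i' j' hr =>
    ⟨h.next hW hN hO rfl hr, by rw [hr.grads]; ring, ?_⟩
  rw [SolveState.sum_next_load]
  have h3 := hr.acc_le_sum
  have h4 : 0 ≤ ∑ i, (r.rem • σ c) i := Finset.sum_nonneg fun i _ =>
    mul_nonneg hr.rem_nonneg (hO.nonneg c _ (hW.mem c) i)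
  simp only [Pi.sub_apply, Finset.sum_sub_distrib] at h3
  simp only [Pi.add_apply (r.load) (r.rem • σ c), Finset.sum_add_distrib]
  have := hr.calls
  push_cast
  linarith

open Classical in
/-- The main phase: improves a warm start to a nearly optimal solution. -/
noncomputable def solve (n d : ℕ) (e : ℝ) (σ : Fin n → Fin d → ℝ) (F : ℕ) :
    Prog n d (Option (Fin n → Fin d → ℝ)) :=
  (Prog.iter (solveStep e σ) F (solveInit n d)).bind fun s =>
    (Prog.queryAll s.price).bind fun f =>
      .ret (if 0 < s.clock ∧ ∀ c, 0 < s.time c ∧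
          s.cost * s.clock ≤ (1 + 20 * e) * (∑ c, s.price ⬝ᵥ f c) * s.time c then
        some fun c => (s.time c)⁻¹ • s.load c else none)

/-- No probability enters: by `price_le` the value at the accumulated prices, divided by the clock,
is a lower bound on the optimum, and the program compares with it before returning anything. -/
theorem ens_solve (hW : WarmStart N X e σ) (hN : SmoothNorm N Ψ g) (hO : LinOracle X O) (F : ℕ) :
    Prog.Ens g O (solve n d e σ F) fun o i j =>
      (∀ ξ ∈ o, (∀ c, ξ c ∈ X c) ∧ ∀ s : Fin n → Fin d → ℝ, (∀ c, s c ∈ X c) →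
        N (∑ c, ξ c) ≤ (1 + 20 * e) * N (∑ c, s c)) ∧ i ≤ j + 2 * F ∧
        e * j ≤ e * F + d * (Real.log d + 1 + F * (1.2 * (e / (n + d)))) + e * n := by
  have he := hW.pos
  refine Prog.ens_bind.2 ((ens_iter_solveStep hW hN hO F).mono ?_)
  rintro s i j ⟨h, rfl, hj⟩
  refine Prog.ens_bind.2 ((Prog.ens_queryAll s.price).mono ?_)
  rintro f i' j' ⟨rfl, rfl, rfl⟩
  have hx := h.sum_nonneg hO
  refine ⟨?_, by omega, ?_⟩
  · intro ξ hξ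
    split_ifs at hξ with htest
    · rw [Option.mem_some_iff] at hξ
      subst hξ
      refine ⟨fun c => inv_smul_mem_of_mem_smul (htest.2 c).1 (h.load_mem c), fun s' hs' => ?_⟩
      obtain ⟨hτ, htest⟩ := htest
      set H := ∑ c, s.price ⬝ᵥ O c s.price with hH
      have hle : H ≤ s.clock * N (∑ c, s' c) := by
        refine le_trans ?_ (h.price_le _ (Finset.sum_nonneg fun c _ => hO.nonneg c _ (hs' c)))
        rw [dotProduct_sum]
        exact Finset.sum_le_sum fun c _ => h.price_min c _ (hs' c)
      have hU := h.cost_pos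
      -- A negative value could not have passed the test, as `s.cost * s.clock` is positive.
      have hH0 : 0 ≤ H := by
        obtain ⟨c⟩ := hW.nonempty
        by_contra hneg
        rw [not_le] at hneg
        have h1 := (htest c).2
        have h2 : (1 + 20 * e) * H * s.time c ≤ 0 :=
          mul_nonpos_of_nonpos_of_nonneg (mul_nonpos_of_nonneg_of_nonpos (by linarith) hneg.le)
            (htest c).1.le
        have := mul_pos hU hτ
        linarith
      have h1 : N (∑ c, (s.time c)⁻¹ • s.load c) ≤
          (1 + 20 * e) * H / (s.cost * s.clock) * N (∑ c, s.load c) := by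
        refine hN.norm_sum_inv_smul_le (by positivity) (h.load_nonneg hO)
          (fun c => (htest c).1) fun c => ?_
        rw [inv_eq_one_div, div_le_div_iff₀ (htest c).1 (mul_pos hU hτ), one_mul]
        exact (htest c).2
      have h2 := (hN.lower _ hx).trans h.psi_le
      calc N (∑ c, (s.time c)⁻¹ • s.load c)
          ≤ (1 + 20 * e) * H / (s.cost * s.clock) * s.cost :=
            h1.trans (mul_le_mul_of_nonneg_left h2 (by positivity))
        _ = (1 + 20 * e) * (H / s.clock) := by field_simp
        _ ≤ (1 + 20 * e) * N (∑ c, s' c) := by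
            gcongr
            rw [div_le_iff₀ hτ]
            linarith
    · simp at hξ
  · have h1 := hN.sum_le _ hx
    have h2 := mul_le_mul_of_nonneg_left (((hN.lower _ hx).trans h.psi_le).trans h.cost_le)
      (Nat.cast_nonneg (α := ℝ) d)
    push_cast
    linarith

/-- By `hlow` and `hτ`, the additive error `U₀ + 5 * L ≤ 7.5 * L` is at most `e * U`, and the
ℓ₁-term costs another `e * U`, so `(1 - 2 * e) * U ≤ B * H`. With `hA` the total loss is `B / (1 - 2
* e) ^ 2 ≤ 1 + 20 * e`. -/
theorem solve_test_of_tails {e M dd L U U₀ H τ A sx B : ℝ} (he : 0 < e) (he' : e ≤ 1 / 20)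
    (hM : 2 ≤ M) (hdM : dd ≤ M) (hL : 0.69 ≤ L) (hU₀ : U₀ ≤ L + 1) (hU : 0 < U)
    (hsx : sx ≤ dd * U) (hB0 : 0 < B) (hB : B ≤ 1 + 2.3 * e) (hτ : 2500 * L ≤ e * τ)
    (hlow : (1 - 2 * e) * τ ≤ 240 * U)
    (h1 : 6 * M * (U - e / M * sx - B * H) + (-(6 * M * U₀) - 60 * L) < 0)
    (hA : (1 - 2 * e) * τ ≤ A) : U * τ ≤ (1 + 20 * e) * H * A := by
  have hM0 : 0 < M := by linarith
  have h3 : e / M * sx ≤ e * U := by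
    rw [div_mul_eq_mul_div, div_le_iff₀ hM0]
    have h4 : dd * U ≤ M * U := mul_le_mul_of_nonneg_right hdM hU.le
    nlinarith
  have h5 : U - e / M * sx - B * H ≤ U₀ + 5 * L := by
    by_contra hlt
    rw [not_le] at hlt
    have h6 : 6 * M * (U₀ + 5 * L) < 6 * M * (U - e / M * sx - B * H) :=
      mul_lt_mul_of_pos_left hlt (by linarith)
    nlinarith
  have hτ0 : 0 < τ := by
    by_contra hlt
    nlinarith
  have h6 : 7.5 * L ≤ e * U := by
    have h7 : e * ((1 - 2 * e) * τ) ≤ e * (240 * U) := mul_le_mul_of_nonneg_left hlow he.le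
    have h8 : (0.9 : ℝ) * (e * τ) ≤ (1 - 2 * e) * (e * τ) :=
      mul_le_mul_of_nonneg_right (by linarith) (by positivity)
    nlinarith
  have h7 : (1 - 2 * e) * U ≤ B * H := by linarith
  have h8 : 0 < 1 - 2 * e := by linarith
  have hH : 0 < H := by
    by_contra hlt
    have : B * H ≤ 0 := mul_nonpos_of_nonneg_of_nonpos hB0.le (not_lt.1 hlt)
    have := mul_pos h8 hU
    linarith
  have hA0 : 0 < A := lt_of_lt_of_le (mul_pos h8 hτ0) hA
  have h9 : (1 - 2 * e) * U * ((1 - 2 * e) * τ) ≤ B * H * A :=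
    mul_le_mul h7 hA (by positivity) (by positivity)
  have h10 : B ≤ (1 + 20 * e) * (1 - 2 * e) ^ 2 := by
    have h13 : 0 ≤ e * (13.7 - 76 * e) := mul_nonneg he.le (by linarith)
    have h14 : 0 ≤ e ^ 3 := by positivity
    linarith
  have h11 : B * (H * A) ≤ (1 + 20 * e) * (1 - 2 * e) ^ 2 * (H * A) :=
    mul_le_mul_of_nonneg_right h10 (by positivity)
  have h12 : (1 - 2 * e) ^ 2 * (U * τ) ≤ (1 - 2 * e) ^ 2 * ((1 + 20 * e) * H * A) := by
    linarith
  exact le_of_mul_le_mul_left h12 (by positivity)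

/-- By `hT` the optimum is at least `1 / 240`, so the bound on Ψ becomes large with the clock and
absorbs the additive errors. -/
theorem ex_solve_le (hW : WarmStart N X e σ) (hN : SmoothNorm N Ψ g) (hO : LinOracle X O)
    (hT : ∀ s : Fin n → Fin d → ℝ, (∀ c, s c ∈ X c) → 1 ≤ 240 * N (∑ c, s c)) {F : ℕ}
    (hF : 90000 * (n + d) * Real.log (n + d) / e ^ 2 ≤ F) :
    Prog.ex g O (solve n d e σ F) (fun o => if o.isNone then 1 else 0) ≤
      (n + 1) * ENNReal.ofReal (Real.exp (-(60 * Real.log (n + d)))) := by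
  obtain ⟨hn, hd⟩ := hW.cast_pos
  have he := hW.pos
  have he' := hW.le
  set L := Real.log (n + d) with hL
  obtain ⟨hL1, hL2⟩ := log_add_bounds hW.one_le_n hW.one_le_d
  set s₀ := solveInit n d with hs₀
  set φ₂ : Fin n → SolveState n d → ℝ := fun c s => 12 * (1 - e) * s.clock - 12 * s.time c
  set f : (SolveState n d → ℝ) → SolveState n d → ℝ≥0∞ := fun φ s =>
    ENNReal.ofReal (Real.exp (φ s + (-φ s₀ - 60 * L))) with hf
  have hinit : ∃ k, SolveInv N Ψ X O e k s₀ := ⟨0, SolveInv.init hN fun c => ⟨_, hW.mem c⟩⟩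
  have hInv : ∀ s, (∃ k, SolveInv N Ψ X O e k s) → Prog.Ens g O (solveStep e σ s)
      fun s' _ _ => ∃ k, SolveInv N Ψ X O e k s' := by
    rintro s ⟨k, h⟩
    exact ens_solveStep hW hN hO h fun c r i j hr => ⟨k + 1, h.next hW hN hO rfl hr⟩
  have e₁ : Prog.ex g O (Prog.iter (solveStep e σ) F s₀) (f (SolveState.excess O e)) ≤
      ENNReal.ofReal (Real.exp (-(60 * L))) :=
    Prog.ex_iter_exp_le (φ := SolveState.excess O e) hInv
      (fun s ⟨k, h⟩ b => solve_excess_supermartingale hW hN hO h b) hinit F (60 * L)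
  have e₂ : ∀ c, Prog.ex g O (Prog.iter (solveStep e σ) F s₀) (f (φ₂ c)) ≤
      ENNReal.ofReal (Real.exp (-(60 * L))) := fun c =>
    Prog.ex_iter_exp_le (φ := φ₂ c) hInv
      (fun s ⟨k, h⟩ b => solve_time_supermartingale hW hN hO h c b) hinit F (60 * L)
  rw [solve, Prog.ex_bind]
  simp only [Prog.ex_queryAll_bind]
  calc _ ≤ Prog.ex g O (Prog.iter (solveStep e σ) F s₀)
        (fun s => (∑ c, f (φ₂ c) s) + f (SolveState.excess O e) s) := by
        refine Prog.ex_le_ex ((ens_iter_solveStep hW hN hO F).mono ?_)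
        rintro s i j ⟨h, -, -⟩
        simp only [Prog.ex]
        split_ifs with htest hnone
        · simp at hnone
        · exact zero_le
        · by_contra hlt
          rw [not_le] at hlt
          refine htest ?_
          have hneg : ∀ φ, f φ s < 1 → φ s + (-φ s₀ - 60 * L) < 0 := fun φ hφ =>
            not_le.1 fun hz => hφ.not_ge (one_le_ofReal_exp hz)
          have h1 := hneg _ ((le_add_left le_rfl).trans_lt hlt)
          have h2 := fun c => hneg (φ₂ c) (((Finset.single_le_sum (f := fun c => f (φ₂ c) s)
            (fun _ _ => zero_le) (Finset.mem_univ c)).trans (le_add_right le_rfl)).trans_lt hlt)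
          have hx := h.sum_nonneg hO
          -- Here 90000 is `36 * 2500`, with 36 from the upper bound on the total rate.
          have hτ : 2500 * L ≤ e * s.clock := by
            have h3 := mul_le_mul_of_nonneg_right hF
              (show 0 ≤ e / (36 * ((n : ℝ) + d)) by positivity)
            have h4 : 90000 * ((n : ℝ) + d) * L / e ^ 2 * (e / (36 * (n + d))) = 2500 * L / e := by
              field_simp
              ring
            rw [h4] at h3
            have h5 := h3.trans h.le_clock
            rwa [div_le_iff₀' he] at h5
          have hτ0 : 0 < s.clock := by
            by_contra hlt'
            nlinarith
          have hA : ∀ c, (1 - 2 * e) * s.clock ≤ s.time c := by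
            intro c
            have := h2 c
            simp only [φ₂, hs₀, solveInit, Pi.zero_apply] at this
            nlinarith
          have hA0 : ∀ c, 0 < s.time c := fun c =>
            lt_of_lt_of_le (mul_pos (by linarith) hτ0) (hA c)
          -- The loads divided by the times are feasible, so `hT` applies to them.
          have hlow : (1 - 2 * e) * s.clock ≤ 240 * s.cost := by
            have h3 := hT (fun c => (s.time c)⁻¹ • s.load c)
              fun c => inv_smul_mem_of_mem_smul (hA0 c) (h.load_mem c)
            have h4 : 0 < (1 - 2 * e) * s.clock := mul_pos (by linarith) hτ0
            have h5 := hN.norm_sum_inv_smul_le (t := ((1 - 2 * e) * s.clock)⁻¹)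
              (inv_nonneg.2 h4.le) (h.load_nonneg hO) hA0 fun c => inv_anti₀ h4 (hA c)
            have h6 := (hN.lower _ hx).trans h.psi_le
            have h7 : 1 ≤ ((1 - 2 * e) * s.clock)⁻¹ * (240 * s.cost) := by
              have := mul_le_mul_of_nonneg_left h6 (inv_nonneg.2 h4.le)
              linarith
            rwa [← div_eq_inv_mul, one_le_div h4] at h7
          refine ⟨hτ0, fun c => ⟨hA0 c, ?_⟩⟩
          have hexp := exp_le_of_le_twentieth he.le he'
          refine solve_test_of_tails (M := n + d) (dd := d) (L := L) (U₀ := Real.log d + 1)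
            (sx := ∑ i, (∑ c, s.load c) i) (B := (1 + e) * Real.exp e) he he' (by linarith)
            (by linarith) hL1 (by linarith) h.cost_pos ?_ (by positivity) (by nlinarith) hτ hlow
            ?_ (hA c)
          · refine (hN.sum_le _ hx).trans (mul_le_mul_of_nonneg_left ?_ (Nat.cast_nonneg d))
            exact (hN.lower _ hx).trans h.psi_le
          · have h3 : SolveState.excess O e s₀ = 6 * (n + d) * (Real.log d + 1) := by
              simp [SolveState.excess, hs₀, solveInit]
            rw [h3] at h1
            exact h1
        · rename_i hnone
          simp at hnone
    _ ≤ (∑ _c : Fin n, ENNReal.ofReal (Real.exp (-(60 * L)))) +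
        ENNReal.ofReal (Real.exp (-(60 * L))) := by
        rw [Prog.ex_add, Prog.ex_sum]
        exact add_le_add (Finset.sum_le_sum fun c _ => e₂ c) e₁
    _ = _ := by
        rw [Finset.sum_const, Finset.card_univ, Fintype.card_fin, nsmul_eq_mul]
        ring

end Solve

/-! ### Assembly, call counts and the deterministic fallback. -/

section Main

variable {n d : ℕ} {N Ψ : (Fin d → ℝ) → ℝ} {g : (Fin d → ℝ) → Fin d → ℝ}
  {X : Fin n → Set (Fin d → ℝ)} {O : Fin n → (Fin d → ℝ) → Fin d → ℝ}

theorem sum_mem_feasibleSet {s : Fin n → Fin d → ℝ} (hs : ∀ c, s c ∈ X c) :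
    ∑ c, s c ∈ feasibleSet X := ⟨s, hs, rfl⟩

theorem WarmStart.rescale (hN : SmoothNorm N Ψ g) {σ : Fin n → Fin d → ℝ} {e lam : ℝ}
    (hlam : 0 < lam) (hn : 1 ≤ n) (hd : 1 ≤ d) (he : 0 < e) (he' : e ≤ 1 / 20)
    (hσ : ∀ c, σ c ∈ X c) (hσN : N (∑ c, σ c) ≤ lam) :
    WarmStart N (fun c => lam⁻¹ • X c) e fun c => lam⁻¹ • σ c where
  mem c := Set.smul_mem_smul_set (hσ c)
  norm_le := by
    rw [← Finset.smul_sum]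
    exact (hN.smul_le _ _ (inv_pos.2 hlam).le).trans (inv_mul_le_one_of_le₀ hσN hlam.le)
  pos := he
  le := he'
  one_le_n := hn
  one_le_d := hd

/-- Improves a solution of value at most `lam` to a nearly optimal solution. -/
noncomputable def improve (n d : ℕ) (e : ℝ) (F : ℕ) (lam : ℝ) (σ : Fin n → Fin d → ℝ) :
    Prog n d (Option (Fin d → ℝ)) :=
  ((solve n d e (fun c => lam⁻¹ • σ c) F).rescale lam⁻¹).bind fun o =>
    .ret (o.map fun ξ => lam • ∑ c, ξ c)

theorem ens_improve (hN : SmoothNorm N Ψ g) (hO : LinOracle X O) {σ : Fin n → Fin d → ℝ}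
    {e lam : ℝ} (hlam : 0 < lam) (hn : 1 ≤ n) (hd : 1 ≤ d) (he : 0 < e) (he' : e ≤ 1 / 20)
    (hσ : ∀ c, σ c ∈ X c) (hσN : N (∑ c, σ c) ≤ lam) (F : ℕ) :
    Prog.Ens g O (improve n d e F lam σ) fun o i j =>
      (∀ x ∈ o, x ∈ feasibleSet X ∧ ∀ z ∈ feasibleSet X, N x ≤ (1 + 20 * e) * N z) ∧
        i ≤ j + 2 * F ∧
        e * j ≤ e * F + d * (Real.log d + 1 + F * (1.2 * (e / (n + d)))) + e * n := by
  have hinv := inv_pos.2 hlam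
  refine Prog.ens_bind.2 (Prog.ens_rescale.2 ((ens_solve
    (WarmStart.rescale hN hlam hn hd he he' hσ hσN) hN (hO.rescale hinv.le) F).mono ?_))
  rintro o i j ⟨h, hi, hj⟩
  refine ⟨?_, by simpa using hi, by simpa using hj⟩
  intro x hx
  obtain ⟨ξ, hξ, rfl⟩ := Option.mem_map.1 hx
  obtain ⟨h1, h2⟩ := h ξ hξ
  refine ⟨⟨fun c => lam • ξ c, fun c => ?_, Finset.smul_sum⟩, ?_⟩
  · have := Set.smul_mem_smul_set (a := lam) (h1 c)
    rwa [smul_smul, mul_inv_cancel₀ hlam.ne', one_smul] at this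
  · rintro z ⟨s, hs, rfl⟩
    have h3 := h2 (fun c => lam⁻¹ • s c) fun c => Set.smul_mem_smul_set (hs c)
    rw [← Finset.smul_sum] at h3
    have h4 := hN.smul_le lam⁻¹ (∑ c, s c) hinv.le
    calc N (lam • ∑ c, ξ c) ≤ lam * N (∑ c, ξ c) := hN.smul_le _ _ hlam.le
      _ ≤ lam * ((1 + 20 * e) * (lam⁻¹ * N (∑ c, s c))) := by gcongr; exact h3.trans (by gcongr)
      _ = (1 + 20 * e) * N (∑ c, s c) := by field_simp

theorem ex_improve_le (hN : SmoothNorm N Ψ g) (hO : LinOracle X O) {σ : Fin n → Fin d → ℝ}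
    {e lam : ℝ} (hlam : 0 < lam) (hn : 1 ≤ n) (hd : 1 ≤ d) (he : 0 < e) (he' : e ≤ 1 / 20)
    (hσ : ∀ c, σ c ∈ X c) (hσN : N (∑ c, σ c) ≤ lam)
    (hT : ∀ z ∈ feasibleSet X, lam ≤ 240 * N z) {F : ℕ}
    (hF : 90000 * (n + d) * Real.log (n + d) / e ^ 2 ≤ F) :
    Prog.ex g O (improve n d e F lam σ) (fun o => if o.isNone then 1 else 0) ≤
      (n + 1) * ENNReal.ofReal (Real.exp (-(60 * Real.log (n + d)))) := by
  rw [improve, Prog.ex_bind, Prog.ex_rescale]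
  simp only [Prog.ex, Option.isNone_map]
  refine ex_solve_le (WarmStart.rescale hN hlam hn hd he he' hσ hσN) hN
    (hO.rescale (inv_pos.2 hlam).le) (fun s hs => ?_) hF
  have h1 : ∀ c, lam • s c ∈ X c := fun c => by
    have := Set.smul_mem_smul_set (a := lam) (hs c)
    rwa [smul_smul, mul_inv_cancel₀ hlam.ne', one_smul] at this
  have h2 := hT _ (sum_mem_feasibleSet h1)
  rw [← Finset.smul_sum] at h2
  have h3 := hN.smul_le lam (∑ c, s c) hlam.le
  have h4 : lam * 1 ≤ lam * (240 * N (∑ c, s c)) := by linarith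
  exact le_of_mul_le_mul_left h4 hlam

open Classical in
/-- The randomized algorithm. It fails with small probability, and otherwise returns a nearly
optimal solution. -/
noncomputable def mainProg (n d : ℕ) (ε : ℝ) : Prog n d (Option (Fin d → ℝ)) :=
  (Prog.queryAll 1).bind fun σ =>
    if ∑ i, (∑ c, σ c) i = 0 then .ret (some (∑ c, σ c)) else
      (search ⌈30000 * (n + d) * Real.log (n + d)⌉₊ (∑ i, (∑ c, σ c) i)
        (Nat.clog 2 (Nat.clog 2 d)) (0, σ)).bind fun q =>
          improve n d (ε / 20) ⌈90000 * (n + d) * Real.log (n + d) / (ε / 20) ^ 2⌉₊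
            (120 * ((∑ i, (∑ c, σ c) i) / 2 ^ q.1)) q.2

/-- For `d = 2` the double logarithm is negative but above `-1/2`, which `ε⁻² ≥ 1` absorbs. For `d =
1` it is `0` as `Real.log 0 = 0`. -/
theorem half_inv_sq_le {d : ℕ} {ε : ℝ} (hd : 1 ≤ d) (hε : 0 < ε) (hε1 : ε ≤ 1) :
    (ε ^ 2)⁻¹ ≤ 2 * ((ε ^ 2)⁻¹ + Real.log (Real.log d)) ∧ 1 ≤ (ε ^ 2)⁻¹ := by
  have h1 : 1 ≤ (ε ^ 2)⁻¹ := (one_le_inv₀ (by positivity)).2 (pow_le_one₀ hε.le hε1)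
  refine ⟨?_, h1⟩
  have h2 : -(1 / 2) ≤ Real.log (Real.log d) := by
    rcases Nat.lt_or_ge 1 d with hd2 | hd2
    · have h3 : Real.log 2 ≤ Real.log d :=
        Real.log_le_log (by norm_num) (by exact_mod_cast hd2)
      have h4 := Real.log_two_gt_d9
      rw [Real.le_log_iff_exp_le (by linarith)]
      have h5 : Real.exp (-(1 / 2)) ^ 2 = Real.exp (-1) := by
        rw [← Real.exp_nat_mul]
        norm_num
      have h6 : Real.exp (-1) ≤ 0.369 := by
        rw [Real.exp_neg, inv_le_comm₀ (Real.exp_pos _) (by norm_num)]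
        exact le_trans (by norm_num) Real.exp_one_gt_d9.le
      have h7 : Real.exp (-(1 / 2)) ≤ 0.69 := by
        by_contra h8
        rw [not_le] at h8
        nlinarith
      linarith
    · have : d = 1 := le_antisymm hd2 hd
      subst this
      norm_num
  linarith

theorem clog_clog_le {d : ℕ} {ε : ℝ} (hd : 1 ≤ d) (hε : 0 < ε) (hε1 : ε ≤ 1) :
    (Nat.clog 2 (Nat.clog 2 d) : ℝ) ≤ 3 * ((ε ^ 2)⁻¹ + Real.log (Real.log d)) := by
  obtain ⟨h1, h2⟩ := half_inv_sq_le hd hε hε1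
  set m := Nat.clog 2 d with hm
  set k := Nat.clog 2 m with hk
  rcases Nat.eq_zero_or_pos k with h0 | hkpos
  · rw [h0, Nat.cast_zero]
    linarith
  have hm2 : 1 < m := by
    by_contra hlt
    have : k = 0 := Nat.clog_of_right_le_one (not_lt.1 hlt) 2
    omega
  have hk1 : 2 ^ (k - 1) < m := Nat.pow_pred_clog_lt_self (by norm_num) hm2
  have hd2 : 1 < d := by
    by_contra hlt
    have : m = 0 := Nat.clog_of_right_le_one (not_lt.1 hlt) 2
    omega
  have hm1 : 2 ^ (m - 1) < d := Nat.pow_pred_clog_lt_self (by norm_num) hd2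
  have h3 : ((m - 1 : ℕ) : ℝ) * Real.log 2 < Real.log d := by
    rw [← Real.log_pow]
    exact Real.log_lt_log (by positivity) (by exact_mod_cast hm1)
  have h4 := Real.log_two_gt_d9
  have h4' := Real.log_two_lt_d9
  have h5 : (m : ℝ) ≤ 3 * Real.log d := by
    rw [Nat.cast_sub hm2.le] at h3
    have : (2 : ℝ) ≤ m := by exact_mod_cast hm2
    push_cast at h3
    nlinarith
  have hlog : 0 < Real.log d := Real.log_pos (by exact_mod_cast hd2)
  have h6 : ((k - 1 : ℕ) : ℝ) * Real.log 2 ≤ Real.log 3 + Real.log (Real.log d) := by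
    rw [← Real.log_pow, ← Real.log_mul (by norm_num) hlog.ne']
    refine Real.log_le_log (by positivity) (le_trans ?_ h5)
    exact_mod_cast hk1.le
  rw [Nat.cast_sub hkpos, Nat.cast_one] at h6
  have h7 : Real.log 3 ≤ 1.1 := by
    rw [Real.log_le_iff_le_exp (by norm_num)]
    have := Real.add_one_le_exp (1.1 - 1)
    have h8 : Real.exp 1.1 = Real.exp 1 * Real.exp (1.1 - 1) := by rw [← Real.exp_add]; norm_num
    rw [h8]
    have := Real.exp_one_gt_d9
    have := Real.quadratic_le_exp_of_nonneg (x := 1.1 - 1) (by norm_num)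
    nlinarith
  have h9 : (1 : ℝ) ≤ k := by exact_mod_cast hkpos
  -- A positive `k` forces `d ≥ 3`, so `log log d ≥ 0` and its coefficient may be enlarged.
  have hd3 : 2 < d := lt_of_le_of_lt (Nat.le_self_pow (by omega) 2) hm1
  have hd3' : (3 : ℝ) ≤ d := by exact_mod_cast hd3
  have hlog1 : 1 ≤ Real.log d := by
    rw [Real.le_log_iff_exp_le (by linarith)]
    linarith [Real.exp_one_lt_d9]
  have h10 := Real.log_nonneg hlog1
  have h11 := mul_le_mul_of_nonneg_left h4.le (sub_nonneg.2 h9)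
  linarith

/-- The bound on the number of calls, arithmetically. -/
theorem call_count_le {n d k F₀ F₁ J : ℕ} {ε : ℝ} (hn : 1 ≤ n) (hd : 1 ≤ d) (hε : 0 < ε)
    (hε1 : ε ≤ 1) (hk : k = Nat.clog 2 (Nat.clog 2 d))
    (hF₀ : F₀ = ⌈30000 * ((n : ℝ) + d) * Real.log (n + d)⌉₊)
    (hF₁ : F₁ = ⌈90000 * ((n : ℝ) + d) * Real.log (n + d) / (ε / 20) ^ 2⌉₊)
    (hJ : ε / 20 * J ≤ ε / 20 * F₁ +
      d * (Real.log d + 1 + F₁ * (1.2 * (ε / 20 / (n + d)))) + ε / 20 * n) :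
    ((n + 4 * F₀ * k + J + 2 * F₁ : ℕ) : ℝ) ≤ callBound 400000000 n d ε := by
  obtain ⟨hL1, hL2⟩ := log_add_bounds hn hd
  obtain ⟨hD1, hE1⟩ := half_inv_sq_le hd hε hε1
  have hk' := clog_clog_le hd hε hε1
  rw [← hk] at hk'
  have hn' : (1 : ℝ) ≤ n := by exact_mod_cast hn
  have hd' : (1 : ℝ) ≤ d := by exact_mod_cast hd
  unfold callBound
  set L := Real.log ((n : ℝ) + d) with hL
  set D := (ε ^ 2)⁻¹ + Real.log (Real.log d) with hD
  set E := (ε ^ 2)⁻¹ with hE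
  set W := ((n : ℝ) + d) * L with hW
  have hW1 : 1.38 ≤ W := by rw [hW]; nlinarith
  have hWn : n ≤ 1.5 * W := by rw [hW]; nlinarith
  have hWd : d * (Real.log d + 1) ≤ 2.5 * W := by
    have h1 : Real.log d + 1 ≤ 2.5 * L := by linarith
    have h2 := mul_le_mul_of_nonneg_left h1 (show (0 : ℝ) ≤ d by linarith)
    rw [hW]
    nlinarith
  have hF₀' : (F₀ : ℝ) ≤ 30001 * W := by
    have := (Nat.ceil_lt_add_one (show 0 ≤ 30000 * ((n : ℝ) + d) * L by positivity)).le
    rw [← hF₀] at this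
    rw [mul_assoc, ← hW] at this
    linarith
  have hWE : W ≤ W * E := le_mul_of_one_le_right (by linarith) hE1
  have hF₁' : (F₁ : ℝ) ≤ 36000001 * (W * E) := by
    have := (Nat.ceil_lt_add_one
      (show 0 ≤ 90000 * ((n : ℝ) + d) * L / (ε / 20) ^ 2 by positivity)).le
    rw [← hF₁] at this
    have h1 : 90000 * ((n : ℝ) + d) * L / (ε / 20) ^ 2 = 36000000 * (W * E) := by
      rw [hW, hE]
      field_simp
      norm_num
    linarith
  have hε' : ε⁻¹ ≤ E := by
    rw [hE]
    refine inv_anti₀ (by positivity) ?_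
    nlinarith
  have hJ' : (J : ℝ) ≤ 2.2 * F₁ + 50 * (W * E) + n := by
    have h1 : (J : ℝ) ≤ F₁ + ε⁻¹ * 20 * (d * (Real.log d + 1)) +
        1.2 * F₁ * (d / (n + d)) + n := by
      have h2 := mul_le_mul_of_nonneg_left hJ (show 0 ≤ ε⁻¹ * 20 by positivity)
      have h3 : ε⁻¹ * 20 * (ε / 20 * J) = J := by field_simp
      rw [h3] at h2
      refine h2.trans (le_of_eq ?_)
      field_simp
      ring
    have h4 : (d : ℝ) / (n + d) ≤ 1 := (div_le_one (by linarith)).2 (by linarith)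
    have h5 : 1.2 * (F₁ : ℝ) * (d / (n + d)) ≤ 1.2 * F₁ := mul_le_of_le_one_right (by positivity) h4
    have h6 : ε⁻¹ * (d * (Real.log d + 1)) ≤ E * (2.5 * W) :=
      mul_le_mul hε' hWd (mul_nonneg (by linarith) (by linarith [Real.log_nonneg hd'])) (by linarith)
    linarith
  have hWD : W * E ≤ 2 * (W * D) := by nlinarith
  have hFk : (F₀ : ℝ) * k ≤ 30001 * W * (3 * D) :=
    mul_le_mul hF₀' hk' (Nat.cast_nonneg _) (by linarith)
  push_cast
  linarith

theorem ens_mainProg (hN : SmoothNorm N Ψ g) (hO : LinOracle X O) (hn : 1 ≤ n) (hd : 1 ≤ d)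
    {ε : ℝ} (hε : 0 < ε) (hε1 : ε ≤ 1) :
    Prog.Ens g O (mainProg n d ε) fun o i j =>
      (∀ x ∈ o, x ∈ feasibleSet X ∧ ∀ z ∈ feasibleSet X, N x ≤ (1 + ε) * N z) ∧
        (i : ℝ) ≤ callBound 400000000 n d ε ∧ (j : ℝ) ≤ callBound 400000000 n d ε := by
  have hne : Nonempty (Fin n) := ⟨⟨0, hn⟩⟩
  refine Prog.ens_bind.2 ((Prog.ens_queryAll 1).mono ?_)
  rintro f i j ⟨rfl, rfl, rfl⟩
  have hmem : ∀ c, O c 1 ∈ X c := fun c => hO.mem c 1 fun _ => one_pos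
  have hσ0 : 0 ≤ ∑ c, O c 1 := Finset.sum_nonneg fun c _ => hO.nonneg c _ (hmem c)
  have hG0 : 0 ≤ ∑ i, (∑ c, O c 1) i := Finset.sum_nonneg fun i _ => hσ0 i
  simp only
  split_ifs with hG
  · have hcount := call_count_le (J := 0) hn hd hε hε1 rfl rfl rfl (by
      have := Real.log_natCast_nonneg d
      simp only [Nat.cast_zero, mul_zero]
      positivity)
    refine ⟨?_, ?_, ?_⟩
    · intro x hx
      rw [Option.mem_some_iff] at hx
      subst hx
      refine ⟨sum_mem_feasibleSet hmem, fun z _ => ?_⟩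
      have h1 := hN.le_sum _ hσ0
      rw [hG] at h1
      exact h1.trans (mul_nonneg (by linarith) (hN.nonneg z))
    · refine le_trans ?_ hcount
      exact Nat.cast_le.2 (by omega)
    · refine le_trans ?_ hcount
      exact Nat.cast_le.2 (by omega)
  · have hGpos := hG0.lt_of_ne' hG
    refine Prog.ens_bind.2 ((ens_search hN hO hne _ hGpos _ (0, fun c => O c 1)
      ⟨hmem, ?_⟩).mono ?_)
    · have := hN.le_sum _ hσ0
      simp only [pow_zero, div_one]
      linarith
    · rintro q i j ⟨⟨hq, hqN⟩, rfl, hj⟩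
      refine (ens_improve hN hO (by positivity) hn hd (by positivity) (by linarith) hq hqN _).mono ?_
      rintro o i' j' ⟨h1, h2, h3⟩
      have hcount := call_count_le hn hd hε hε1 rfl rfl rfl h3
      refine ⟨fun x hx => ?_, ?_, ?_⟩
      · obtain ⟨hx1, hx2⟩ := h1 x hx
        refine ⟨hx1, fun z hz => ?_⟩
        have := hx2 z hz
        rwa [mul_div_cancel₀ _ (by norm_num : (20 : ℝ) ≠ 0)] at this
      · refine le_trans ?_ hcount
        exact Nat.cast_le.2 (by omega)
      · refine le_trans ?_ hcount
        exact Nat.cast_le.2 (by omega)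

theorem feasibleSet_nonneg (hO : LinOracle X O) {z : Fin d → ℝ} (hz : z ∈ feasibleSet X) :
    0 ≤ z := by
  obtain ⟨s, hs, rfl⟩ := hz
  exact Finset.sum_nonneg fun c _ => hO.nonneg c _ (hs c)

theorem ex_mainProg_le (hN : SmoothNorm N Ψ g) (hO : LinOracle X O) (hn : 1 ≤ n) (hd : 1 ≤ d)
    {ε : ℝ} (hε : 0 < ε) (hε1 : ε ≤ 1) :
    Prog.ex g O (mainProg n d ε) (fun o => if o.isNone then 1 else 0) ≤
      (Nat.clog 2 (Nat.clog 2 d) * (n + 2) + (n + 1)) *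
        ENNReal.ofReal (Real.exp (-(60 * Real.log (n + d)))) := by
  classical
  have hne : Nonempty (Fin n) := ⟨⟨0, hn⟩⟩
  have hmem : ∀ c, O c 1 ∈ X c := fun c => hO.mem c 1 fun _ => one_pos
  have hσ0 : 0 ≤ ∑ c, O c 1 := Finset.sum_nonneg fun c _ => hO.nonneg c _ (hmem c)
  have hG0 : 0 ≤ ∑ i, (∑ c, O c 1) i := Finset.sum_nonneg fun i _ => hσ0 i
  have hd' : (0 : ℝ) < d := by exact_mod_cast hd
  rw [mainProg, Prog.ex_queryAll_bind]
  split_ifs with hG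
  · simp [Prog.ex]
  have hGpos := hG0.lt_of_ne' hG
  set G := ∑ i, (∑ c, O c 1) i with hGdef
  set k := Nat.clog 2 (Nat.clog 2 d) with hk
  set δ := ENNReal.ofReal (Real.exp (-(60 * Real.log ((n : ℝ) + d)))) with hδ
  set T := sInf (N '' feasibleSet X) with hTdef
  have hTle : ∀ z ∈ feasibleSet X, T ≤ N z := fun z hz =>
    csInf_le ⟨0, by rintro _ ⟨z', -, rfl⟩; exact hN.nonneg z'⟩ ⟨z, hz, rfl⟩
  have hleT : ∀ t, (∀ z ∈ feasibleSet X, t ≤ N z) → t ≤ T := fun t ht =>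
    le_csInf ⟨_, _, sum_mem_feasibleSet hmem, rfl⟩ (by rintro _ ⟨z, hz, rfl⟩; exact ht z hz)
  have hH : ∀ x, 0 ≤ x → ∑ c, g x ⬝ᵥ O c (g x) ≤ T := fun x hx => hleT _ (by
    rintro z ⟨s, hs, rfl⟩
    exact hN.value_le hO hx hs)
  -- Unit prices minimize the ℓ₁-norm over the feasible set. It is at most `d * N`, and `d ≤ 2 ^ 2 ^
  -- k` by the choice of `k`.
  have hstart : G / 2 ^ (0 + 2 ^ k) ≤ T := hleT _ (by
    intro z hz
    have h1 : G ≤ ∑ i, z i := by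
      obtain ⟨s, hs, rfl⟩ := hz
      rw [hGdef, ← one_dotProduct (∑ c, O c 1), ← one_dotProduct (∑ c, s c), dotProduct_sum,
        dotProduct_sum]
      exact Finset.sum_le_sum fun c _ => hO.le c 1 (fun _ => one_pos) _ (hs c)
    have h2 := h1.trans (hN.sum_le z (feasibleSet_nonneg hO hz))
    have h3 : (d : ℝ) ≤ 2 ^ (2 ^ k) := by
      have h4 : d ≤ 2 ^ Nat.clog 2 d := Nat.le_pow_clog (by norm_num) d
      have h5 : Nat.clog 2 d ≤ 2 ^ k := Nat.le_pow_clog (by norm_num) _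
      exact_mod_cast h4.trans (Nat.pow_le_pow_right (by norm_num) h5)
    rw [zero_add, div_le_iff₀ (by positivity)]
    have := mul_le_mul_of_nonneg_right h3 (hN.nonneg z)
    linarith)
  have hsearch := ex_search_le hN hO hn hd hGpos hH (Nat.le_ceil _) k (0, fun c => O c 1) hstart
  rw [Prog.ex_bind]
  calc _ ≤ Prog.ex g O (search ⌈30000 * ((n : ℝ) + d) * Real.log (n + d)⌉₊ G k
        (0, fun c => O c 1)) (fun q => (if G / 2 ^ (q.1 + 1) ≤ T then 0 else 1) + (n + 1) * δ) := by
        refine Prog.ex_le_ex ((ens_search hN hO hne _ hGpos _ (0, fun c => O c 1)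
          ⟨hmem, ?_⟩).mono ?_)
        · have := hN.le_sum _ hσ0
          simp only [pow_zero, div_one]
          linarith
        · rintro q i j ⟨⟨hq, hqN⟩, -, -⟩
          split_ifs with hqT
          · rw [zero_add]
            refine ex_improve_le hN hO (by positivity) hn hd (by positivity) (by linarith) hq hqN
              (fun z hz => ?_) (Nat.le_ceil _)
            have h1 := hqT.trans (hTle z hz)
            rw [pow_succ, ← div_div] at h1
            linarith
          · refine le_trans (Prog.ex_le_of_ens (Prog.Ens.of_forall fun o _ _ => ?_)) le_self_add
            split_ifs <;> simp
    _ ≤ k * ((n + 2) * δ) + (n + 1) * δ := by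
        rw [Prog.ex_add, Prog.ex_const]
        gcongr
    _ = _ := by ring

/-- Three of the 60 powers of `n + d` absorb the polynomial number of failure events. -/
theorem fail_bound {n d : ℕ} (hn : 1 ≤ n) (hd : 1 ≤ d) :
    ((Nat.clog 2 (Nat.clog 2 d) : ℝ≥0∞) * (n + 2) + (n + 1)) *
        ENNReal.ofReal (Real.exp (-(60 * Real.log (n + d)))) ≤
      ENNReal.ofReal ((((n : ℝ) + d) ^ 57)⁻¹) := by
  have hn' : (1 : ℝ) ≤ n := by exact_mod_cast hn
  have hd' : (1 : ℝ) ≤ d := by exact_mod_cast hd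
  have hM : 0 < (n : ℝ) + d := by linarith
  set k := Nat.clog 2 (Nat.clog 2 d) with hk
  have hkd : (k : ℝ) ≤ d := by
    have h1 : k ≤ Nat.clog 2 d := Nat.clog_le_of_le_pow Nat.lt_two_pow_self.le
    have h2 : Nat.clog 2 d ≤ d := Nat.clog_le_of_le_pow Nat.lt_two_pow_self.le
    exact_mod_cast h1.trans h2
  have h1 : ((k : ℝ≥0∞) * (n + 2) + (n + 1)) =
      ENNReal.ofReal ((k * (n + 2) + (n + 1) : ℕ) : ℝ) := by
    rw [ENNReal.ofReal_natCast]
    push_cast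
    ring
  rw [h1, ← ENNReal.ofReal_mul (Nat.cast_nonneg _)]
  refine ENNReal.ofReal_le_ofReal ?_
  have h2 : Real.exp (-(60 * Real.log ((n : ℝ) + d))) = (((n : ℝ) + d) ^ 60)⁻¹ := by
    rw [Real.exp_neg, mul_comm, Real.exp_mul, Real.exp_log hM]
    norm_cast
  rw [h2, ← div_eq_mul_inv, div_le_iff₀ (by positivity), inv_mul_eq_div,
    show 60 = 3 + 57 by norm_num, pow_add, mul_div_cancel_right₀ _ (by positivity)]
  push_cast
  have h3 : (k : ℝ) * (n + 2) ≤ d * (n + 2) := mul_le_mul_of_nonneg_right hkd (by linarith)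
  have h4 : (d : ℝ) * (n + 2) + (n + 1) ≤ 6 * (n * d) := by nlinarith
  have h5 : 6 * ((n : ℝ) * d) ≤ (n + d) ^ 3 := by
    have : 4 * ((n : ℝ) * d) ≤ (n + d) ^ 2 := by nlinarith [sq_nonneg ((n : ℝ) - d)]
    have h6 : 2 * ((n : ℝ) + d) ^ 2 ≤ (n + d) ^ 3 := by
      rw [pow_succ _ 2, mul_comm]
      gcongr
      linarith
    linarith [mul_nonneg (show (0 : ℝ) ≤ n by linarith) (show (0 : ℝ) ≤ d by linarith)]
  linarith

theorem LinOracle.aggregate (hO : LinOracle X O) :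
    LinOracle (fun _ : Fin 1 => feasibleSet X) fun _ y => ∑ c, O c y where
  convex _ := by
    rintro _ ⟨s, hs, rfl⟩ _ ⟨s', hs', rfl⟩ a b ha hb hab
    refine ⟨fun c => a • s c + b • s' c, fun c => hO.convex c (hs c) (hs' c) ha hb hab, ?_⟩
    rw [Finset.smul_sum, Finset.smul_sum, Finset.sum_add_distrib]
  nonneg _ _ hz := feasibleSet_nonneg hO hz
  mem _ y hy := sum_mem_feasibleSet fun c => hO.mem c y hy
  le _ y hy := by
    rintro _ ⟨s, hs, rfl⟩
    rw [dotProduct_sum, dotProduct_sum]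
    exact Finset.sum_le_sum fun c _ => hO.le c y hy _ (hs c)

theorem feasibleSet_one (S : Set (Fin d → ℝ)) : feasibleSet (fun _ : Fin 1 => S) = S := by
  ext z
  constructor
  · rintro ⟨s, hs, rfl⟩
    simpa using hs 0
  · exact fun hz => ⟨fun _ => z, fun _ => hz, by simp⟩

/-- The randomized algorithm, followed by its derandomized version for one customer if it fails. -/
noncomputable def fullProg (n d : ℕ) (ε : ℝ) : Prog n d (Fin d → ℝ) :=
  (mainProg n d ε).bind fun o => o.elim
    ((mainProg 1 d ε).aggregate.bind fun o' => .ret (o'.getD 0)) .ret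

theorem callBound_one_le {n d : ℕ} {ε : ℝ} (hn : 1 ≤ n) (hd : 1 ≤ d) (hε : 0 < ε) (hε1 : ε ≤ 1)
    {K : ℝ} (hK : 0 ≤ K) : callBound K 1 d ε ≤ callBound K n d ε ∧ 0 ≤ callBound K n d ε := by
  obtain ⟨hD1, hE1⟩ := half_inv_sq_le hd hε hε1
  have hn' : (1 : ℝ) ≤ n := by exact_mod_cast hn
  have hd' : (1 : ℝ) ≤ d := by exact_mod_cast hd
  have hD : 0 ≤ (ε ^ 2)⁻¹ + Real.log (Real.log d) := by linarith
  have hlog : 0 ≤ Real.log (1 + (d : ℝ)) := Real.log_nonneg (by linarith)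
  have hlog' : 0 ≤ Real.log ((n : ℝ) + d) := Real.log_nonneg (by linarith)
  unfold callBound
  refine ⟨?_, by positivity⟩
  push_cast
  gcongr

/-- For one merged customer the failure probability is below one, hence failure is impossible and
the default of `getD` is never used. -/
theorem ens_fallback (hN : SmoothNorm N Ψ g) (hO : LinOracle X O) (hn : 1 ≤ n) (hd : 1 ≤ d)
    {ε : ℝ} (hε : 0 < ε) (hε1 : ε ≤ 1) :
    Prog.Ens g O ((mainProg 1 d ε).aggregate.bind fun o' => .ret (o'.getD 0)) fun x i j =>
      (x ∈ feasibleSet X ∧ ∀ z ∈ feasibleSet X, N x ≤ (1 + ε) * N z) ∧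
        (i : ℝ) ≤ callBound 400000000 n d ε ∧ (j : ℝ) ≤ n * callBound 400000000 n d ε := by
  have hb := (callBound_one_le (K := 400000000) hn hd hε hε1 (by norm_num)).1
  refine Prog.ens_bind.2 (Prog.Ens.aggregate ?_)
  have hprob : Prog.ex g (fun _ y => ∑ c, O c y) (mainProg 1 d ε)
      (fun o => if o.isNone then 1 else 0) < 1 := by
    refine ((ex_mainProg_le hN hO.aggregate le_rfl hd hε hε1).trans
      (fail_bound le_rfl hd)).trans_lt ?_
    rw [← ENNReal.ofReal_one]
    refine (ENNReal.ofReal_lt_ofReal_iff one_pos).2 (inv_lt_one_of_one_lt₀ ?_)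
    refine one_lt_pow₀ ?_ (by norm_num)
    have : (1 : ℝ) ≤ d := by exact_mod_cast hd
    push_cast
    linarith
  refine ((ens_mainProg hN hO.aggregate le_rfl hd hε hε1).and
    (Prog.ens_lt_one_of_ex_lt_one hprob)).mono ?_
  rintro o i j ⟨⟨h1, h2, h3⟩, h4⟩
  cases o with
  | none => simp at h4
  | some x =>
    rw [feasibleSet_one] at h1
    refine ⟨h1 x rfl, ?_, ?_⟩
    · simpa using h2.trans hb
    · push_cast
      rw [add_zero]
      exact mul_le_mul_of_nonneg_left (h3.trans hb) (Nat.cast_nonneg n)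

theorem ens_fullProg (hN : SmoothNorm N Ψ g) (hO : LinOracle X O) (hn : 1 ≤ n) (hd : 1 ≤ d)
    {ε : ℝ} (hε : 0 < ε) (hε1 : ε ≤ 1) :
    Prog.Ens g O (fullProg n d ε) fun x i j =>
      (x ∈ feasibleSet X ∧ ∀ z ∈ feasibleSet X, N x ≤ (1 + ε) * N z) ∧
        (i : ℝ) ≤ callBound 800000000 n d ε ∧ (j : ℝ) ≤ n * callBound 800000000 n d ε := by
  have hb := (callBound_one_le (K := 400000000) hn hd hε hε1 (by norm_num)).2
  have hn' : (1 : ℝ) ≤ n := by exact_mod_cast hn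
  have h2 : callBound 800000000 n d ε = 2 * callBound 400000000 n d ε := by
    unfold callBound
    ring
  have hnb : callBound 400000000 n d ε ≤ n * callBound 400000000 n d ε :=
    le_mul_of_one_le_left hb hn'
  refine Prog.ens_bind.2 ((ens_mainProg hN hO hn hd hε hε1).mono ?_)
  rintro o i j ⟨h3, h4, h5⟩
  rw [h2]
  cases o with
  | none =>
    refine (ens_fallback hN hO hn hd hε hε1).mono ?_
    rintro x i' j' ⟨h6, h7, h8⟩
    refine ⟨h6, ?_, ?_⟩
    · push_cast
      linarith
    · push_cast
      linarith
  | some x =>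
    refine ⟨h3 x rfl, ?_, ?_⟩
    · push_cast
      linarith
    · push_cast
      linarith

/-- `mainProg` surely stays within half of the bound, so exceeding it requires the fallback and thus
a failure. -/
theorem toOuterMeasure_fullProg_le (hN : SmoothNorm N Ψ g) (hO : LinOracle X O) (hn : 1 ≤ n)
    (hd : 1 ≤ d) {ε : ℝ} (hε : 0 < ε) (hε1 : ε ≤ 1) :
    ((fullProg n d ε).toAlg.run g O).toOuterMeasure
        {o | callBound 800000000 n d ε < (o.oracleCalls : ℝ)} ≤
      ENNReal.ofReal ((((n : ℝ) + d) ^ 57)⁻¹) := by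
  have hb := (callBound_one_le (K := 400000000) hn hd hε hε1 (by norm_num)).2
  have h2 : callBound 800000000 n d ε = 2 * callBound 400000000 n d ε := by
    unfold callBound
    ring
  refine (Prog.toOuterMeasure_run_bind_le (f := fun o => if o.isNone then 1 else 0)
    (E := fun _ _ j => callBound 800000000 n d ε < (j : ℝ)) ?_).trans
    ((ex_mainProg_le hN hO hn hd hε hε1).trans (fail_bound hn hd))
  refine (ens_mainProg hN hO hn hd hε hε1).mono ?_
  rintro o i j ⟨-, -, h5⟩
  cases o with
  | none => exact Or.inl (by simp)
  | some x =>
    refine Or.inr ?_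
    simp only [Option.elim, Prog.Ens, add_zero, not_lt]
    linarith

end Main

theorem IsOrderedWeight.one_le {d : ℕ} {β : Fin d → ℝ} (hβ : IsOrderedWeight β) : 1 ≤ d := by
  rcases Nat.eq_zero_or_pos d with rfl | h
  · simpa using hβ.sum_eq_one
  · exact h

/-- There are an absolute constant `K` and a family of randomized oracle algorithms, depending only on
`n`, `d` and `ε`, that always return a `(1 + ε)`-approximate minimizer of the ordered norm, always
respect the bounds on gradient evaluations and oracle calls, and exceed the smaller bound on oracle
calls only with the stated probability. -/
theorem mainTheorem5 :
    ∃ K : ℝ, 0 < K ∧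
    ∃ alg : (n d : ℕ) → ℝ → OracleAlgorithm n d,
      ∀ (n d : ℕ) (ε : ℝ), 1 ≤ n → 0 < ε → ε ≤ 1 →
      ∀ β : Fin d → ℝ, IsOrderedWeight β →
      ∀ Ψ : (Fin d → ℝ) → ℝ, IsNormApprox (Real.log d) 1 β Ψ →
      ∀ X : Fin n → Set (Fin d → ℝ), (∀ c, IsCustomerSet (X c)) →
      ∀ L : Fin n → (Fin d → ℝ) → (Fin d → ℝ), (∀ c, IsLinearMinOracle (X c) (L c)) →
        (∀ o ∈ ((alg n d ε).run (orthantGradient Ψ) L).support,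
          o.solution ∈ feasibleSet X ∧
          orderedNorm β o.solution ≤ (1 + ε) * optValue β X ∧
          (o.gradientEvals : ℝ) ≤ callBound K n d ε ∧
          (o.oracleCalls : ℝ) ≤ n * callBound K n d ε) ∧
        ((alg n d ε).run (orthantGradient Ψ) L).toOuterMeasure
            {o | callBound K n d ε < (o.oracleCalls : ℝ)} ≤
          ENNReal.ofReal ((((n : ℝ) * (d : ℝ)) ^ 18)⁻¹) := by
  refine ⟨800000000, by norm_num, fun n d ε => (fullProg n d ε).toAlg, ?_⟩
  intro n d ε hn hε hε1 β hβ Ψ hΨ X hX L hL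
  have hN := hΨ.smoothNorm hβ
  have hO := linOracle_of_isLinearMinOracle hX hL
  have hd := hβ.one_le
  have hn' : (1 : ℝ) ≤ n := by exact_mod_cast hn
  have hd' : (1 : ℝ) ≤ d := by exact_mod_cast hd
  refine ⟨fun o ho => ?_, ?_⟩
  · obtain ⟨⟨h1, h2⟩, h3, h4⟩ := (ens_fullProg hN hO hn hd hε hε1).toAlg o ho
    refine ⟨h1, ?_, h3, h4⟩
    -- The infimum need not be attained, so the comparison with every feasible point is turned into
    -- a lower bound of the value set.
    rw [← div_le_iff₀' (by linarith)]
    refine le_csInf ⟨_, _, h1, rfl⟩ ?_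
    rintro _ ⟨z, hz, rfl⟩
    rw [div_le_iff₀' (by linarith)]
    exact h2 z hz
  · refine (toOuterMeasure_fullProg_le hN hO hn hd hε hε1).trans (ENNReal.ofReal_le_ofReal ?_)
    refine inv_anti₀ (by positivity) ?_
    have h1 : (n : ℝ) * d ≤ (n + d) ^ 2 := by nlinarith
    calc ((n : ℝ) * d) ^ 18 ≤ (((n : ℝ) + d) ^ 2) ^ 18 := by gcongr
      _ = ((n : ℝ) + d) ^ 36 := by rw [← pow_mul]
      _ ≤ ((n : ℝ) + d) ^ 57 := pow_le_pow_right₀ (by linarith) (by norm_num)
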